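/- Let $(n,m)\in\{(2,2),(3,4),(5,8)\}$ and $\hbar>0$. For vectors $a,b\in\mathbb C^k$ write $a\cdot b=\sum_s a_s\overline{b_s}$. Let $L^2(S^n)$ be the complex Hilbert space of square integrable functions on the unit sphere $S^n\subset\mathbb R^{n+1}$ with respect to the normalized surface measure $d\Omega$, with $\langle\phi,\psi\rangle=\int_{S^n}\phi\,\overline{\psi}\,d\Omega$, and let $$d\mu_\hbar(u)=(\pi\hbar)^{-m}e^{-|u|^2/\hbar}\,du$$ on $\mathbb C^m$, where $du$ is Lebesgue measure on $\mathbb C^m\simeq\mathbb R^{2m}$. Define $\rho:\mathbb C^m\to\mathbb C^{n+1}$ by * $(n,m)=(2,2)$: $\rho(z)=\big(\tfrac12(z_2^2-z_1^2),\ \tfrac i2(z_1^2+z_2^2),\ z_1z_2\big)$; * $(n,m)=(3,4)$: $\rho(z)=\big(z_1z_3+z_2z_4,\ i(z_1z_3-z_2z_4),\ i(z_1z_4+z_2z_3),\ z_1z_4-z_2z_3\big)$; * $(n,m)=(5,8)$: $\rho(z)=(\rho_1,\dots,\rho_6)$ with $\rho_1=i(-z_1z_6+z_3z_8+z_2z_5-z_4z_7)$,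 $\rho_2=z_1z_6+z_3z_8+z_2z_5+z_4z_7$, $\rho_3=z_2z_6+z_3z_7-z_1z_5-z_4z_8$, $\rho_4=i(-z_1z_5+z_4z_8-z_2z_6+z_3z_7)$, $\rho_5=i(-z_1z_8-z_2z_7-z_3z_6-z_4z_5)$, $\rho_6=z_1z_8+z_2z_7-z_3z_6-z_4z_5$. For $z\in\mathbb C^m$ let $\Phi_z\in L^2(S^n)$ be the coherent state $$\Phi_z(x)=\sum_{\ell=0}^\infty\frac{\sqrt{2\ell+n-1}}{\ell!\,\sqrt{n-1}}\Big(\frac{x\cdot\rho(z)}{\hbar}\Big)^{\ell},\qquad x\in S^n,$$ and for $\psi\in L^2(S^n)$ let $$\mathbf B_{S^n}\psi(z)=\int_{S^n}\Big(\sum_{\ell=0}^\infty\frac{\sqrt{2\ell+n-1}}{\ell!\,\sqrt{n-1}}\Big(\frac{\rho(z)\cdot x}{\hbar}\Big)^{\ell}\Big)\psi(x)\,d\Omega(x),\qquad Q_m(z,w)=\mathbf B_{S^n}\Phi_w(z).$$ For a bounded linear operator $A$ on $L^2(S^n)$ define its Berezin symbol and its extended Berezin symbol by $$\mathfrak B(A)(z)=\frac{\langle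 A\Phi_z,\Phi_z\rangle}{\langle\Phi_z,\Phi_z\rangle},\qquad \mathfrak B(A)(w,z)=\frac{\langle A\Phi_z,\Phi_w\rangle}{\langle\Phi_z,\Phi_w\rangle},$$ the latter wherever $\langle\Phi_z,\Phi_w\rangle\neq0$; since $\langle\Phi_z,\Phi_w\rangle=Q_m(w,z)=\overline{Q_m(z,w)}$, this means wherever $Q_m(z,w)\ne 0$. Then for all bounded linear operators $A,B$ on $L^2(S^n)$ the following hold. 0. For every $z\in\mathbb C^m$ one has $Q_m(z,u)\neq0$ and $Q_m(u,z)\ne0$ for $\mu_\hbar$-almost every $u$; hence the integrands in 3 and 4 are defined almost everywhere. 1. $\mathfrak B(\mathrm{Id})(z)=1$ for all $z\in\mathbb C^m$, and $\mathfrak B(\mathrm{Id})(z,w)=1$ whenever $Q_m(z,w)\neq0$. 2. $\mathfrak B(A^*)(z,w)=\overline{\mathfrak B(A)(w,z)}$ whenever $Q_m(z,w)\ne0$. 3. For all $\phi\in L^2(S^n)$ and $z\in\mathbb C^m$, $$\mathbf B_{S^n}(A\phi)(z)=\int_{\mathbb C^m}\mathbf B_{S^n}\phi(u)\,\mathfrak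 B(A)(z,u)\,Q_m(z,u)\,d\mu_\hbar(u).$$ 4. For all $z,w\in\mathbb C^m$ with $Q_m(z,w)\neq0$, $$\mathfrak B(AB)(z,w)=\int_{\mathbb C^m}\mathfrak B(B)(u,w)\,\mathfrak B(A)(z,u)\,\frac{Q_m(z,u)\,Q_m(u,w)}{Q_m(z,w)}\,d\mu_\hbar(u).$$ The integrals in 3 and 4 converge absolutely. -/

import Mathlib

open MeasureTheory
open scoped ComplexConjugate

noncomputable section

namespace SphereBerezin

/-- The three admissible pairs `(n, m) = (2, 2), (3, 4), (5, 8)`. -/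
inductive SphereCase
  | two
  | three
  | five

/-- The dimension `n` of the sphere. -/
def SphereCase.n : SphereCase → ℕ
  | .two => 2
  | .three => 3
  | .five => 5

/-- The dimension `m` of the phase space `ℂ^m`. -/
def SphereCase.m : SphereCase → ℕ
  | .two => 2
  | .three => 4
  | .five => 8

/-- The map `ρ_{(2,2)} : ℂ² → ℂ³` (coordinates are numbered from `0` in the code). -/
def rho22 (z : Fin 2 → ℂ) : Fin 3 → ℂ :=
  ![(1 / 2) * (z 1 ^ 2 - z 0 ^ 2),
    (Complex.I / 2) * (z 0 ^ 2 + z 1 ^ 2),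
    z 0 * z 1]

/-- The map `ρ_{(3,4)} : ℂ⁴ → ℂ⁴`. -/
def rho34 (z : Fin 4 → ℂ) : Fin 4 → ℂ :=
  ![z 0 * z 2 + z 1 * z 3,
    Complex.I * (z 0 * z 2 - z 1 * z 3),
    Complex.I * (z 0 * z 3 + z 1 * z 2),
    z 0 * z 3 - z 1 * z 2]

/-- The map `ρ_{(5,8)} : ℂ⁸ → ℂ⁶`. -/
def rho58 (z : Fin 8 → ℂ) : Fin 6 → ℂ :=
  ![Complex.I * (-(z 0 * z 5) + z 2 * z 7 + z 1 * z 4 - z 3 * z 6),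
    z 0 * z 5 + z 2 * z 7 + z 1 * z 4 + z 3 * z 6,
    z 1 * z 5 + z 2 * z 6 - z 0 * z 4 - z 3 * z 7,
    Complex.I * (-(z 0 * z 4) + z 3 * z 7 - z 1 * z 5 + z 2 * z 6),
    Complex.I * (-(z 0 * z 7) - z 1 * z 6 - z 2 * z 5 - z 3 * z 4),
    z 0 * z 7 + z 1 * z 6 - z 2 * z 5 - z 3 * z 4]

/-- The map `ρ_{(n,m)} : ℂ^m → ℂ^{n+1}`. -/
def rho : (c : SphereCase) → (Fin c.m → ℂ) → (Fin (c.n + 1) → ℂ)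
  | .two => rho22
  | .three => rho34
  | .five => rho58

/-- The pairing `z · w = ∑ z_s conj(w_s)`. -/
def cdot {k : ℕ} (z w : Fin k → ℂ) : ℂ := ∑ s, z s * conj (w s)

/-- The unit sphere `S^n` in `ℝ^{n+1}`. -/
abbrev Sph (n : ℕ) : Type := Metric.sphere (0 : EuclideanSpace ℝ (Fin (n + 1))) 1

/-- The point `x ∈ S^n ⊆ ℝ^{n+1}`, regarded as a vector of `ℂ^{n+1}`. -/
def Sph.toC {n : ℕ} (x : Sph n) : Fin (n + 1) → ℂ :=
  fun j => (((x : EuclideanSpace ℝ (Fin (n + 1))) j : ℝ) : ℂ)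

/-- The normalized surface measure `dΩ` on `S^n`. -/
def sphMeasure (n : ℕ) : Measure (Sph n) :=
  ((volume : Measure (EuclideanSpace ℝ (Fin (n + 1)))).toSphere Set.univ)⁻¹ •
    (volume : Measure (EuclideanSpace ℝ (Fin (n + 1)))).toSphere

instance (n : ℕ) : IsProbabilityMeasure (sphMeasure n) := by
  refine ⟨?_⟩
  rw [sphMeasure, Measure.smul_apply, smul_eq_mul]
  refine ENNReal.inv_mul_cancel ?_ (measure_ne_top _ _)
  rw [Ne, Measure.measure_univ_eq_zero]
  exact Measure.toSphere_ne_zero _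

/-- The Hilbert space `L²(S^n)`. Mathlib's inner product is conjugate-linear in its first
argument: `⟨φ, ψ⟩ = ∫ φ conj(ψ) dΩ` is `inner ℂ ψ φ`. -/
abbrev L2 (n : ℕ) : Type := Lp ℂ 2 (sphMeasure n)

/-- The inner product `⟨φ, ψ⟩ = ∫ φ conj(ψ) dΩ` of `L²(S^n)`. -/
def ip {n : ℕ} (φ ψ : L2 n) : ℂ := inner ℂ ψ φ

/-- The coefficient `√(2ℓ + n - 1) / (ℓ! √(n - 1))`. -/
def coeff (n ℓ : ℕ) : ℝ := √(2 * (ℓ : ℝ) + (n : ℝ) - 1) / ((Nat.factorial ℓ : ℝ) * √((n : ℝ) - 1))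

/-- The coherent state labelled by `α ∈ ℂ^{n+1}`, as a function on `S^n`. -/
def coherentFun (n : ℕ) (ħ : ℝ) (α : Fin (n + 1) → ℂ) (x : Sph n) : ℂ :=
  ∑' ℓ : ℕ, (coeff n ℓ : ℂ) * (cdot x.toC α / (ħ : ℂ)) ^ ℓ

theorem coeff_nonneg (n ℓ : ℕ) : 0 ≤ coeff n ℓ := by
  unfold coeff; positivity

theorem coeff_le (n ℓ : ℕ) : coeff n ℓ ≤ ((n + 3) / √((n : ℝ) - 1)) * (2 ^ ℓ / (Nat.factorial ℓ : ℝ)) := by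
  have h1 : √(2 * (ℓ : ℝ) + (n : ℝ) - 1) ≤ (n + 3) * 2 ^ ℓ := by
    have h2 : (ℓ : ℝ) ≤ 2 ^ ℓ := by exact_mod_cast (Nat.lt_two_pow_self (n := ℓ)).le
    have h3 : (1 : ℝ) ≤ 2 ^ ℓ := one_le_pow₀ (by norm_num)
    have hn : (0 : ℝ) ≤ n := Nat.cast_nonneg n
    have hl : (0 : ℝ) ≤ ℓ := Nat.cast_nonneg ℓ
    refine (Real.sqrt_le_sqrt (y := (2 * (ℓ : ℝ) + n + 1) ^ 2) ?_).trans ?_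
    · nlinarith
    · rw [Real.sqrt_sq (by positivity)]
      nlinarith
  calc coeff n ℓ = √(2 * (ℓ : ℝ) + (n : ℝ) - 1) * ((Nat.factorial ℓ : ℝ)⁻¹ * (√((n : ℝ) - 1))⁻¹) := by
        rw [coeff, div_eq_mul_inv, mul_inv]
    _ ≤ ((n + 3) * 2 ^ ℓ) * ((Nat.factorial ℓ : ℝ)⁻¹ * (√((n : ℝ) - 1))⁻¹) := by gcongr
    _ = _ := by ring

theorem summable_coeff (n : ℕ) (R : ℝ) : Summable fun ℓ : ℕ => coeff n ℓ * |R| ^ ℓ := by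
  refine Summable.of_nonneg_of_le (fun ℓ => mul_nonneg (coeff_nonneg n ℓ) (by positivity))
    (fun ℓ => mul_le_mul_of_nonneg_right (coeff_le n ℓ) (by positivity)) ?_
  refine ((Real.summable_pow_div_factorial (2 * |R|)).mul_left
    ((n + 3) / √((n : ℝ) - 1))).congr fun ℓ => ?_
  rw [mul_pow]; ring

theorem continuous_cdot (n : ℕ) (α : Fin (n + 1) → ℂ) :
    Continuous fun x : Sph n => cdot x.toC α := by
  unfold cdot Sph.toC
  fun_prop

theorem continuous_coherentFun (n : ℕ) (ħ : ℝ) (α : Fin (n + 1) → ℂ) :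
    Continuous (coherentFun n ħ α) := by
  have hc : Continuous fun x : Sph n => cdot x.toC α / (ħ : ℂ) :=
    (continuous_cdot n α).div_const _
  obtain ⟨R, hR⟩ := (isCompact_univ (X := Sph n)).exists_bound_of_continuousOn hc.continuousOn
  refine continuous_tsum (fun ℓ => continuous_const.mul (hc.pow ℓ)) (summable_coeff n R) ?_
  intro ℓ x
  rw [norm_mul, norm_pow, Complex.norm_real, Real.norm_of_nonneg (coeff_nonneg n ℓ)]
  exact mul_le_mul_of_nonneg_left
    (pow_le_pow_left₀ (norm_nonneg _) ((hR x (Set.mem_univ x)).trans (le_abs_self R)) ℓ)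
    (coeff_nonneg n ℓ)

/-- The coherent state labelled by `α ∈ ℂ^{n+1}`, as an element of `L²(S^n)`. -/
def coherent (n : ℕ) (ħ : ℝ) (α : Fin (n + 1) → ℂ) : L2 n :=
  ContinuousMap.toLp 2 (sphMeasure n) ℂ ⟨coherentFun n ħ α, continuous_coherentFun n ħ α⟩

/-- The coherent state `Φ_{ρ(z)}`, `z ∈ ℂ^m`. -/
def Phi (c : SphereCase) (ħ : ℝ) (z : Fin c.m → ℂ) : L2 c.n := coherent c.n ħ (rho c z)

/-- The transformation `B_{S^n}` from `L²(S^n)` to functions on `ℂ^m`. -/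
def bargmann (c : SphereCase) (ħ : ℝ) (ψ : L2 c.n) (z : Fin c.m → ℂ) : ℂ :=
  ∫ x : Sph c.n,
    (∑' ℓ : ℕ, (coeff c.n ℓ : ℂ) * (cdot (rho c z) x.toC / (ħ : ℂ)) ^ ℓ) * ψ x ∂(sphMeasure c.n)

/-- `Q_m(z, w)`, the transform of the coherent state `Φ_{ρ(w)}` evaluated at `z`. -/
def Q (c : SphereCase) (ħ : ℝ) (z w : Fin c.m → ℂ) : ℂ := bargmann c ħ (Phi c ħ w) z

/-- The Gaussian measure `(πħ)^{-m} exp(-|z|²/ħ) dz` on `ℂ^m`. -/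
def gaussMeasure (m : ℕ) (ħ : ℝ) : Measure (Fin m → ℂ) :=
  (volume : Measure (Fin m → ℂ)).withDensity fun z =>
    ENNReal.ofReal (((Real.pi * ħ) ^ m)⁻¹ * Real.exp (-(∑ j, ‖z j‖ ^ 2) / ħ))

/-- The Berezin symbol of a bounded operator on `L²(S^n)`. -/
def symbol (c : SphereCase) (ħ : ℝ) (A : L2 c.n →L[ℂ] L2 c.n) (z : Fin c.m → ℂ) : ℂ :=
  ip (A (Phi c ħ z)) (Phi c ħ z) / ip (Phi c ħ z) (Phi c ħ z)

/-- The extended Berezin symbol `(w, z) ↦ ⟨A Φ_z, Φ_w⟩ / ⟨Φ_z, Φ_w⟩`; it is meaningful where the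
denominator does not vanish. -/
def extSymbol (c : SphereCase) (ħ : ℝ) (A : L2 c.n →L[ℂ] L2 c.n) (w z : Fin c.m → ℂ) : ℂ :=
  ip (A (Phi c ħ z)) (Phi c ħ w) / ip (Phi c ħ z) (Phi c ħ w)

end SphereBerezin

end

noncomputable section

namespace SphereBerezin

/-! ### Gaussian integrals on complex coordinate spaces -/

section

/-! Everything reduces to the resolution of the identity `ip_resolution`: `∫ ⟨φ, Φ_u⟩⟨Φ_u, ψ⟩ dμ(u)
= ⟨φ, ψ⟩`. With `ψ = A* Φ_z` it is the formula for `B(Aφ)(z)`, and with also `φ = B Φ_w`, after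
division by `Q(z, w)`, it is the composition formula. The extended symbol times `Q` is a matrix
element wherever `Q ≠ 0`, so it remains to see that `Q(·, z)` vanishes only on a null set.

Since `Bψ(z) = ⟨ψ, Φ_z⟩`, the resolution of the identity says that the transform is isometric into
`L²(μ)`. For continuous `φ`, `Bφ` is the sum over `ℓ` of a coefficient times the moment `∫
(ρ(z)·x/ħ)^ℓ φ(x) dΩ`. Moments of different degree are orthogonal because `μ` is invariant under
phases, so only the sum of the squared norms has to be found.

The core is a Gaussian integral (`genKernel_eq`): the average of `exp(s(ρ(z)·x + conj(ρ(z)·y))/ħ)`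
is `(1 - 2rt + r²)^(-(n-1)/2)` with `r = s²` and `t = x·y`, the generating function of the
Gegenbauer polynomials. The reason is that `ρ(z)·x` is a bilinear form (for `n = 2`, half a
quadratic form) whose matrix `M(x)` satisfies the Clifford relation `M(x)M(y)* + M(y)M(x)* = 2t`.
Integrating half of the variables leaves a Gaussian with matrix `M(x)M(y)* = t + iH`, where `H` is
Hermitian and traceless with `H² = 1 - t²`; its eigenvalues give the product. For `n = 2` two copies
of the integral combine into a bilinear one, and the square root is fixed by continuity in `s`.

Applying `1 + (2/(n-1)) r d/dr` turns the generating function into the Poisson kernel and multiplies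
its `ℓ`-th coefficient by `(2ℓ+n-1)/(n-1)`, which is where the square roots in `Φ_z` come from. The
Poisson kernel is an approximate identity as `r → 1`; its mass is one because `ρ(z)` is a null
vector, so positive powers of `ρ(z)·x` have mean zero on the sphere. An Abel limit with nonnegative
terms gives `hasSum_integral_norm_sq`, and density of the continuous functions extends the isometry
to `L²`.

For the zeros of `Q`: `Q(0, z) = 1`, and `Q` is analytic along each real line through the origin, so
it vanishes on a null subset of each line; Fubini does the rest. -/

theorem measurePreserving_of_gaussian_invariant {E : Type*} [NormedAddCommGroup E] [NormedSpace ℝ E]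
    [FiniteDimensional ℝ E] [MeasurableSpace E] [BorelSpace E] (ν : Measure E)
    [ν.IsAddHaarMeasure] (N : E → ℝ) (hN : Continuous N)
    (hint : Integrable (fun x => Real.exp (-N x)) ν) (L : E →ₗ[ℝ] E)
    (hinj : Function.Injective L) (hL : ∀ x, N (L x) = N x) :
    MeasurePreserving L ν ν := by
  have hLc : Continuous L := L.continuous_of_finiteDimensional
  refine ⟨hLc.measurable, ?_⟩
  have hdet : LinearMap.det L ≠ 0 := by
    have h2 : IsUnit L := (LinearMap.isUnit_iff_ker_eq_bot L).2 (LinearMap.ker_eq_bot.2 hinj)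
    exact (h2.map (LinearMap.det : (E →ₗ[ℝ] E) →* ℝ)).ne_zero
  have hmap := Measure.map_linearMap_addHaar_eq_smul_addHaar ν hdet
  set c := ENNReal.ofReal |(LinearMap.det L)⁻¹|
  have hm : Measurable fun x => ENNReal.ofReal (Real.exp (-N x)) := by
    fun_prop
  -- Pushing forward scales `ν` by a constant `c`. Testing on `exp(-N)`, which `L` fixes and whose
  -- integral is finite and nonzero, forces `c = 1` without computing a determinant.
  have h1 : ∫⁻ x, ENNReal.ofReal (Real.exp (-N x)) ∂(Measure.map L ν) =
      ∫⁻ x, ENNReal.ofReal (Real.exp (-N x)) ∂ν := by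
    rw [lintegral_map hm hLc.measurable]
    simp only [hL]
  rw [hmap, lintegral_smul_measure, smul_eq_mul] at h1
  set I := ∫⁻ x, ENNReal.ofReal (Real.exp (-N x)) ∂ν
  have hI : I ≠ ⊤ := by
    have := hint.lintegral_lt_top
    exact this.ne
  have hI0 : I ≠ 0 := by
    rw [Ne, lintegral_eq_zero_iff hm]
    intro h
    have h3 : ν Set.univ = 0 := by
      rw [Filter.EventuallyEq, ae_iff] at h
      convert h
      ext x
      simp [Real.exp_pos]
    exact (NeZero.ne (ν Set.univ)) h3
  have hc : c = 1 := by
    have : c * I = 1 * I := by rw [h1, one_mul]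
    exact (ENNReal.mul_left_inj hI0 hI).1 this
  rw [hmap, hc, one_smul]

/-- Real and imaginary parts separate into two one-dimensional Gaussians. Their square-root
prefactors are equal and multiply to `π / p`, so no branch survives, and the exponents add up
because `(β + γ)² - (β - γ)² = 4βγ`. -/
theorem integral_gaussian_plane {p : ℂ} (hp : 0 < p.re) (β γ : ℂ) :
    ∫ z : ℂ, Complex.exp (-p * (‖z‖ ^ 2 : ℝ) + β * z + γ * conj z) =
      (Real.pi / p) * Complex.exp (β * γ / p) := by
  have hp0 : p ≠ 0 := by rintro rfl; simp at hp
  rw [← Complex.volume_preserving_equiv_real_prod.symm.integral_comp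
    Complex.measurableEquivRealProd.symm.measurableEmbedding]
  have h : ∀ x : ℝ × ℝ, Complex.exp (-p * (‖Complex.measurableEquivRealProd.symm x‖ ^ 2 : ℝ) +
      β * Complex.measurableEquivRealProd.symm x +
      γ * conj (Complex.measurableEquivRealProd.symm x)) =
      Complex.exp (-p * x.1 ^ 2 + (β + γ) * x.1 + 0) *
        Complex.exp (-p * x.2 ^ 2 + (Complex.I * (β - γ)) * x.2 + 0) := by
    rintro ⟨x, y⟩
    have : Complex.measurableEquivRealProd.symm (x, y) = x + y * Complex.I := by
      apply Complex.ext <;> simp [Complex.measurableEquivRealProd]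
    rw [this, ← Complex.exp_add, ← Complex.normSq_eq_norm_sq, Complex.normSq_add_mul_I]
    congr 1
    simp
    ring
  simp_rw [h]
  rw [Measure.volume_eq_prod, integral_prod_mul (fun x : ℝ => Complex.exp (-p * x ^ 2 + (β + γ) * x + 0))
    (fun x : ℝ => Complex.exp (-p * x ^ 2 + (Complex.I * (β - γ)) * x + 0))]
  have hp' : (-p).re < 0 := by simpa using hp
  rw [integral_cexp_quadratic hp', integral_cexp_quadratic hp']
  have h2 : (↑Real.pi / - -p) ^ (1 / 2 : ℂ) * (↑Real.pi / - -p) ^ (1 / 2 : ℂ) = Real.pi / p := by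
    have : (Real.pi : ℂ) / - -p ≠ 0 := by
      simp [Real.pi_ne_zero, hp0]
    rw [← Complex.cpow_add _ _ this]
    norm_num
  rw [mul_mul_mul_comm, h2, ← Complex.exp_add]
  congr 2
  field_simp
  ring_nf
  rw [Complex.I_sq]
  ring

theorem integral_gaussian_pi {ι : Type*} [Fintype ι] {p : ι → ℂ} (hp : ∀ i, 0 < (p i).re)
    (β γ : ι → ℂ) :
    ∫ z : ι → ℂ, Complex.exp (∑ i, (-p i * (‖z i‖ ^ 2 : ℝ) + β i * z i + γ i * conj (z i))) =
      ∏ i, ((Real.pi / p i) * Complex.exp (β i * γ i / p i)) := by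
  simp_rw [Complex.exp_sum]
  rw [integral_fintype_prod_volume_eq_prod (fun i (z : ℂ) =>
    Complex.exp (-p i * (‖z‖ ^ 2 : ℝ) + β i * z + γ i * conj z))]
  simp_rw [integral_gaussian_plane (hp _)]

theorem integrable_gaussian_pi {ι : Type*} [Fintype ι] {a : ℝ} (ha : 0 < a) :
    Integrable fun z : ι → ℂ => Real.exp (-(a * ∑ i, ‖z i‖ ^ 2)) := by
  have h := integral_gaussian_pi (ι := ι) (p := fun _ => (a : ℂ)) (fun _ => by simpa using ha) 0 0
  have h2 : Integrable fun z : ι → ℂ => Complex.exp (∑ i, (-(a : ℂ) * (‖z i‖ ^ 2 : ℝ) + 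
      (0 : ι → ℂ) i * z i + (0 : ι → ℂ) i * conj (z i))) := by
    -- A Bochner integral that fails to converge is zero by convention, while the value found above
    -- is a nonzero product.
    by_contra H
    rw [integral_undef H] at h
    refine Finset.prod_ne_zero_iff.2 ?_ h.symm
    intro i _
    simp [Real.pi_ne_zero, ha.ne']
  refine h2.norm.congr (Filter.Eventually.of_forall fun z => ?_)
  simp only
  rw [Complex.norm_exp]
  congr 1
  simp [Finset.mul_sum, -Complex.ofReal_pow]

end

/-! ### Gaussian integrals of bilinear forms with unitary matrices -/

section

open Matrix

section Bilinear
variable {ι : Type*} [Fintype ι]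

theorem sum_norm_sq_eq_dotProduct (v : ι → ℂ) :
    ((∑ i, ‖v i‖ ^ 2 : ℝ) : ℂ) = v ⬝ᵥ star v := by
  simp [dotProduct, Complex.mul_conj, Complex.normSq_eq_norm_sq]

variable [DecidableEq ι]

theorem sum_norm_sq_vecMul {M : Matrix ι ι ℂ} (hM : M * Mᴴ = 1) (a : ι → ℂ) :
    ∑ i, ‖(a ᵥ* M) i‖ ^ 2 = ∑ i, ‖a i‖ ^ 2 := by
  have : ((∑ i, ‖(a ᵥ* M) i‖ ^ 2 : ℝ) : ℂ) = ((∑ i, ‖a i‖ ^ 2 : ℝ) : ℂ) := by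
    rw [sum_norm_sq_eq_dotProduct, sum_norm_sq_eq_dotProduct, star_vecMul, ← dotProduct_mulVec,
      mulVec_mulVec, hM, one_mulVec]
  exact_mod_cast this

theorem sum_norm_sq_mulVec {M : Matrix ι ι ℂ} (hM : M * Mᴴ = 1) (b : ι → ℂ) :
    ∑ i, ‖(M *ᵥ b) i‖ ^ 2 = ∑ i, ‖b i‖ ^ 2 := by
  rw [← vecMul_transpose]
  refine sum_norm_sq_vecMul ?_ b
  have h : Mᵀᴴ = Mᴴᵀ := rfl
  rw [h, ← transpose_mul, mul_eq_one_comm.1 hM, transpose_one]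

/-- Unitarity followed by `2xy ≤ x² + y²` in each coordinate. The constant `1/2` is what lets two
such forms, scaled by `s < 1`, stay below the Gaussian weight. -/
theorem norm_dotProduct_mulVec_le {M : Matrix ι ι ℂ} (hM : M * Mᴴ = 1) (a b : ι → ℂ) :
    ‖a ⬝ᵥ M *ᵥ b‖ ≤ (1 / 2) * (∑ i, ‖a i‖ ^ 2 + ∑ i, ‖b i‖ ^ 2) := by
  rw [← sum_norm_sq_mulVec hM b, ← Finset.sum_add_distrib, Finset.mul_sum]
  refine norm_sum_le_of_le _ fun i _ => ?_
  rw [norm_mul]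
  nlinarith [sq_nonneg (‖a i‖ - ‖(M *ᵥ b) i‖)]

theorem measurePreserving_vecMul {M : Matrix ι ι ℂ} (hM : M * Mᴴ = 1) :
    MeasurePreserving (fun a : ι → ℂ => a ᵥ* M) := by
  refine measurePreserving_of_gaussian_invariant volume (fun z : ι → ℂ => 1 * ∑ i, ‖z i‖ ^ 2)
    (by fun_prop) (integrable_gaussian_pi one_pos) ((vecMulLinear M).restrictScalars ℝ) ?_ ?_
  · intro a b h
    have h2 : a ᵥ* M = b ᵥ* M := h
    have := congrArg (fun v => v ᵥ* Mᴴ) h2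
    simpa [vecMul_vecMul, hM] using this
  · intro a
    simpa using sum_norm_sq_vecMul hM a

/-- The exponent of the Gaussian integral attached to two bilinear forms. -/
def bilinExponent (ħ s : ℝ) (M N : Matrix ι ι ℂ) (p : (ι → ℂ) × (ι → ℂ)) : ℂ :=
  -((∑ i, ‖p.1 i‖ ^ 2 + ∑ i, ‖p.2 i‖ ^ 2 : ℝ) : ℂ) / ħ +
    s / ħ * (p.1 ⬝ᵥ M *ᵥ p.2 + conj (p.1 ⬝ᵥ N *ᵥ p.2))

omit [DecidableEq ι] in
theorem continuous_bilinExponent (ħ s : ℝ) (M N : Matrix ι ι ℂ) :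
    Continuous (bilinExponent ħ s M N) := by
  unfold bilinExponent
  simp only [dotProduct, mulVec]
  fun_prop

theorem integrable_exp_bilinExponent {ħ s : ℝ} (hħ : 0 < ħ) (hs0 : 0 ≤ s) (hs : s < 1)
    {M N : Matrix ι ι ℂ} (hM : M * Mᴴ = 1) (hN : N * Nᴴ = 1) :
    Integrable fun p => Complex.exp (bilinExponent ħ s M N p) := by
  have ha : 0 < (1 - s) / ħ := div_pos (by linarith) hħ
  have h := (integrable_gaussian_pi (ι := ι) ha).mul_prod (integrable_gaussian_pi (ι := ι) ha)
  rw [← Measure.volume_eq_prod] at h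
  refine h.mono' (by
    exact (Complex.continuous_exp.comp (continuous_bilinExponent ħ s M N)).aestronglyMeasurable) ?_
  refine Filter.Eventually.of_forall fun p => ?_
  rw [Complex.norm_exp, ← Real.exp_add]
  refine Real.exp_le_exp.2 ?_
  have h1 := (Complex.re_le_norm _).trans (norm_dotProduct_mulVec_le hM p.1 p.2)
  have h2 := (Complex.re_le_norm _).trans (norm_dotProduct_mulVec_le hN p.1 p.2)
  have h3 : (bilinExponent ħ s M N p).re = -(∑ i, ‖p.1 i‖ ^ 2 + ∑ i, ‖p.2 i‖ ^ 2) / ħ +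
      s / ħ * ((p.1 ⬝ᵥ M *ᵥ p.2).re + (p.1 ⬝ᵥ N *ᵥ p.2).re) := by
    unfold bilinExponent
    rw [Complex.add_re, ← Complex.ofReal_neg, ← Complex.ofReal_div, Complex.ofReal_re,
      ← Complex.ofReal_div, Complex.re_ofReal_mul, Complex.add_re, Complex.conj_re]
  rw [h3]
  have hsh : 0 ≤ s / ħ := by positivity
  calc _ ≤ -(∑ i, ‖p.1 i‖ ^ 2 + ∑ i, ‖p.2 i‖ ^ 2) / ħ +
      s / ħ * (∑ i, ‖p.1 i‖ ^ 2 + ∑ i, ‖p.2 i‖ ^ 2) := by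
        have := mul_le_mul_of_nonneg_left (add_le_add h1 h2) hsh
        linarith
    _ = _ := by field_simp; ring

-- For fixed `a` the exponent is affine in `b` and `conj b` apart from `-|b|²/ħ`, so the plane
-- formula applies with `β = (s/ħ) aM` and `γ = (s/ħ) conj(aN)`; the product `βγħ` sums to the form
-- of `M N*` evaluated at `a`.
omit [DecidableEq ι] in
theorem integral_bilinExponent_inner {ħ s : ℝ} (hħ : 0 < ħ) (M N : Matrix ι ι ℂ) (a : ι → ℂ) :
    ∫ b, Complex.exp (bilinExponent ħ s M N (a, b)) =
      (Real.pi * ħ : ℂ) ^ Fintype.card ι *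
        Complex.exp (-((∑ i, ‖a i‖ ^ 2 : ℝ) : ℂ) / ħ +
          s ^ 2 / ħ * (a ᵥ* (M * Nᴴ) ⬝ᵥ star a)) := by
  have hħ' : (ħ : ℂ) ≠ 0 := by exact_mod_cast hħ.ne'
  have h1 : ∀ b, Complex.exp (bilinExponent ħ s M N (a, b)) =
      Complex.exp (-((∑ i, ‖a i‖ ^ 2 : ℝ) : ℂ) / ħ) *
      Complex.exp (∑ i, (-((1 / ħ : ℝ) : ℂ) * (‖b i‖ ^ 2 : ℝ) + (s / ħ * (a ᵥ* M) i) * b i +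
        (s / ħ * conj ((a ᵥ* N) i)) * conj (b i))) := by
    intro b
    rw [← Complex.exp_add]
    congr 1
    simp only [bilinExponent, Finset.sum_add_distrib, dotProduct_mulVec]
    simp only [dotProduct, map_sum, map_mul, Finset.mul_sum, mul_add, mul_assoc]
    push_cast
    simp only [neg_div, add_div, Finset.sum_div, neg_mul, Finset.sum_neg_distrib, one_div_mul_eq_div, neg_add]
    ring
  simp_rw [h1]
  rw [integral_const_mul, integral_gaussian_pi (fun i => by
    rw [Complex.ofReal_re]; positivity), Finset.prod_mul_distrib, ← Complex.exp_sum,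
    Complex.exp_add]
  have h2 : ∏ _i : ι, ((Real.pi : ℂ) / ((1 / ħ : ℝ) : ℂ)) =
      (Real.pi * ħ : ℂ) ^ Fintype.card ι := by
    rw [Finset.prod_const, Finset.card_univ]
    congr 1
    push_cast
    field_simp
  have h3 : a ᵥ* (M * Nᴴ) ⬝ᵥ star a = ∑ i, (a ᵥ* M) i * conj ((a ᵥ* N) i) := by
    rw [← vecMul_vecMul, ← dotProduct_mulVec, ← star_vecMul]
    rfl
  rw [h2, h3, Finset.mul_sum]
  rw [mul_left_comm]
  congr 3
  refine Finset.sum_congr rfl fun i _ => ?_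
  push_cast
  field_simp

/-- The unitary `U = M N*` satisfies `U + U* = 2t`, hence `U = t + iH` with `H` Hermitian, and `UU*
= 1` becomes `H² = 1 - t²`. Diagonalising `H` decouples the Gaussian integral over `a` into planes.
The numbers `h i` are the eigenvalues of `H`; the trace hypothesis makes them sum to zero, which
later fixes how many have each sign. -/
theorem integral_exp_bilinExponent {ħ s t : ℝ} (hħ : 0 < ħ) (hs0 : 0 ≤ s) (hs : s < 1)
    (ht1 : |t| ≤ 1) {M N : Matrix ι ι ℂ} (hM : M * Mᴴ = 1) (hN : N * Nᴴ = 1)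
    (ht : M * Nᴴ + N * Mᴴ = (2 * t : ℂ) • (1 : Matrix ι ι ℂ))
    (htr : (M * Nᴴ).trace = Fintype.card ι * t) :
    ∃ h : ι → ℝ, (∀ i, h i ^ 2 = 1 - t ^ 2) ∧ ∑ i, h i = 0 ∧
      ∫ p, Complex.exp (bilinExponent ħ s M N p) =
        (Real.pi * ħ : ℂ) ^ (2 * Fintype.card ι) *
          ∏ i, (1 - s ^ 2 * (t + h i * Complex.I))⁻¹ := by
  have hħ' : (ħ : ℂ) ≠ 0 := by exact_mod_cast hħ.ne'
  set U := M * Nᴴ with hU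
  have hUH : Uᴴ = (2 * t : ℂ) • 1 - U := by
    rw [← ht, hU, conjTranspose_mul, conjTranspose_conjTranspose]; abel
  have hUU : U * Uᴴ = 1 := by
    rw [hU, conjTranspose_mul, conjTranspose_conjTranspose, Matrix.mul_assoc,
      ← Matrix.mul_assoc Nᴴ, mul_eq_one_comm.1 hN, Matrix.one_mul, hM]
  set H : Matrix ι ι ℂ := (-Complex.I) • (U - (t : ℂ) • 1) with hH
  have hHH : H.IsHermitian := by
    rw [Matrix.IsHermitian, hH, conjTranspose_smul, conjTranspose_sub, hUH, conjTranspose_smul,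
      conjTranspose_one]
    ext i j
    simp
    ring
  have hUeq : U = (t : ℂ) • 1 + Complex.I • H := by
    rw [hH, smul_smul]
    simp
  have hH2 : H * H = ((1 - t ^ 2 : ℝ) : ℂ) • 1 := by
    have h1 : U * ((2 * t : ℂ) • 1 - U) = 1 := by rw [← hUH, hUU]
    rw [hUeq] at h1
    have h3 : ((t : ℂ) • (1 : Matrix ι ι ℂ) + Complex.I • H) *
        ((2 * t : ℂ) • 1 - ((t : ℂ) • 1 + Complex.I • H)) =
        ((t : ℂ) ^ 2) • (1 : Matrix ι ι ℂ) + H * H := by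
      have : (2 * t : ℂ) • (1 : Matrix ι ι ℂ) - ((t : ℂ) • 1 + Complex.I • H) =
          (t : ℂ) • 1 - Complex.I • H := by
        rw [two_mul, add_smul]; abel
      rw [this]
      simp only [Matrix.add_mul, Matrix.mul_sub, Matrix.smul_mul, Matrix.mul_smul, Matrix.one_mul,
        Matrix.mul_one]
      simp only [smul_add, smul_smul, Complex.I_mul_I]
      rw [neg_one_smul, mul_comm Complex.I (t : ℂ), sq]
      abel
    rw [h3] at h1
    rw [eq_sub_of_add_eq' h1]
    push_cast
    rw [sub_smul, one_smul]
  set V : Matrix ι ι ℂ := (hHH.eigenvectorUnitary : Matrix ι ι ℂ)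
  have hVV : V * Vᴴ = 1 := by
    have := (hHH.eigenvectorUnitary).2
    rw [Matrix.mem_unitaryGroup_iff] at this
    exact this
  have hspec : H = V * diagonal (fun i => (hHH.eigenvalues i : ℂ)) * Vᴴ := by
    have := hHH.spectral_theorem
    rw [Unitary.conjStarAlgAut_apply] at this
    exact this
  have hVV' : Vᴴ * V = 1 := mul_eq_one_comm.1 hVV
  refine ⟨hHH.eigenvalues, ?_, ?_, ?_⟩
  · have hD : diagonal (fun i => (hHH.eigenvalues i : ℂ)) *
        diagonal (fun i => (hHH.eigenvalues i : ℂ)) = ((1 - t ^ 2 : ℝ) : ℂ) • 1 := by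
      have hD1 : diagonal (fun i => (hHH.eigenvalues i : ℂ)) = Vᴴ * H * V := by
        nth_rw 2 [hspec]
        rw [Matrix.mul_assoc, Matrix.mul_assoc (V * _), hVV', Matrix.mul_one, ← Matrix.mul_assoc,
          hVV', Matrix.one_mul]
      rw [hD1]
      calc Vᴴ * H * V * (Vᴴ * H * V) = Vᴴ * H * (V * Vᴴ) * H * V := by
            simp only [Matrix.mul_assoc]
        _ = Vᴴ * (H * H) * V := by rw [hVV, Matrix.mul_one]; simp only [Matrix.mul_assoc]
        _ = _ := by rw [hH2, Matrix.mul_smul, Matrix.smul_mul, Matrix.mul_one, hVV']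
    intro i
    have := congrFun (congrFun hD i) i
    rw [diagonal_mul_diagonal] at this
    simp only [diagonal_apply_eq, Matrix.smul_apply, one_apply_eq, smul_eq_mul, mul_one] at this
    rw [sq]
    exact_mod_cast this
  · have h1 := hHH.trace_eq_sum_eigenvalues
    have h0 : H.trace = 0 := by
      rw [hH, trace_smul, trace_sub, htr, trace_smul, trace_one]
      simp [mul_comm]
    have h2 : (∑ i, (hHH.eigenvalues i : ℂ)) = 0 := by
      exact h1.symm.trans h0
    exact_mod_cast h2
  · have hint := integrable_exp_bilinExponent hħ hs0 hs hM hN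
    rw [Measure.volume_eq_prod] at hint ⊢
    rw [integral_prod _ hint]
    simp_rw [integral_bilinExponent_inner hħ]
    rw [integral_const_mul, two_mul, pow_add, mul_assoc]
    congr 1
    set h := hHH.eigenvalues
    have hst : ∀ i, 0 < ((1 / ħ : ℂ) * (1 - s ^ 2 * (t + h i * Complex.I))).re := by
      intro i
      have : ((1 / ħ : ℂ) * (1 - s ^ 2 * (t + h i * Complex.I))).re =
          (1 / ħ) * (1 - s ^ 2 * t) := by
        rw [← Complex.ofReal_one, ← Complex.ofReal_div, Complex.re_ofReal_mul,
          ← Complex.ofReal_pow, Complex.sub_re, Complex.re_ofReal_mul]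
        simp
      rw [this]
      have : s ^ 2 * t < 1 := by
        have h1 : s ^ 2 < 1 := by nlinarith
        have h2 := (abs_le.1 ht1).2
        nlinarith [sq_nonneg s]
      have h3 : 0 < 1 - s ^ 2 * t := by linarith
      positivity
    -- In the eigenbasis of `H`, that is with `c = aV`, the exponent is diagonal; the change of
    -- variables costs nothing since `V` is unitary.
    have key : ∀ a : ι → ℂ, Complex.exp (-((∑ i, ‖a i‖ ^ 2 : ℝ) : ℂ) / ħ +
          s ^ 2 / ħ * (a ᵥ* U ⬝ᵥ star a)) =
        (fun c : ι → ℂ => Complex.exp (∑ i,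
          (-((1 / ħ : ℂ) * (1 - s ^ 2 * (t + h i * Complex.I))) * (‖c i‖ ^ 2 : ℝ) +
            (0 : ι → ℂ) i * c i + (0 : ι → ℂ) i * conj (c i)))) (a ᵥ* V) := by
      intro a
      have h1 : a ᵥ* U ⬝ᵥ star a = t * ((∑ i, ‖(a ᵥ* V) i‖ ^ 2 : ℝ) : ℂ) +
          Complex.I * ∑ i, (h i : ℂ) * ((‖(a ᵥ* V) i‖ ^ 2 : ℝ) : ℂ) := by
        rw [hUeq, vecMul_add, add_dotProduct, vecMul_smul, vecMul_smul, smul_dotProduct,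
          smul_dotProduct, vecMul_one, smul_eq_mul, smul_eq_mul, sum_norm_sq_vecMul hVV,
          sum_norm_sq_eq_dotProduct]
        congr 2
        rw [hspec, ← vecMul_vecMul, ← dotProduct_mulVec, ← star_vecMul, ← vecMul_vecMul]
        refine Finset.sum_congr rfl fun i _ => ?_
        rw [vecMul_diagonal]
        simp only [Pi.star_apply, RCLike.star_def, ← Complex.normSq_eq_norm_sq,
          ← Complex.mul_conj]
        ring
      rw [h1, ← sum_norm_sq_vecMul hVV a]
      congr 1
      simp only [Pi.zero_apply, zero_mul, add_zero, Complex.ofReal_sum, Finset.mul_sum,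
        ← Finset.sum_neg_distrib, Finset.sum_div, ← Finset.sum_add_distrib]
      refine Finset.sum_congr rfl fun i _ => ?_
      field_simp
      ring
    simp_rw [← hU, key]
    have hc : Continuous (fun c : ι → ℂ => Complex.exp (∑ i,
          (-((1 / ħ : ℂ) * (1 - s ^ 2 * (t + h i * Complex.I))) * (‖c i‖ ^ 2 : ℝ) +
            (0 : ι → ℂ) i * c i + (0 : ι → ℂ) i * conj (c i)))) := by fun_prop
    have hmp := measurePreserving_vecMul hVV
    have hchange := integral_map hmp.measurable.aemeasurable
      (hc.aestronglyMeasurable (μ := Measure.map (fun a : ι → ℂ => a ᵥ* V) volume))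
    rw [hmp.map_eq] at hchange
    refine hchange.symm.trans ?_
    rw [integral_gaussian_pi hst, ← Finset.card_univ,
      ← Finset.prod_const, ← Finset.prod_mul_distrib]
    refine Finset.prod_congr rfl fun i _ => ?_
    have : (1 - s ^ 2 * (t + h i * Complex.I)) ≠ 0 := by
      intro h0
      have := hst i
      rw [h0] at this
      simp at this
    simp
    field_simp

end Bilinear

/-! ### The Gaussian measure, and splitting of the coordinates -/

theorem integral_gaussMeasure (m : ℕ) {ħ : ℝ} (hħ : 0 < ħ) (f : (Fin m → ℂ) → ℂ) :
    ∫ z, f z ∂(gaussMeasure m ħ) = ((Real.pi * ħ : ℂ) ^ m)⁻¹ *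
      ∫ z, Complex.exp (-((∑ j, ‖z j‖ ^ 2 : ℝ) : ℂ) / ħ) * f z := by
  rw [gaussMeasure, integral_withDensity_eq_integral_toReal_smul (by fun_prop)
    (Filter.Eventually.of_forall fun _ => ENNReal.ofReal_lt_top), ← integral_const_mul]
  refine integral_congr_ae (Filter.Eventually.of_forall fun z => ?_)
  simp only
  rw [ENNReal.toReal_ofReal (by positivity), Complex.real_smul]
  push_cast
  ring

theorem integrable_gaussMeasure_iff (m : ℕ) {ħ : ℝ} (hħ : 0 < ħ) (f : (Fin m → ℂ) → ℂ) :
    Integrable f (gaussMeasure m ħ) ↔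
      Integrable fun z => Complex.exp (-((∑ j, ‖z j‖ ^ 2 : ℝ) : ℂ) / ħ) * f z := by
  rw [gaussMeasure, integrable_withDensity_iff_integrable_smul' (by fun_prop)
    (Filter.Eventually.of_forall fun _ => ENNReal.ofReal_lt_top)]
  have hc : ((Real.pi * ħ : ℂ) ^ m)⁻¹ ≠ 0 := by
    have : (Real.pi * ħ : ℂ) ≠ 0 := by
      exact_mod_cast (mul_pos Real.pi_pos hħ).ne'
    exact inv_ne_zero (pow_ne_zero _ this)
  rw [← integrable_const_mul_iff (isUnit_iff_ne_zero.2 hc)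
    (fun z : Fin m → ℂ => Complex.exp (-((∑ j, ‖z j‖ ^ 2 : ℝ) : ℂ) / ħ) * f z)]
  refine integrable_congr (Filter.Eventually.of_forall fun z => ?_)
  simp only
  rw [ENNReal.toReal_ofReal (by positivity), Complex.real_smul]
  push_cast
  ring

theorem integrable_exp_gaussMeasure (m : ℕ) {ħ a : ℝ} (hħ : 0 < ħ) (ha : a < 1) :
    Integrable (fun z => Real.exp (a * (∑ j, ‖z j‖ ^ 2) / ħ)) (gaussMeasure m ħ) := by
  have h : Integrable (fun z : Fin m → ℂ => (Real.exp (a * (∑ j, ‖z j‖ ^ 2) / ħ) : ℂ))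
      (gaussMeasure m ħ) := by
    rw [integrable_gaussMeasure_iff m hħ]
    have := (integrable_gaussian_pi (ι := Fin m) (a := (1 - a) / ħ)
      (div_pos (by linarith) hħ)).ofReal (𝕜 := ℂ)
    refine this.congr (Filter.Eventually.of_forall fun z => ?_)
    simp only [Complex.coe_algebraMap, Complex.ofReal_exp]
    rw [← Complex.exp_add]
    congr 1
    push_cast
    ring
  refine h.norm.congr (Filter.Eventually.of_forall fun z => ?_)
  simp only
  rw [Complex.norm_real, Real.norm_of_nonneg (Real.exp_pos _).le]

theorem integral_one_gaussMeasure (m : ℕ) {ħ : ℝ} (hħ : 0 < ħ) :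
    ∫ _z, (1 : ℂ) ∂(gaussMeasure m ħ) = 1 := by
  rw [integral_gaussMeasure m hħ]
  have h := integral_gaussian_pi (ι := Fin m) (p := fun _ => ((1 / ħ : ℝ) : ℂ))
    (fun _ => by rw [Complex.ofReal_re]; positivity) 0 0
  have hħ' : (ħ : ℂ) ≠ 0 := by exact_mod_cast hħ.ne'
  have h1 : ∀ z : Fin m → ℂ, Complex.exp (-((∑ j, ‖z j‖ ^ 2 : ℝ) : ℂ) / ħ) * 1 =
      Complex.exp (∑ i, (-((1 / ħ : ℝ) : ℂ) * (‖z i‖ ^ 2 : ℝ) + (0 : Fin m → ℂ) i * z i +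
        (0 : Fin m → ℂ) i * conj (z i))) := by
    intro z
    rw [mul_one]
    congr 1
    simp only [Pi.zero_apply, zero_mul, add_zero, Complex.ofReal_sum, ← Finset.sum_neg_distrib,
      Finset.sum_div]
    refine Finset.sum_congr rfl fun i _ => ?_
    push_cast
    ring
  simp_rw [h1]
  rw [h]
  simp only [Pi.zero_apply, zero_mul, zero_div, Complex.exp_zero, mul_one, Finset.prod_const,
    Finset.card_univ, Fintype.card_fin]
  push_cast
  rw [← inv_pow, ← mul_pow]
  have : (Real.pi : ℂ) ≠ 0 := by exact_mod_cast Real.pi_ne_zero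
  field_simp
  exact one_pow _

theorem measurePreserving_append (k l : ℕ) :
    MeasurePreserving (fun p : (Fin k → ℂ) × (Fin l → ℂ) => Fin.append p.1 p.2) := by
  have h1 := (volume_measurePreserving_sumPiEquivProdPi_symm (fun _ : Fin k ⊕ Fin l => ℂ))
  have h2 := volume_measurePreserving_piCongrLeft (fun _ : Fin (k + l) => ℂ) finSumFinEquiv
  have h := h2.comp h1
  suffices he : (fun p : (Fin k → ℂ) × (Fin l → ℂ) => Fin.append p.1 p.2) =
      MeasurableEquiv.piCongrLeft (fun _ : Fin (k + l) => ℂ) finSumFinEquiv ∘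
        (MeasurableEquiv.sumPiEquivProdPi fun _ : Fin k ⊕ Fin l => ℂ).symm from he ▸ h
  funext p i
  refine Fin.addCases (fun j => ?_) (fun j => ?_) i
  · have : (finSumFinEquiv (Sum.inl j) : Fin (k + l)) = Fin.castAdd l j := rfl
    rw [Fin.append_left, ← this, Function.comp_apply, MeasurableEquiv.coe_piCongrLeft,
      Equiv.piCongrLeft_apply_apply]
    rfl
  · have : (finSumFinEquiv (Sum.inr j) : Fin (k + l)) = Fin.natAdd k j := rfl
    rw [Fin.append_right, ← this, Function.comp_apply, MeasurableEquiv.coe_piCongrLeft,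
      Equiv.piCongrLeft_apply_apply]
    rfl

theorem integral_append (k l : ℕ) (f : (Fin (k + l) → ℂ) → ℂ) (hf : Continuous f) :
    ∫ z, f z = ∫ p : (Fin k → ℂ) × (Fin l → ℂ), f (Fin.append p.1 p.2) := by
  have h := measurePreserving_append k l
  rw [← integral_map (f := f) h.measurable.aemeasurable hf.aestronglyMeasurable, h.map_eq]

/-! ### Clifford matrices of the forms `ρ(z)·x` -/

/-- The matrix of the quadratic form `z ↦ 2 ρ(z) · x` on `ℂ²`. -/
def mat2 (x : Fin 3 → ℝ) : Matrix (Fin 2) (Fin 2) ℂ :=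
  !![-(x 0 : ℂ) + Complex.I * x 1, x 2; x 2, x 0 + Complex.I * x 1]

/-- The matrix of the bilinear form `(a, b) ↦ ρ(a, b) · x` on `ℂ² × ℂ²`. -/
def mat3 (x : Fin 4 → ℝ) : Matrix (Fin 2) (Fin 2) ℂ :=
  !![(x 0 : ℂ) + Complex.I * x 1, x 3 + Complex.I * x 2;
    -x 3 + Complex.I * x 2, x 0 - Complex.I * x 1]

/-- The matrix of the bilinear form `(a, b) ↦ ρ(a, b) · x` on `ℂ⁴ × ℂ⁴`. -/
def mat5 (x : Fin 6 → ℝ) : Matrix (Fin 4) (Fin 4) ℂ :=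
  !![-(x 2 : ℂ) - Complex.I * x 3, x 1 - Complex.I * x 0, 0, x 5 - Complex.I * x 4;
    x 1 + Complex.I * x 0, x 2 - Complex.I * x 3, x 5 - Complex.I * x 4, 0;
    0, -x 5 - Complex.I * x 4, x 2 + Complex.I * x 3, x 1 + Complex.I * x 0;
    -x 5 - Complex.I * x 4, 0, x 1 - Complex.I * x 0, -x 2 + Complex.I * x 3]

theorem mat2_clifford (x y : Fin 3 → ℝ) :
    mat2 x * (mat2 y)ᴴ + mat2 y * (mat2 x)ᴴ = (2 * (∑ i, x i * y i : ℝ) : ℂ) • 1 := by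
  ext i j
  simp only [Matrix.add_apply, Matrix.mul_apply, conjTranspose_apply, Fin.sum_univ_two]
  fin_cases i <;> fin_cases j <;>
    simp [mat2, Fin.sum_univ_succ] <;> ring_nf <;> (try simp only [Complex.I_sq]) <;> ring1

/-- The Clifford relation determines only the real part of this trace. That the imaginary part
vanishes as well is what makes `H` traceless, so that the eigenvalues of both signs balance. -/
theorem mat2_trace (x y : Fin 3 → ℝ) :
    (mat2 x * (mat2 y)ᴴ).trace = 2 * (∑ i, x i * y i : ℝ) := by
  simp only [Matrix.trace, Matrix.diag, Matrix.mul_apply, conjTranspose_apply, Fin.sum_univ_two]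
  simp [mat2, Fin.sum_univ_succ]
  ring_nf
  simp only [Complex.I_sq]
  ring

theorem mat3_clifford (x y : Fin 4 → ℝ) :
    mat3 x * (mat3 y)ᴴ + mat3 y * (mat3 x)ᴴ = (2 * (∑ i, x i * y i : ℝ) : ℂ) • 1 := by
  ext i j
  simp only [Matrix.add_apply, Matrix.mul_apply, conjTranspose_apply, Fin.sum_univ_two]
  fin_cases i <;> fin_cases j <;>
    simp [mat3, Fin.sum_univ_succ] <;> ring_nf <;> (try simp only [Complex.I_sq]) <;> ring1

theorem mat3_trace (x y : Fin 4 → ℝ) :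
    (mat3 x * (mat3 y)ᴴ).trace = 2 * (∑ i, x i * y i : ℝ) := by
  simp only [Matrix.trace, Matrix.diag, Matrix.mul_apply, conjTranspose_apply, Fin.sum_univ_two]
  simp [mat3, Fin.sum_univ_succ]
  ring_nf
  simp only [Complex.I_sq]
  ring

theorem mat5_clifford (x y : Fin 6 → ℝ) :
    mat5 x * (mat5 y)ᴴ + mat5 y * (mat5 x)ᴴ = (2 * (∑ i, x i * y i : ℝ) : ℂ) • 1 := by
  ext i j
  simp only [Matrix.add_apply, Matrix.mul_apply, conjTranspose_apply, Fin.sum_univ_four]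
  fin_cases i <;> fin_cases j <;>
    simp [mat5, Fin.sum_univ_succ] <;> ring_nf <;> (try simp only [Complex.I_sq]) <;> ring1

theorem mat5_trace (x y : Fin 6 → ℝ) :
    (mat5 x * (mat5 y)ᴴ).trace = 4 * (∑ i, x i * y i : ℝ) := by
  simp only [Matrix.trace, Matrix.diag, Matrix.mul_apply, conjTranspose_apply, Fin.sum_univ_four]
  simp [mat5, Fin.sum_univ_succ]
  ring_nf
  simp only [Complex.I_sq]
  ring

theorem prod_inv_two {h : Fin 2 → ℝ} {r t : ℝ} (h1 : ∀ i, h i ^ 2 = 1 - t ^ 2)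
    (h2 : ∑ i, h i = 0) :
    ∏ i, (1 - r * (t + h i * Complex.I))⁻¹ = ((1 - 2 * r * t + r ^ 2 : ℝ) : ℂ)⁻¹ := by
  rw [Finset.prod_inv_distrib]
  congr 1
  rw [Fin.sum_univ_two] at h2
  have h3 : h 1 = -h 0 := by linarith
  have h4 : ((h 0 : ℝ) : ℂ) ^ 2 = 1 - t ^ 2 := by exact_mod_cast h1 0
  rw [Fin.prod_univ_two, h3]
  push_cast
  linear_combination (r : ℂ) ^ 2 * h4 - (r ^ 2 * h 0 ^ 2 : ℂ) * Complex.I_sq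

/-- All `h i` equal `± h 0`. With two of each sign the factors pair into conjugates with product `1
- 2rt + r²`; any other distribution of signs is compatible with a zero sum only if `h 0 = 0`. -/
theorem prod_inv_four {h : Fin 4 → ℝ} {r t : ℝ} (h1 : ∀ i, h i ^ 2 = 1 - t ^ 2)
    (h2 : ∑ i, h i = 0) :
    ∏ i, (1 - r * (t + h i * Complex.I))⁻¹ = (((1 - 2 * r * t + r ^ 2) ^ 2 : ℝ) : ℂ)⁻¹ := by
  rw [Finset.prod_inv_distrib]
  congr 1
  rw [Fin.sum_univ_four] at h2
  have h4 : ((h 0 : ℝ) : ℂ) ^ 2 = 1 - t ^ 2 := by exact_mod_cast h1 0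
  have h5 : (1 - r * (t + h 0 * Complex.I)) * (1 - r * (t - h 0 * Complex.I)) =
      ((1 - 2 * r * t + r ^ 2 : ℝ) : ℂ) := by
    push_cast
    linear_combination (r : ℂ) ^ 2 * h4 - (r ^ 2 * h 0 ^ 2 : ℂ) * Complex.I_sq
  have hs : ∀ i, h i = h 0 ∨ h i = -h 0 := fun i => sq_eq_sq_iff_eq_or_eq_neg.1 (by
    rw [h1 i, h1 0])
  rw [Fin.prod_univ_four, Complex.ofReal_pow, ← h5]
  rcases hs 1 with e1 | e1 <;> rcases hs 2 with e2 | e2 <;> rcases hs 3 with e3 | e3 <;>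
    rw [e1, e2, e3] at h2 ⊢ <;> first
    | (push_cast; ring1)
    | (have h0 : h 0 = 0 := by linarith
       rw [h0]; push_cast; ring1)

/-! ### The forms `ρ(z)·x`: bounds, continuity, homogeneity -/

/-- The quadratic form `z ↦ ρ(z) · x` on `ℂ^m`. -/
def qf (c : SphereCase) (x : Sph c.n) (z : Fin c.m → ℂ) : ℂ := cdot (rho c z) x.toC

theorem qf_two (x : Sph 2) (z : Fin 2 → ℂ) :
    qf .two x z = (1 / 2) * (z ⬝ᵥ mat2 (fun i => (x : EuclideanSpace ℝ (Fin 3)) i) *ᵥ z) := by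
  change cdot (rho22 z) x.toC = _
  simp only [cdot, rho22, Sph.toC, mat2, dotProduct, mulVec, Complex.conj_ofReal]
  simp [Fin.sum_univ_succ]
  ring

theorem qf_three (x : Sph 3) (p : (Fin 2 → ℂ) × (Fin 2 → ℂ)) :
    qf .three x (Fin.append p.1 p.2) =
      p.1 ⬝ᵥ mat3 (fun i => (x : EuclideanSpace ℝ (Fin 4)) i) *ᵥ p.2 := by
  have h0 : (Fin.append p.1 p.2 : Fin 4 → ℂ) 0 = p.1 0 := rfl
  have h1 : (Fin.append p.1 p.2 : Fin 4 → ℂ) 1 = p.1 1 := rfl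
  have h2 : (Fin.append p.1 p.2 : Fin 4 → ℂ) 2 = p.2 0 := rfl
  have h3 : (Fin.append p.1 p.2 : Fin 4 → ℂ) 3 = p.2 1 := rfl
  change cdot (rho34 (Fin.append p.1 p.2 : Fin 4 → ℂ)) x.toC = _
  simp only [cdot, rho34, Sph.toC, mat3, dotProduct, mulVec, Complex.conj_ofReal, h0, h1, h2, h3]
  simp [Fin.sum_univ_succ]
  ring

theorem qf_five (x : Sph 5) (p : (Fin 4 → ℂ) × (Fin 4 → ℂ)) :
    qf .five x (Fin.append p.1 p.2) =
      p.1 ⬝ᵥ mat5 (fun i => (x : EuclideanSpace ℝ (Fin 6)) i) *ᵥ p.2 := by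
  have h0 : (Fin.append p.1 p.2 : Fin 8 → ℂ) 0 = p.1 0 := rfl
  have h1 : (Fin.append p.1 p.2 : Fin 8 → ℂ) 1 = p.1 1 := rfl
  have h2 : (Fin.append p.1 p.2 : Fin 8 → ℂ) 2 = p.1 2 := rfl
  have h3 : (Fin.append p.1 p.2 : Fin 8 → ℂ) 3 = p.1 3 := rfl
  have h4 : (Fin.append p.1 p.2 : Fin 8 → ℂ) 4 = p.2 0 := rfl
  have h5 : (Fin.append p.1 p.2 : Fin 8 → ℂ) 5 = p.2 1 := rfl
  have h6 : (Fin.append p.1 p.2 : Fin 8 → ℂ) 6 = p.2 2 := rfl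
  have h7 : (Fin.append p.1 p.2 : Fin 8 → ℂ) 7 = p.2 3 := rfl
  change cdot (rho58 (Fin.append p.1 p.2 : Fin 8 → ℂ)) x.toC = _
  simp only [cdot, rho58, Sph.toC, mat5, dotProduct, mulVec, Complex.conj_ofReal,
    h0, h1, h2, h3, h4, h5, h6, h7]
  simp [Fin.sum_univ_succ]
  ring

theorem sum_mul_eq_inner {n : ℕ} (x y : Sph n) :
    ∑ i, (x : EuclideanSpace ℝ (Fin (n + 1))) i * (y : EuclideanSpace ℝ (Fin (n + 1))) i =
      inner ℝ (x : EuclideanSpace ℝ (Fin (n + 1))) y := by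
  simp [PiLp.inner_apply, mul_comm]

theorem abs_inner_sphere_le {n : ℕ} (x y : Sph n) :
    |inner ℝ (x : EuclideanSpace ℝ (Fin (n + 1))) y| ≤ 1 := by
  have := abs_real_inner_le_norm (x : EuclideanSpace ℝ (Fin (n + 1))) y
  simpa using this

theorem inner_sphere_self {n : ℕ} (x : Sph n) :
    inner ℝ (x : EuclideanSpace ℝ (Fin (n + 1))) x = 1 := by
  rw [real_inner_self_eq_norm_sq]; simp

theorem mul_conjTranspose_eq_one_of_two {ι : Type*} [Fintype ι] [DecidableEq ι]
    {M : Matrix ι ι ℂ} (h : M * Mᴴ + M * Mᴴ = (2 * (1 : ℝ) : ℂ) • 1) : M * Mᴴ = 1 := by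
  have h2 : (2 : ℂ) • (M * Mᴴ) = (2 : ℂ) • (1 : Matrix ι ι ℂ) := by
    rw [two_smul, h]; simp
  exact smul_right_injective _ (two_ne_zero' ℂ) h2

theorem mat2_unitary (x : Sph 2) :
    mat2 (fun i => (x : EuclideanSpace ℝ (Fin 3)) i) *
      (mat2 (fun i => (x : EuclideanSpace ℝ (Fin 3)) i))ᴴ = 1 := by
  refine mul_conjTranspose_eq_one_of_two ?_
  rw [mat2_clifford, sum_mul_eq_inner, inner_sphere_self]

theorem mat3_unitary (x : Sph 3) :
    mat3 (fun i => (x : EuclideanSpace ℝ (Fin 4)) i) *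
      (mat3 (fun i => (x : EuclideanSpace ℝ (Fin 4)) i))ᴴ = 1 := by
  refine mul_conjTranspose_eq_one_of_two ?_
  rw [mat3_clifford, sum_mul_eq_inner, inner_sphere_self]

theorem mat5_unitary (x : Sph 5) :
    mat5 (fun i => (x : EuclideanSpace ℝ (Fin 6)) i) *
      (mat5 (fun i => (x : EuclideanSpace ℝ (Fin 6)) i))ᴴ = 1 := by
  refine mul_conjTranspose_eq_one_of_two ?_
  rw [mat5_clifford, sum_mul_eq_inner, inner_sphere_self]

theorem sum_norm_sq_append {k l : ℕ} (a : Fin k → ℂ) (b : Fin l → ℂ) :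
    ∑ j, ‖Fin.append a b j‖ ^ 2 = ∑ j, ‖a j‖ ^ 2 + ∑ j, ‖b j‖ ^ 2 := by
  rw [Fin.sum_univ_add]; simp

theorem exists_append {k l : ℕ} (z : Fin (k + l) → ℂ) :
    ∃ p : (Fin k → ℂ) × (Fin l → ℂ), Fin.append p.1 p.2 = z :=
  ⟨(fun i => z (Fin.castAdd l i), fun i => z (Fin.natAdd k i)), Fin.append_castAdd_natAdd⟩

/-- Comes from unitarity of the Clifford matrix of a unit vector. All later domination arguments
rest on it: the exponential with parameter `s` is bounded by `exp(s|z|²/ħ)`, which is `μ`-integrable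
for `s < 1`. -/
theorem norm_qf_le (c : SphereCase) (x : Sph c.n) (z : Fin c.m → ℂ) :
    ‖qf c x z‖ ≤ (1 / 2) * ∑ j, ‖z j‖ ^ 2 := by
  cases c
  · have := norm_dotProduct_mulVec_le (mat2_unitary x) z z
    refine (congrArg norm (qf_two x z)).trans_le ?_
    rw [norm_mul, norm_div, norm_one, Complex.norm_two]
    refine mul_le_mul_of_nonneg_left ?_ (by norm_num)
    refine this.trans_eq ?_
    rw [← two_mul, ← mul_assoc, one_div_mul_cancel two_ne_zero, one_mul]
    rfl
  · obtain ⟨p, rfl⟩ := exists_append (k := 2) (l := 2) z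
    refine (congrArg norm (qf_three x p)).trans_le ?_
    refine (norm_dotProduct_mulVec_le (mat3_unitary x) _ _).trans_eq ?_
    rw [← sum_norm_sq_append]
    rfl
  · obtain ⟨p, rfl⟩ := exists_append (k := 4) (l := 4) z
    refine (congrArg norm (qf_five x p)).trans_le ?_
    refine (norm_dotProduct_mulVec_le (mat5_unitary x) _ _).trans_eq ?_
    rw [← sum_norm_sq_append]
    rfl

theorem continuous_rho (c : SphereCase) : Continuous (rho c) := by
  cases c
  · refine continuous_pi fun i => ?_
    fin_cases i <;> simp [rho, rho22] <;> fun_prop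
  · refine continuous_pi fun i => ?_
    fin_cases i <;> simp [rho, rho34] <;> fun_prop
  · refine continuous_pi fun i => ?_
    fin_cases i <;> simp [rho, rho58] <;> fun_prop

theorem continuous_qf_uncurry (c : SphereCase) :
    Continuous fun p : Sph c.n × (Fin c.m → ℂ) => qf c p.1 p.2 := by
  unfold qf cdot Sph.toC
  have := continuous_rho c
  fun_prop

theorem continuous_qf (c : SphereCase) (x : Sph c.n) : Continuous (qf c x) :=
  (continuous_qf_uncurry c).comp (Continuous.prodMk_right x)

theorem rho22_smul (l : ℂ) (z : Fin 2 → ℂ) : rho22 (l • z) = l ^ 2 • rho22 z := by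
  ext i
  fin_cases i <;> simp [rho22] <;> ring

theorem rho34_smul (l : ℂ) (z : Fin 4 → ℂ) : rho34 (l • z) = l ^ 2 • rho34 z := by
  ext i
  fin_cases i <;> simp [rho34] <;> ring

theorem rho58_smul (l : ℂ) (z : Fin 8 → ℂ) : rho58 (l • z) = l ^ 2 • rho58 z := by
  ext i
  fin_cases i <;> simp [rho58] <;> ring

theorem rho_smul (c : SphereCase) (l : ℂ) (z : Fin c.m → ℂ) :
    rho c (l • z) = l ^ 2 • rho c z := by
  cases c
  · exact rho22_smul l z
  · exact rho34_smul l z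
  · exact rho58_smul l z

theorem cdot_smul {k : ℕ} (l : ℂ) (v w : Fin k → ℂ) : cdot (l • v) w = l * cdot v w := by
  simp [cdot, Finset.mul_sum, mul_assoc]

theorem qf_smul (c : SphereCase) (x : Sph c.n) (l : ℂ) (z : Fin c.m → ℂ) :
    qf c x (l • z) = l ^ 2 * qf c x z := by
  rw [qf, rho_smul, cdot_smul, qf]

/-- The image of `ρ` lies in the null cone; this is the hypothesis under which powers of `ρ(z)·x`
have mean zero on the sphere. -/
theorem sum_rho_sq (c : SphereCase) (z : Fin c.m → ℂ) : ∑ j, rho c z j ^ 2 = 0 := by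
  cases c
  · change ∑ j : Fin 3, rho22 z j ^ 2 = 0
    simp [rho22, Fin.sum_univ_succ]
    ring_nf
    simp only [Complex.I_sq]
    ring
  · change ∑ j : Fin 4, rho34 z j ^ 2 = 0
    simp [rho34, Fin.sum_univ_succ]
    ring_nf
    simp only [Complex.I_sq]
    ring
  · change ∑ j : Fin 6, rho58 z j ^ 2 = 0
    simp [rho58, Fin.sum_univ_succ]
    ring_nf
    simp only [Complex.I_sq]
    ring

/-! ### Closed form of the generating kernel -/

theorem integral_exp_bilin_append {k : ℕ} {ħ : ℝ} (hħ : 0 < ħ) (s : ℝ)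
    (M N : Matrix (Fin k) (Fin k) ℂ) (u v : (Fin (k + k) → ℂ) → ℂ)
    (hu : Continuous u) (hv : Continuous v)
    (huM : ∀ p : (Fin k → ℂ) × (Fin k → ℂ), u (Fin.append p.1 p.2) = p.1 ⬝ᵥ M *ᵥ p.2)
    (hvN : ∀ p : (Fin k → ℂ) × (Fin k → ℂ), v (Fin.append p.1 p.2) = p.1 ⬝ᵥ N *ᵥ p.2) :
    ∫ z, Complex.exp (s / ħ * (u z + conj (v z))) ∂(gaussMeasure (k + k) ħ) =
      ((Real.pi * ħ : ℂ) ^ (k + k))⁻¹ * ∫ p, Complex.exp (bilinExponent ħ s M N p) := by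
  rw [integral_gaussMeasure _ hħ, integral_append _ _ _ (by fun_prop)]
  congr 1
  refine integral_congr_ae (Filter.Eventually.of_forall fun p => ?_)
  simp only
  rw [← Complex.exp_add, huM, hvN, sum_norm_sq_append, bilinExponent]

/-- The function whose `p/2`-th power is the reciprocal of the generating kernel. -/
def poissonDenom (r t : ℝ) : ℝ := 1 - 2 * r * t + r ^ 2

theorem poissonDenom_lower {r t : ℝ} (hr : 0 ≤ r) (ht : |t| ≤ 1) :
    (1 - r) ^ 2 ≤ poissonDenom r t := by
  have := (abs_le.1 ht).2
  unfold poissonDenom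
  nlinarith

theorem poissonDenom_pos {r t : ℝ} (hr : 0 ≤ r) (hr1 : r < 1) (ht : |t| ≤ 1) :
    0 < poissonDenom r t :=
  lt_of_lt_of_le (pow_pos (by linarith) 2) (poissonDenom_lower hr ht)

theorem norm_exp_qf_le (c : SphereCase) {ħ s : ℝ} (hħ : 0 < ħ) (hs : 0 ≤ s) (x y : Sph c.n)
    (z : Fin c.m → ℂ) :
    ‖Complex.exp (s / ħ * (qf c x z + conj (qf c y z)))‖ ≤
      Real.exp (s * (∑ j, ‖z j‖ ^ 2) / ħ) := by
  rw [Complex.norm_exp]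
  refine Real.exp_le_exp.2 ?_
  rw [← Complex.ofReal_div, Complex.re_ofReal_mul, Complex.add_re, Complex.conj_re]
  have h1 := (Complex.re_le_norm _).trans (norm_qf_le c x z)
  have h2 := (Complex.re_le_norm _).trans (norm_qf_le c y z)
  have := mul_le_mul_of_nonneg_left (add_le_add h1 h2) (div_nonneg hs hħ.le)
  refine this.trans_eq ?_
  ring

/-- The unitary change of variables `(z, w) ↦ ((z + i w) / √2, (z - i w) / √2)`. -/
def doubling (k : ℕ) : (Fin k → ℂ) × (Fin k → ℂ) →ₗ[ℝ] (Fin k → ℂ) × (Fin k → ℂ) where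
  toFun p := ((√2)⁻¹ • (p.1 + Complex.I • p.2), (√2)⁻¹ • (p.1 - Complex.I • p.2))
  map_add' p q := by
    ext i <;> simp <;> ring
  map_smul' a p := by
    ext i <;> simp <;> ring

theorem sum_norm_sq_doubling (k : ℕ) (p : (Fin k → ℂ) × (Fin k → ℂ)) :
    ∑ i, ‖(doubling k p).1 i‖ ^ 2 + ∑ i, ‖(doubling k p).2 i‖ ^ 2 =
      ∑ i, ‖p.1 i‖ ^ 2 + ∑ i, ‖p.2 i‖ ^ 2 := by
  simp only [← Finset.sum_add_distrib]
  refine Finset.sum_congr rfl fun i => fun _ => ?_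
  have h1 := parallelogram_law_with_norm ℝ (p.1 i) (Complex.I * p.2 i)
  rw [norm_mul, Complex.norm_I, one_mul] at h1
  have h3 : ((√2)⁻¹) ^ 2 = (1 / 2 : ℝ) := by
    rw [inv_pow, Real.sq_sqrt (by norm_num)]; norm_num
  have h4 : ∀ v : ℂ, ‖(√2)⁻¹ • v‖ ^ 2 = (1 / 2) * ‖v‖ ^ 2 := by
    intro v
    rw [norm_smul, mul_pow, Real.norm_eq_abs, sq_abs, h3]
  change ‖(√2)⁻¹ • (p.1 i + Complex.I * p.2 i)‖ ^ 2 +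
    ‖(√2)⁻¹ • (p.1 i - Complex.I * p.2 i)‖ ^ 2 = _
  rw [h4, h4]
  linarith

theorem measurePreserving_doubling (k : ℕ) : MeasurePreserving (doubling k) := by
  have := Measure.prod.instIsAddHaarMeasure (volume : Measure (Fin k → ℂ))
    (volume : Measure (Fin k → ℂ))
  refine measurePreserving_of_gaussian_invariant
    ((volume : Measure (Fin k → ℂ)).prod (volume : Measure (Fin k → ℂ)))
    (fun p : (Fin k → ℂ) × (Fin k → ℂ) => 1 * ∑ i, ‖p.1 i‖ ^ 2 + 1 * ∑ i, ‖p.2 i‖ ^ 2)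
    (by fun_prop) ?_ _ ?_ ?_
  · have h := (integrable_gaussian_pi (ι := Fin k) one_pos).mul_prod
      (integrable_gaussian_pi (ι := Fin k) one_pos)
    refine h.congr (Filter.Eventually.of_forall fun p => ?_)
    simp only
    rw [← Real.exp_add, neg_add]
  · intro p q h
    have h2 : ((√2)⁻¹ : ℝ) ≠ 0 := by positivity
    have e1 := smul_right_injective _ h2 (congrArg Prod.fst h)
    have e2 := smul_right_injective _ h2 (congrArg Prod.snd h)
    ext i
    · have a1 := congrFun e1 i
      have a2 := congrFun e2 i
      simp at a1 a2
      linear_combination (a1 + a2) / 2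
    · have a1 := congrFun e1 i
      have a2 := congrFun e2 i
      simp at a1 a2
      linear_combination (-Complex.I / 2) * (a1 - a2) + (p.2 i - q.2 i) * Complex.I_sq
  · intro p
    simpa only [one_mul] using sum_norm_sq_doubling k p

/-- In `(z + iw)ᵀ M (z - iw) / 2` the cross terms cancel because `M` is symmetric. Thus a product of
two integrals with quadratic exponents becomes one integral with a bilinear exponent. -/
theorem bilin_doubling {k : ℕ} {M : Matrix (Fin k) (Fin k) ℂ} (hM : Mᵀ = M)
    (p : (Fin k → ℂ) × (Fin k → ℂ)) :
    ((doubling k p).1 ⬝ᵥ M *ᵥ (doubling k p).2) =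
      (1 / 2) * (p.1 ⬝ᵥ M *ᵥ p.1) + (1 / 2) * (p.2 ⬝ᵥ M *ᵥ p.2) := by
  have hc : (((√2)⁻¹ : ℝ) : ℂ) * (((√2)⁻¹ : ℝ) : ℂ) = 1 / 2 := by
    rw [← Complex.ofReal_mul, ← mul_inv, Real.mul_self_sqrt (by norm_num)]
    simp
  have hsymm : p.2 ⬝ᵥ M *ᵥ p.1 = p.1 ⬝ᵥ M *ᵥ p.2 := by
    rw [dotProduct_mulVec, ← mulVec_transpose, hM, dotProduct_comm]
  change (((√2)⁻¹ : ℝ) • (p.1 + Complex.I • p.2)) ⬝ᵥ M *ᵥ (((√2)⁻¹ : ℝ) • (p.1 - Complex.I • p.2)) = _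
  rw [← Complex.coe_smul, ← Complex.coe_smul, mulVec_smul, smul_dotProduct, dotProduct_smul,
    smul_smul, hc, mulVec_sub, mulVec_smul, add_dotProduct, dotProduct_sub, dotProduct_sub,
    smul_dotProduct, smul_dotProduct, dotProduct_smul, dotProduct_smul, hsymm]
  simp only [smul_eq_mul]
  linear_combination (- (1 / 2) * (p.2 ⬝ᵥ M *ᵥ p.2)) * Complex.I_sq

theorem integral_exp_bilin_two {ħ s : ℝ} (hħ : 0 < ħ) (hs0 : 0 ≤ s) (hs : s < 1) {t : ℝ}
    (ht1 : |t| ≤ 1) {M N : Matrix (Fin 2) (Fin 2) ℂ} (hM : M * Mᴴ = 1) (hN : N * Nᴴ = 1)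
    (ht : M * Nᴴ + N * Mᴴ = (2 * t : ℂ) • 1) (htr : (M * Nᴴ).trace = 2 * t) :
    ∫ p, Complex.exp (bilinExponent ħ s M N p) =
      (Real.pi * ħ : ℂ) ^ 4 * ((poissonDenom (s ^ 2) t : ℝ) : ℂ)⁻¹ := by
  obtain ⟨h, h1, h2, h3⟩ := integral_exp_bilinExponent hħ hs0 hs ht1 hM hN ht (by simpa using htr)
  have := prod_inv_two (r := s ^ 2) h1 h2
  rw [h3, poissonDenom, ← this]
  simp

theorem integral_exp_bilin_four {ħ s : ℝ} (hħ : 0 < ħ) (hs0 : 0 ≤ s) (hs : s < 1) {t : ℝ}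
    (ht1 : |t| ≤ 1) {M N : Matrix (Fin 4) (Fin 4) ℂ} (hM : M * Mᴴ = 1) (hN : N * Nᴴ = 1)
    (ht : M * Nᴴ + N * Mᴴ = (2 * t : ℂ) • 1) (htr : (M * Nᴴ).trace = 4 * t) :
    ∫ p, Complex.exp (bilinExponent ħ s M N p) =
      (Real.pi * ħ : ℂ) ^ 8 * ((poissonDenom (s ^ 2) t ^ 2 : ℝ) : ℂ)⁻¹ := by
  obtain ⟨h, h1, h2, h3⟩ := integral_exp_bilinExponent hħ hs0 hs ht1 hM hN ht (by simpa using htr)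
  have := prod_inv_four (r := s ^ 2) h1 h2
  rw [h3, poissonDenom, ← this]
  simp

/-- The Gaussian average of `exp (s (ρ(z)·x + conj (ρ(z)·y)) / ħ)`. -/
def genKernel (c : SphereCase) (ħ s : ℝ) (x y : Sph c.n) : ℂ :=
  ∫ z, Complex.exp (s / ħ * (qf c x z + conj (qf c y z))) ∂(gaussMeasure c.m ħ)

/-- On `ℂ²` the coordinates do not split into two halves paired bilinearly, so the square of the
integral is computed instead, as an integral over `ℂ² × ℂ²` in doubled variables. -/
theorem genKernel_two_sq {ħ s : ℝ} (hħ : 0 < ħ) (hs0 : 0 ≤ s) (hs : s < 1) (x y : Sph 2) :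
    genKernel .two ħ s x y ^ 2 =
      ((poissonDenom (s ^ 2) (inner ℝ (x : EuclideanSpace ℝ (Fin 3)) y) : ℝ) : ℂ)⁻¹ := by
  set M := mat2 (fun i => (x : EuclideanSpace ℝ (Fin 3)) i)
  set N := mat2 (fun i => (y : EuclideanSpace ℝ (Fin 3)) i)
  have hMt : Mᵀ = M := by
    ext i j; fin_cases i <;> fin_cases j <;> rfl
  have hNt : Nᵀ = N := by
    ext i j; fin_cases i <;> fin_cases j <;> rfl
  have hint := integral_exp_bilin_two hħ hs0 hs (abs_inner_sphere_le x y) (mat2_unitary x)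
    (mat2_unitary y) (by rw [mat2_clifford, sum_mul_eq_inner])
    (by rw [mat2_trace, sum_mul_eq_inner])
  set G : (Fin 2 → ℂ) → ℂ := fun z => Complex.exp (-((∑ j, ‖z j‖ ^ 2 : ℝ) : ℂ) / ħ) *
    Complex.exp (s / ħ * ((1 / 2) * (z ⬝ᵥ M *ᵥ z) + conj ((1 / 2) * (z ⬝ᵥ N *ᵥ z))))
  have h1 : genKernel .two ħ s x y = ((Real.pi * ħ : ℂ) ^ 2)⁻¹ * ∫ z, G z := by
    have : genKernel .two ħ s x y =
      ∫ z : Fin 2 → ℂ, Complex.exp (s / ħ * ((1 / 2) * (z ⬝ᵥ M *ᵥ z) +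
        conj ((1 / 2) * (z ⬝ᵥ N *ᵥ z)))) ∂(gaussMeasure 2 ħ) := by
      refine integral_congr_ae (Filter.Eventually.of_forall fun z => ?_)
      exact congrArg (fun w => Complex.exp (s / ħ * w))
        (congrArg₂ (· + ·) (qf_two x z) (congrArg conj (qf_two y z)))
    rw [this, integral_gaussMeasure 2 hħ]
  have h2 : (∫ z, G z) * (∫ z, G z) = ∫ p, Complex.exp (bilinExponent ħ s M N p) := by
    rw [← integral_prod_mul, ← Measure.volume_eq_prod]
    have hmp := measurePreserving_doubling 2
    have hcg := integral_map (μ := volume) hmp.measurable.aemeasurable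
      (f := fun p => Complex.exp (bilinExponent ħ s M N p))
      (Complex.continuous_exp.comp (continuous_bilinExponent ħ s M N)).aestronglyMeasurable
    rw [hmp.map_eq] at hcg
    rw [hcg]
    refine integral_congr_ae (Filter.Eventually.of_forall fun p => ?_)
    simp only [G]
    have hnorm : (∑ i, ‖(doubling 2 p).1 i‖ ^ 2 + ∑ i, ‖(doubling 2 p).2 i‖ ^ 2 : ℝ) =
        ∑ i, ‖p.1 i‖ ^ 2 + ∑ i, ‖p.2 i‖ ^ 2 := sum_norm_sq_doubling 2 p
    rw [bilinExponent, hnorm, bilin_doubling hMt, bilin_doubling hNt, ← Complex.exp_add,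
      ← Complex.exp_add, ← Complex.exp_add]
    congr 1
    push_cast
    simp only [map_add]
    ring
  have hpi : (Real.pi * ħ : ℂ) ≠ 0 := by
    exact_mod_cast (mul_pos Real.pi_pos hħ).ne'
  rw [h1, sq, mul_mul_mul_comm, h2, hint, ← mul_assoc, ← mul_inv, ← pow_add,
    inv_mul_cancel₀ (pow_ne_zero _ hpi), one_mul]

theorem continuousOn_genKernel (c : SphereCase) {ħ s : ℝ} (hħ : 0 < ħ) (hs : s < 1)
    (x y : Sph c.n) : ContinuousOn (fun σ => genKernel c ħ σ x y) (Set.Icc 0 s) := by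
  have h1 := continuous_qf c x
  have h2 := continuous_qf c y
  unfold genKernel
  refine continuousOn_of_dominated (bound := fun z : Fin c.m → ℂ => Real.exp (s * (∑ j, ‖z j‖ ^ 2) / ħ)) ?_ ?_
    (integrable_exp_gaussMeasure c.m hħ hs) ?_
  · intro σ _
    exact Continuous.aestronglyMeasurable (by fun_prop)
  · intro σ hσ
    refine Filter.Eventually.of_forall fun z => (norm_exp_qf_le c hħ hσ.1 x y z).trans ?_
    have : 0 ≤ ∑ j, ‖z j‖ ^ 2 := Finset.sum_nonneg fun _ _ => by positivity
    refine Real.exp_le_exp.2 ?_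
    gcongr
    exact hσ.2
  · refine Filter.Eventually.of_forall fun z => ?_
    have h3 : ∀ w : ℂ, Continuous fun σ : ℝ => Complex.exp (σ / ħ * w) := fun w => by fun_prop
    exact (h3 _).continuousOn

theorem rpow_neg_half_sq {d : ℝ} (hd : 0 < d) : (d ^ (-(1 / 2) : ℝ)) ^ 2 = d⁻¹ := by
  rw [← Real.rpow_natCast, ← Real.rpow_mul hd.le, ← Real.rpow_neg_one]
  norm_num

theorem genKernel_eq (c : SphereCase) {ħ s : ℝ} (hħ : 0 < ħ) (hs0 : 0 ≤ s) (hs : s < 1)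
    (x y : Sph c.n) :
    genKernel c ħ s x y =
      ((poissonDenom (s ^ 2) (inner ℝ (x : EuclideanSpace ℝ (Fin (c.n + 1))) y) ^
        (-((c.n : ℝ) - 1) / 2) : ℝ) : ℂ) := by
  have hpi : (Real.pi * ħ : ℂ) ≠ 0 := by
    exact_mod_cast (mul_pos Real.pi_pos hħ).ne'
  have hs2 : s ^ 2 < 1 := by nlinarith
  have hpos := poissonDenom_pos (sq_nonneg s) hs2 (abs_inner_sphere_le x y)
  cases c
  · change Sph 2 at x y
    have hexp : -((SphereCase.two.n : ℝ) - 1) / 2 = -(1 / 2) := by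
      norm_num [SphereCase.n]
    rw [hexp]
    set g : ℝ → ℂ := fun σ => ((poissonDenom (σ ^ 2)
      (inner ℝ (x : EuclideanSpace ℝ (Fin 3)) y) ^ (-(1 / 2) : ℝ) : ℝ) : ℂ)
    have hpos' : ∀ σ ∈ Set.Icc 0 s, 0 < poissonDenom (σ ^ 2)
        (inner ℝ (x : EuclideanSpace ℝ (Fin 3)) y) := fun σ hσ =>
      poissonDenom_pos (sq_nonneg σ) (by nlinarith [hσ.1, hσ.2]) (abs_inner_sphere_le x y)
    have hg : ContinuousOn g (Set.Icc 0 s) := by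
      refine Complex.continuous_ofReal.comp_continuousOn ?_
      refine ContinuousOn.rpow_const ?_ fun σ hσ => Or.inl (hpos' σ hσ).ne'
      unfold poissonDenom
      fun_prop
    have hsq : Set.EqOn ((fun σ => genKernel .two ħ σ x y) ^ 2) (g ^ 2) (Set.Icc 0 s) := by
      intro σ hσ
      simp only [Pi.pow_apply]
      rw [genKernel_two_sq hħ hσ.1 (hσ.2.trans_lt hs)]
      simp only [g]
      rw [← Complex.ofReal_pow, ← Complex.ofReal_inv, rpow_neg_half_sq (hpos' σ hσ)]
    have hg0 : ∀ {σ}, σ ∈ Set.Icc 0 s → g σ ≠ 0 := by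
      intro σ hσ
      exact Complex.ofReal_ne_zero.2 (Real.rpow_pos_of_pos (hpos' σ hσ) _).ne'
    -- Two continuous functions on `[0, s]` with equal squares, one of them nowhere zero, agree up
    -- to a global sign. Both equal `1` at `σ = 0`, which excludes the minus sign.
    rcases isPreconnected_Icc.eq_or_eq_neg_of_sq_eq (continuousOn_genKernel .two hħ hs x y) hg
      hsq hg0 with h | h
    · exact h (Set.right_mem_Icc.2 hs0)
    · exfalso
      have h0 := h (Set.left_mem_Icc.2 hs0)
      have e1 : genKernel .two ħ 0 x y = 1 := by
        simpa [genKernel] using integral_one_gaussMeasure SphereCase.two.m hħ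
      have e2 : g 0 = 1 := by simp [g, poissonDenom]
      simp only [Pi.neg_apply] at h0
      rw [e1, e2] at h0
      norm_num at h0
  · change Sph 3 at x y
    have hexp : -((SphereCase.three.n : ℝ) - 1) / 2 = -1 := by
      norm_num [SphereCase.n]
    rw [hexp]
    have h1 := integral_exp_bilin_append (k := 2) hħ s _ _ (qf .three x) (qf .three y)
      (continuous_qf _ _) (continuous_qf _ _) (qf_three x) (qf_three y)
    rw [integral_exp_bilin_two hħ hs0 hs (abs_inner_sphere_le x y) (mat3_unitary x)
      (mat3_unitary y) (by rw [mat3_clifford, sum_mul_eq_inner])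
      (by rw [mat3_trace, sum_mul_eq_inner])] at h1
    refine Eq.trans h1 ?_
    rw [Real.rpow_neg_one, ← mul_assoc, inv_mul_cancel₀ (pow_ne_zero _ hpi), one_mul,
      Complex.ofReal_inv]
    rfl
  · change Sph 5 at x y
    have hexp : -((SphereCase.five.n : ℝ) - 1) / 2 = -2 := by
      norm_num [SphereCase.n]
    rw [hexp]
    have h1 := integral_exp_bilin_append (k := 4) hħ s _ _ (qf .five x) (qf .five y)
      (continuous_qf _ _) (continuous_qf _ _) (qf_five x) (qf_five y)
    rw [integral_exp_bilin_four hħ hs0 hs (abs_inner_sphere_le x y) (mat5_unitary x)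
      (mat5_unitary y) (by rw [mat5_clifford, sum_mul_eq_inner])
      (by rw [mat5_trace, sum_mul_eq_inner])] at h1
    refine Eq.trans h1 ?_
    rw [Real.rpow_neg hpos.le, Real.rpow_two, ← mul_assoc, inv_mul_cancel₀ (pow_ne_zero _ hpi),
      one_mul, Complex.ofReal_inv]
    rfl

end

/-! ### Rotation invariance of the sphere and means of null powers -/

section

/-- The action of a linear isometry on the sphere. -/
def sphMap {n : ℕ} (R : EuclideanSpace ℝ (Fin (n + 1)) ≃ₗᵢ[ℝ] EuclideanSpace ℝ (Fin (n + 1)))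
    (x : Sph n) : Sph n :=
  ⟨R x, by simp⟩

/-- The surface measure of a set is, up to a constant, the volume of the cone over it, and a linear
isometry maps cones to cones and preserves volume. -/
theorem measurePreserving_sphMap {n : ℕ}
    (R : EuclideanSpace ℝ (Fin (n + 1)) ≃ₗᵢ[ℝ] EuclideanSpace ℝ (Fin (n + 1))) :
    MeasurePreserving (sphMap R) (sphMeasure n) (sphMeasure n) := by
  have hc : Continuous (sphMap R) := by
    unfold sphMap
    exact Continuous.subtype_mk (R.continuous.comp continuous_subtype_val) _
  have h : MeasurePreserving (sphMap R)
      (volume : Measure (EuclideanSpace ℝ (Fin (n + 1)))).toSphere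
      (volume : Measure (EuclideanSpace ℝ (Fin (n + 1)))).toSphere := by
    refine ⟨hc.measurable, ?_⟩
    ext s hs
    rw [Measure.map_apply hc.measurable hs, Measure.toSphere_apply' _ (hc.measurable hs),
      Measure.toSphere_apply' _ hs]
    congr 1
    refine Eq.trans ?_ (R.measurePreserving.measure_preimage_equiv (f := R.toMeasurableEquiv) _)
    congr 1
    ext v
    simp only [Set.mem_smul, Set.mem_image, Set.mem_preimage]
    constructor
    · rintro ⟨r, hr, y, ⟨x, hx, rfl⟩, rfl⟩
      refine ⟨r, hr, _, ⟨sphMap R x, hx, rfl⟩, ?_⟩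
      simp [sphMap]
    · rintro ⟨r, hr, y, ⟨x, hx, rfl⟩, hv⟩
      refine ⟨r, hr, R.symm x, ⟨sphMap R.symm x, ?_, rfl⟩, ?_⟩
      · have : sphMap R (sphMap R.symm x) = x := by
          ext1; simp [sphMap]
        rwa [this]
      · apply R.injective
        simpa using hv
  unfold sphMeasure
  exact h.smul_measure _

theorem integral_sphMap {n : ℕ}
    (R : EuclideanSpace ℝ (Fin (n + 1)) ≃ₗᵢ[ℝ] EuclideanSpace ℝ (Fin (n + 1)))
    (f : Sph n → ℂ) (hf : Continuous f) :
    ∫ x, f (sphMap R x) ∂(sphMeasure n) = ∫ x, f x ∂(sphMeasure n) := by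
  have h := measurePreserving_sphMap R
  rw [← integral_map (f := f) h.measurable.aemeasurable hf.aestronglyMeasurable, h.map_eq]

/-- The reflection in the hyperplane orthogonal to `d` acts on the plane of `a` and `b` as the
reflection in the line at angle `φ`, which sends `A + iB` to `exp(2iφ)(A - iB)`. Reflections suffice
here, and two values of `φ` will be compared. -/
theorem integral_inner_pow_eq {n : ℕ} {a b : EuclideanSpace ℝ (Fin (n + 1))}
    (hab : inner ℝ a b = 0) (hn : ‖a‖ = ‖b‖) (ha : a ≠ 0) (l : ℕ) (φ : ℝ) :
    ∫ x : Sph n, ((inner ℝ a (x : EuclideanSpace ℝ (Fin (n + 1))) : ℂ) +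
        Complex.I * (inner ℝ b (x : EuclideanSpace ℝ (Fin (n + 1))) : ℂ)) ^ l ∂(sphMeasure n) =
      Complex.exp (2 * φ * Complex.I) ^ l *
      ∫ x : Sph n, ((inner ℝ a (x : EuclideanSpace ℝ (Fin (n + 1))) : ℂ) -
        Complex.I * (inner ℝ b (x : EuclideanSpace ℝ (Fin (n + 1))) : ℂ)) ^ l ∂(sphMeasure n) := by
  set d : EuclideanSpace ℝ (Fin (n + 1)) := (-Real.sin φ) • a + Real.cos φ • b
  have haa : inner ℝ a a = ‖a‖ ^ 2 := real_inner_self_eq_norm_sq a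
  have hbb : inner ℝ b b = ‖a‖ ^ 2 := by rw [hn]; exact real_inner_self_eq_norm_sq b
  have hba : inner ℝ b a = 0 := by rw [real_inner_comm]; exact hab
  have hda : inner ℝ d a = -Real.sin φ * ‖a‖ ^ 2 := by
    simp only [d, inner_add_left, real_inner_smul_left, haa, hba]; ring
  have hdb : inner ℝ d b = Real.cos φ * ‖a‖ ^ 2 := by
    simp only [d, inner_add_left, real_inner_smul_left, hbb, hab]; ring
  have hdd : ‖d‖ ^ 2 = ‖a‖ ^ 2 := by
    rw [← real_inner_self_eq_norm_sq]
    nth_rw 2 [show d = (-Real.sin φ) • a + Real.cos φ • b from rfl]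
    rw [inner_add_right, real_inner_smul_right, real_inner_smul_right, hda, hdb]
    linear_combination ‖a‖ ^ 2 * Real.sin_sq_add_cos_sq φ
  have hN : ‖a‖ ^ 2 ≠ 0 := by simpa using ha
  set R := (Submodule.span ℝ {d})ᗮ.reflection
  have hR : ∀ v, R v = v - (2 * (inner ℝ d v / ‖a‖ ^ 2)) • d := by
    intro v
    simp only [R]
    rw [Submodule.reflection_orthogonal_apply, Submodule.reflection_singleton_apply]
    simp only [RCLike.ofReal_real_eq_id, id_eq]
    rw [hdd, neg_sub, mul_smul, two_smul, two_smul]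
  rw [← integral_sphMap R _ (by fun_prop), ← integral_const_mul]
  refine integral_congr_ae (Filter.Eventually.of_forall fun x => ?_)
  simp only
  rw [← mul_pow]
  congr 1
  set A := inner ℝ a (x : EuclideanSpace ℝ (Fin (n + 1)))
  set B := inner ℝ b (x : EuclideanSpace ℝ (Fin (n + 1)))
  have hdx : inner ℝ d (x : EuclideanSpace ℝ (Fin (n + 1))) = -Real.sin φ * A + Real.cos φ * B := by
    simp only [d, inner_add_left, real_inner_smul_left, A, B]
  have e1 : inner ℝ a (R x) = A + 2 * Real.sin φ * (-Real.sin φ * A + Real.cos φ * B) := by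
    rw [hR, inner_sub_right, real_inner_smul_right, real_inner_comm d a, hda, hdx]
    field_simp
    ring
  have e2 : inner ℝ b (R x) = B - 2 * Real.cos φ * (-Real.sin φ * A + Real.cos φ * B) := by
    rw [hR, inner_sub_right, real_inner_smul_right, real_inner_comm d b, hdb, hdx]
    field_simp
    rfl
  have e3 : ((sphMap R x : Sph n) : EuclideanSpace ℝ (Fin (n + 1))) = R x := rfl
  rw [e3, e1, e2, show (2 * φ * Complex.I : ℂ) = φ * Complex.I + φ * Complex.I by ring,
    Complex.exp_add, Complex.exp_mul_I]
  push_cast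
  have hsc := Complex.sin_sq_add_cos_sq φ
  linear_combination (-(A : ℂ) - Complex.I * B) * hsc +
    (-A * Complex.sin φ ^ 2 + 2 * Complex.sin φ * Complex.cos φ * B +
      Complex.sin φ ^ 2 * B * Complex.I) * Complex.I_sq

theorem integral_cdot_pow_eq_zero {n : ℕ} (α : Fin (n + 1) → ℂ) (hα : ∑ j, α j ^ 2 = 0) {l : ℕ}
    (hl : l ≠ 0) : ∫ x : Sph n, cdot α x.toC ^ l ∂(sphMeasure n) = 0 := by
  set a : EuclideanSpace ℝ (Fin (n + 1)) := WithLp.toLp 2 fun j => (α j).re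
  set b : EuclideanSpace ℝ (Fin (n + 1)) := WithLp.toLp 2 fun j => (α j).im
  have hre : ∑ j, (α j).re ^ 2 = ∑ j, (α j).im ^ 2 := by
    have := congrArg Complex.re hα
    simp only [Complex.re_sum, sq, Complex.mul_re, Finset.sum_sub_distrib, Complex.zero_re] at this
    simp only [sq]; linarith
  have him : ∑ j, (α j).re * (α j).im = 0 := by
    have := congrArg Complex.im hα
    simp only [Complex.im_sum, sq, Complex.mul_im, Complex.zero_im] at this
    have h2 : ∑ j, ((α j).re * (α j).im + (α j).im * (α j).re) =
        2 * ∑ j, (α j).re * (α j).im := by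
      rw [Finset.mul_sum]; exact Finset.sum_congr rfl fun j _ => by ring
    linarith
  have hab : inner ℝ a b = 0 := by
    simp [a, b, PiLp.inner_apply]
    rw [← him]
    exact Finset.sum_congr rfl fun j _ => by ring
  have hn : ‖a‖ = ‖b‖ := by
    simp [a, b, EuclideanSpace.norm_eq, hre]
  have hx : ∀ x : Sph n, cdot α x.toC = (inner ℝ a (x : EuclideanSpace ℝ (Fin (n + 1))) : ℂ) +
        Complex.I * (inner ℝ b (x : EuclideanSpace ℝ (Fin (n + 1))) : ℂ) := by
    intro x
    simp only [cdot, Sph.toC, PiLp.inner_apply, Complex.conj_ofReal, a, b]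
    push_cast
    rw [Finset.mul_sum, ← Finset.sum_add_distrib]
    refine Finset.sum_congr rfl fun j _ => ?_
    simp only [RCLike.inner_apply, conj_trivial, Complex.ofReal_mul]
    linear_combination
      (-((x : EuclideanSpace ℝ (Fin (n + 1))) j : ℂ)) * Complex.re_add_im (α j)
  simp_rw [hx]
  by_cases ha : a = 0
  · have hb : b = 0 := by
      rw [← norm_eq_zero, ← hn, ha, norm_zero]
    simp [ha, hb, hl]
  -- The angles `0` and `π / (2l)` give the factors `1` and `-1` in front of the same integral, so
  -- both sides vanish.
  · have h0 := integral_inner_pow_eq hab hn ha l 0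
    have h1 := integral_inner_pow_eq hab hn ha l (Real.pi / (2 * l))
    have hl' : (l : ℂ) ≠ 0 := by exact_mod_cast hl
    have he : Complex.exp (2 * ((Real.pi / (2 * l) : ℝ) : ℂ) * Complex.I) ^ l = -1 := by
      rw [← Complex.exp_nat_mul, ← Complex.exp_pi_mul_I]
      congr 1
      push_cast
      field_simp
    rw [he] at h1
    simp only [Complex.ofReal_zero, mul_zero, zero_mul, Complex.exp_zero, one_pow, one_mul] at h0
    rw [← h0] at h1
    linear_combination h1 / 2

end

/-! ### Phase invariance and orthogonality of degrees -/

section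

open Filter Topology

theorem integral_gaussMeasure_smul (m : ℕ) {ħ : ℝ} (hħ : 0 < ħ) {l : ℂ} (hl : ‖l‖ = 1)
    {f : (Fin m → ℂ) → ℂ} (hf : Continuous f) :
    ∫ z, f (l • z) ∂(gaussMeasure m ħ) = ∫ z, f z ∂(gaussMeasure m ħ) := by
  have hN : ∀ z : Fin m → ℂ, ∑ j, ‖(l • z) j‖ ^ 2 = ∑ j, ‖z j‖ ^ 2 := by
    intro z; simp [hl]
  have hmp : MeasurePreserving (fun z : Fin m → ℂ => l • z) := by
    refine measurePreserving_of_gaussian_invariant volume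
      (fun z : Fin m → ℂ => 1 * ∑ i, ‖z i‖ ^ 2) (by fun_prop) (integrable_gaussian_pi one_pos)
      ((LinearMap.lsmul ℂ (Fin m → ℂ) l).restrictScalars ℝ) ?_ ?_
    · have hl0 : l ≠ 0 := by rintro rfl; simp at hl
      exact smul_right_injective _ hl0
    · intro z
      rw [one_mul, one_mul]
      exact hN z
  rw [integral_gaussMeasure m hħ, integral_gaussMeasure m hħ]
  congr 1
  have h := integral_map (μ := volume) hmp.measurable.aemeasurable
    (f := fun z => Complex.exp (-((∑ j, ‖z j‖ ^ 2 : ℝ) : ℂ) / ħ) * f z)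
    (Continuous.aestronglyMeasurable (by fun_prop))
  rw [hmp.map_eq] at h
  rw [h]
  simp only [hN]

theorem integral_homogeneous_mul_conj (m : ℕ) {ħ : ℝ} (hħ : 0 < ħ) {g h : (Fin m → ℂ) → ℂ}
    (hg : Continuous g) (hh : Continuous h) {i j : ℕ} (hij : i ≠ j)
    (hgi : ∀ (l : ℂ) z, g (l • z) = l ^ (2 * i) * g z)
    (hhj : ∀ (l : ℂ) z, h (l • z) = l ^ (2 * j) * h z) :
    ∫ z, g z * conj (h z) ∂(gaussMeasure m ħ) = 0 := by
  -- The phase is chosen so that `exp(iθ(2i - 2j)) = -1` (degrees `i` and `j` in the exponent);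
  -- invariance then equates the integral with its negative.
  set θ : ℝ := Real.pi / (2 * ((i : ℝ) - j))
  have h1 := integral_gaussMeasure_smul m hħ (l := Complex.exp (θ * Complex.I))
    (Complex.norm_exp_ofReal_mul_I θ) (f := fun z => g z * conj (h z)) (by fun_prop)
  have h2 : Complex.exp (θ * Complex.I) ^ (2 * i) *
      conj (Complex.exp (θ * Complex.I) ^ (2 * j)) = -1 := by
    have hij' : (i : ℂ) - j ≠ 0 := sub_ne_zero.2 (by exact_mod_cast hij)
    rw [map_pow, ← Complex.exp_conj, ← Complex.exp_nat_mul, ← Complex.exp_nat_mul,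
      ← Complex.exp_add, ← Complex.exp_pi_mul_I]
    congr 1
    have h2 : (starRingEnd ℂ) 2 = 2 := map_ofNat _ 2
    simp [θ, h2]
    field_simp
    ring
  have h3 : ∀ z, g (Complex.exp (θ * Complex.I) • z) * conj (h (Complex.exp (θ * Complex.I) • z)) =
      -1 * (g z * conj (h z)) := by
    intro z
    rw [hgi, hhj, map_mul, ← h2]
    ring
  simp only [h3] at h1
  rw [integral_const_mul] at h1
  linear_combination (-1 / 2) * h1

/-! ### Power series of the generating kernel -/

/-- The `ℓ`-th coefficient of the generating kernel. -/
def kerCoeff (c : SphereCase) (ħ : ℝ) (l : ℕ) (x y : Sph c.n) : ℂ :=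
  ((l.factorial : ℂ) ^ 2)⁻¹ *
    ∫ z, (qf c x z / ħ) ^ l * conj ((qf c y z / ħ) ^ l) ∂(gaussMeasure c.m ħ)

/-- A uniform bound for the coefficients of the generating kernel. -/
def kerBound (c : SphereCase) (ħ : ℝ) (l : ℕ) : ℝ :=
  ((l.factorial : ℝ) ^ 2)⁻¹ *
    ∫ z, ((∑ j, ‖z j‖ ^ 2) / (2 * ħ)) ^ (2 * l) ∂(gaussMeasure c.m ħ)

theorem norm_qf_div_le (c : SphereCase) {ħ : ℝ} (hħ : 0 < ħ) (x : Sph c.n) (z : Fin c.m → ℂ) :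
    ‖qf c x z / ħ‖ ≤ (∑ j, ‖z j‖ ^ 2) / (2 * ħ) := by
  rw [norm_div, Complex.norm_real, Real.norm_of_nonneg hħ.le]
  have := div_le_div_of_nonneg_right (norm_qf_le c x z) hħ.le
  refine this.trans_eq ?_
  field_simp

theorem gaussRadius_nonneg {m : ℕ} {ħ : ℝ} (hħ : 0 < ħ) (z : Fin m → ℂ) :
    0 ≤ (∑ j, ‖z j‖ ^ 2) / (2 * ħ) := by positivity

theorem integrable_gaussRadius_pow (m : ℕ) {ħ : ℝ} (hħ : 0 < ħ) (l : ℕ) :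
    Integrable (fun z => ((∑ j, ‖z j‖ ^ 2) / (2 * ħ)) ^ l) (gaussMeasure m ħ) := by
  refine ((integrable_exp_gaussMeasure m (a := 1 / 2) hħ (by norm_num)).const_mul
    (l.factorial : ℝ)).mono' (Continuous.aestronglyMeasurable (by fun_prop)) ?_
  refine Eventually.of_forall fun z => ?_
  have h0 := gaussRadius_nonneg hħ z
  rw [Real.norm_of_nonneg (pow_nonneg h0 _)]
  have := Real.pow_div_factorial_le_exp _ h0 l
  rw [div_le_iff₀' (by positivity)] at this
  refine this.trans_eq ?_
  congr 2
  field_simp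

theorem norm_kerCoeff_le (c : SphereCase) {ħ : ℝ} (hħ : 0 < ħ) (l : ℕ) (x y : Sph c.n) :
    ‖kerCoeff c ħ l x y‖ ≤ kerBound c ħ l := by
  rw [kerCoeff, kerBound, norm_mul, norm_inv, norm_pow, Complex.norm_natCast]
  refine mul_le_mul_of_nonneg_left ?_ (by positivity)
  refine norm_integral_le_of_norm_le (integrable_gaussRadius_pow c.m hħ (2 * l)) ?_
  refine Eventually.of_forall fun z => ?_
  rw [norm_mul, RCLike.norm_conj, norm_pow, norm_pow, two_mul l, pow_add]
  have h1 := norm_qf_div_le c hħ x z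
  have h2 := norm_qf_div_le c hħ y z
  gcongr

theorem kerBound_nonneg (c : SphereCase) {ħ : ℝ} (hħ : 0 < ħ) (l : ℕ) : 0 ≤ kerBound c ħ l := by
  unfold kerBound
  refine mul_nonneg (by positivity) (integral_nonneg fun z => pow_nonneg (gaussRadius_nonneg hħ z) _)

/-- With `s = √r` and `a = s|z|²/(2ħ)`, the partial sums are integrals of `∑ (a^l/l!)² ≤ (∑ a^l/l!)²
≤ exp(2a)`, and `exp(2a) = exp(s|z|²/ħ)` is integrable. -/
theorem summable_kerBound (c : SphereCase) {ħ : ℝ} (hħ : 0 < ħ) {r : ℝ} (hr0 : 0 ≤ r)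
    (hr : r < 1) : Summable fun l => kerBound c ħ l * r ^ l := by
  set s := √r
  have hs0 : 0 ≤ s := Real.sqrt_nonneg r
  have hs : s < 1 := by
    rw [Real.sqrt_lt' one_pos]; simpa using hr
  have hsr : s ^ 2 = r := Real.sq_sqrt hr0
  refine summable_of_sum_range_le (c := ∫ z, Real.exp (s * (∑ j, ‖z j‖ ^ 2) / ħ)
    ∂(gaussMeasure c.m ħ)) (fun l => mul_nonneg (kerBound_nonneg c hħ l) (by positivity)) ?_
  intro N
  have h1 : ∀ l, kerBound c ħ l * r ^ l = ∫ z, ((s * ((∑ j, ‖z j‖ ^ 2) / (2 * ħ))) ^ l /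
      (l.factorial : ℝ)) ^ 2 ∂(gaussMeasure c.m ħ) := by
    intro l
    rw [kerBound, mul_comm, ← mul_assoc, ← integral_const_mul]
    refine integral_congr_ae (Eventually.of_forall fun z => ?_)
    simp only
    generalize (∑ j, ‖z j‖ ^ 2) / (2 * ħ) = a
    rw [← hsr]
    ring
  have hint : ∀ l, Integrable (fun z : Fin c.m → ℂ => ((s * ((∑ j, ‖z j‖ ^ 2) / (2 * ħ))) ^ l /
      (l.factorial : ℝ)) ^ 2) (gaussMeasure c.m ħ) := by
    intro l
    refine ((integrable_gaussRadius_pow c.m hħ (2 * l)).const_mul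
      (s ^ (2 * l) / (l.factorial : ℝ) ^ 2)).congr (Eventually.of_forall fun z => ?_)
    simp only
    generalize (∑ j, ‖z j‖ ^ 2) / (2 * ħ) = a
    ring
  simp_rw [h1]
  rw [← integral_finsetSum _ fun l _ => hint l]
  refine integral_mono (integrable_finsetSum _ fun l _ => hint l)
    (integrable_exp_gaussMeasure c.m hħ hs) fun z => ?_
  set a := s * ((∑ j, ‖z j‖ ^ 2) / (2 * ħ))
  have ha : 0 ≤ a := mul_nonneg hs0 (gaussRadius_nonneg hħ z)
  calc ∑ l ∈ Finset.range N, (a ^ l / (l.factorial : ℝ)) ^ 2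
      ≤ (∑ l ∈ Finset.range N, a ^ l / (l.factorial : ℝ)) ^ 2 :=
        Finset.sum_sq_le_sq_sum_of_nonneg fun l _ => by positivity
    _ ≤ (Real.exp a) ^ 2 := by
        have := Real.sum_le_exp_of_nonneg ha N
        have h0 : 0 ≤ ∑ l ∈ Finset.range N, a ^ l / (l.factorial : ℝ) :=
          Finset.sum_nonneg fun l _ => by positivity
        gcongr
    _ = _ := by
        rw [← Real.exp_nat_mul]
        congr 1
        simp only [a]
        push_cast
        field_simp

theorem hasSum_mul_prod {f g : ℕ → ℂ} {a b : ℂ} (hf : HasSum f a) (hg : HasSum g b) :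
    HasSum (fun i : ℕ × ℕ => f i.1 * g i.2) (a * b) :=
  hf.mul hg (summable_mul_of_summable_norm hf.summable.norm hg.summable.norm)

theorem hasSum_exp_mul_conj (u v : ℂ) :
    HasSum (fun i : ℕ × ℕ => (u ^ i.1 / (i.1.factorial : ℂ)) *
      conj (v ^ i.2 / (i.2.factorial : ℂ))) (Complex.exp (u + conj v)) := by
  have e1 : ∀ w : ℂ, HasSum (fun l : ℕ => w ^ l / (l.factorial : ℂ)) (Complex.exp w) := by
    intro w
    rw [Complex.exp_eq_exp_ℂ]
    exact NormedSpace.expSeries_div_hasSum_exp w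
  have e3 : HasSum (fun l : ℕ => conj (v ^ l / (l.factorial : ℂ))) (conj (Complex.exp v)) :=
    Complex.hasSum_conj'.2 (e1 v)
  rw [Complex.exp_add, Complex.exp_conj]
  have h := hasSum_mul_prod (e1 u) e3
  exact h

theorem hasSum_genKernel (c : SphereCase) {ħ s : ℝ} (hħ : 0 < ħ) (hs0 : 0 ≤ s) (hs : s < 1)
    (x y : Sph c.n) :
    HasSum (fun l => kerCoeff c ħ l x y * ((s ^ 2) ^ l : ℝ)) (genKernel c ħ s x y) := by
  set F : ℕ × ℕ → (Fin c.m → ℂ) → ℂ := fun i z =>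
    ((s * (qf c x z / ħ)) ^ i.1 / (i.1.factorial : ℂ)) *
      conj ((s * (qf c y z / ħ)) ^ i.2 / (i.2.factorial : ℂ))
  have hcx := continuous_qf c x
  have hcy := continuous_qf c y
  have hsum : HasSum (fun i => ∫ z, F i z ∂(gaussMeasure c.m ħ)) (genKernel c ħ s x y) := by
    refine hasSum_integral_of_dominated_convergence
      (fun i (z : Fin c.m → ℂ) =>
        ((s * ((∑ j, ‖z j‖ ^ 2) / (2 * ħ))) ^ i.1 / (i.1.factorial : ℝ)) *
        ((s * ((∑ j, ‖z j‖ ^ 2) / (2 * ħ))) ^ i.2 / (i.2.factorial : ℝ))) ?_ ?_ ?_ ?_ ?_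
    · intro i
      exact Continuous.aestronglyMeasurable (by simp only [F]; fun_prop)
    · intro i
      refine Eventually.of_forall fun z => ?_
      have h1 := norm_qf_div_le c hħ x z
      have h2 := norm_qf_div_le c hħ y z
      simp only [F, norm_mul, RCLike.norm_conj, norm_div, norm_pow, Complex.norm_natCast,
        Complex.norm_real, Real.norm_of_nonneg hs0] at h1 h2 ⊢
      gcongr
    · refine Eventually.of_forall fun z => ?_
      have h0 : 0 ≤ s * ((∑ j, ‖z j‖ ^ 2) / (2 * ħ)) := mul_nonneg hs0 (gaussRadius_nonneg hħ z)
      have h1 := Real.summable_pow_div_factorial (s * ((∑ j, ‖z j‖ ^ 2) / (2 * ħ)))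
      exact h1.mul_of_nonneg h1 (fun l => by positivity) (fun l => by positivity)
    · refine (integrable_exp_gaussMeasure c.m hħ hs).congr (Eventually.of_forall fun z => ?_)
      have h0 : 0 ≤ s * ((∑ j, ‖z j‖ ^ 2) / (2 * ħ)) := mul_nonneg hs0 (gaussRadius_nonneg hħ z)
      have h1 := Real.summable_pow_div_factorial (s * ((∑ j, ‖z j‖ ^ 2) / (2 * ħ)))
      have h2 := h1.tsum_mul_tsum h1 (h1.mul_of_nonneg h1 (fun l => by positivity)
        (fun l => by positivity))
      simp only
      rw [← h2, ← congrFun NormedSpace.exp_eq_tsum_div, ← Real.exp_eq_exp_ℝ, ← Real.exp_add]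
      congr 1
      field_simp
      norm_num
    · refine Eventually.of_forall fun z => ?_
      have e := hasSum_exp_mul_conj (s * (qf c x z / ħ)) (s * (qf c y z / ħ))
      have e5 : (s * (qf c x z / ħ) + conj (s * (qf c y z / ħ)) : ℂ) =
          s / ħ * (qf c x z + conj (qf c y z)) := by
        simp
        ring
      rw [e5] at e
      exact e
  -- Expanding both exponentials gives a double series; its off-diagonal terms vanish by phase
  -- invariance, so only pairs `(l, l)`, and hence only powers of `s²`, remain.
  have hinj : Function.Injective fun l : ℕ => (l, l) := fun a b h => (Prod.ext_iff.1 h).1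
  rw [← hinj.hasSum_iff] at hsum
  · convert hsum using 1
    ext l
    simp only [Function.comp_apply, kerCoeff, F]
    rw [mul_right_comm, mul_comm, mul_comm _ ((((s ^ 2) ^ l : ℝ)) : ℂ), mul_comm,
      ← integral_const_mul]
    refine integral_congr_ae (Eventually.of_forall fun z => ?_)
    simp only [mul_pow, map_div₀, map_mul, map_pow, Complex.conj_ofReal, map_natCast]
    push_cast
    field_simp
    ring
  · rintro ⟨i, j⟩ hij
    have hne : i ≠ j := by
      rintro rfl
      exact hij ⟨i, rfl⟩
    refine integral_homogeneous_mul_conj c.m hħ (by fun_prop) (by fun_prop) hne ?_ ?_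
    · intro l z
      rw [qf_smul, pow_mul]
      ring
    · intro l z
      rw [qf_smul, pow_mul]
      ring

theorem summable_nat_mul_pow {κ : ℕ → ℝ} (hκ : ∀ l, 0 ≤ κ l)
    (h : ∀ r, 0 ≤ r → r < 1 → Summable fun l => κ l * r ^ l) {r : ℝ} (hr0 : 0 ≤ r) (hr : r < 1) :
    Summable fun l : ℕ => (l : ℝ) * (κ l * r ^ l) := by
  -- The factor `l` is absorbed by enlarging the radius, since `l (r/ρ)^l → 0`.
  obtain ⟨ρ, hrρ, hρ⟩ := exists_between hr
  have hρ0 : 0 < ρ := hr0.trans_lt hrρ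
  have hq : r / ρ < 1 := (div_lt_one hρ0).2 hrρ
  have hq0 : 0 ≤ r / ρ := by positivity
  have ht := tendsto_self_mul_const_pow_of_lt_one hq0 hq
  have hev : ∀ᶠ l : ℕ in atTop, (l : ℝ) * (r / ρ) ^ l < 1 := ht.eventually_lt_const one_pos
  refine Summable.of_norm_bounded_eventually_nat (h ρ hρ0.le hρ) ?_
  filter_upwards [hev] with l hl
  have hk := hκ l
  rw [Real.norm_of_nonneg (by positivity)]
  have : (l : ℝ) * (κ l * r ^ l) = κ l * ρ ^ l * (l * (r / ρ) ^ l) := by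
    rw [div_pow]; field_simp
  rw [this]
  exact mul_le_of_le_one_right (by positivity) hl.le

theorem SphereCase.two_le_n (c : SphereCase) : 2 ≤ c.n := by
  cases c <;> decide

theorem SphereCase.one_le_n_sub_one (c : SphereCase) : (1 : ℝ) ≤ (c.n : ℝ) - 1 := by
  have : (2 : ℝ) ≤ c.n := by exact_mod_cast c.two_le_n
  linarith

/-! ### From the generating function to the Poisson kernel -/

/-- The Poisson kernel of the unit ball of `ℝ^{n+1}` as a function of the inner product. -/
def poissonKer (n : ℕ) (r t : ℝ) : ℝ :=
  (1 - r ^ 2) * poissonDenom r t ^ (-((n : ℝ) - 1) / 2 - 1)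

theorem summable_deriv_bound (c : SphereCase) {ħ : ℝ} (hħ : 0 < ħ) {r : ℝ} (hr0 : 0 < r)
    (hr : r < 1) : Summable fun l : ℕ => kerBound c ħ l * ((l : ℝ) * r ^ (l - 1)) := by
  refine ((summable_nat_mul_pow (kerBound_nonneg c hħ)
    (fun r h0 h1 => summable_kerBound c hħ h0 h1) hr0.le hr).mul_right r⁻¹).congr fun l => ?_
  rcases l with _ | l
  · simp
  · rw [Nat.add_sub_cancel, pow_succ]
    field_simp

theorem hasDerivAt_genSeries (c : SphereCase) {ħ : ℝ} (hħ : 0 < ħ) (x y : Sph c.n) {r : ℝ}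
    (hr0 : 0 < r) (hr : r < 1) :
    HasDerivAt (fun σ : ℝ => ∑' l, kerCoeff c ħ l x y * ((σ ^ l : ℝ) : ℂ))
      (∑' l : ℕ, kerCoeff c ħ l x y * (((l : ℝ) * r ^ (l - 1) : ℝ) : ℂ)) r := by
  obtain ⟨r1, hr1, hr1'⟩ := exists_between hr
  have h0 : 0 < r1 := hr0.trans hr1
  refine hasDerivAt_tsum_of_isPreconnected (t := Set.Ioo 0 r1) (y₀ := r)
    (g := fun (l : ℕ) (σ : ℝ) => kerCoeff c ħ l x y * ((σ ^ l : ℝ) : ℂ))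
    (g' := fun (l : ℕ) (σ : ℝ) => kerCoeff c ħ l x y * (((l : ℝ) * σ ^ (l - 1) : ℝ) : ℂ))
    (summable_deriv_bound c hħ h0 hr1')
    isOpen_Ioo isPreconnected_Ioo ?_ ?_ ⟨hr0, hr1⟩ ?_ ⟨hr0, hr1⟩
  · intro l σ _
    exact ((hasDerivAt_pow l σ).ofReal_comp).const_mul _
  · intro l σ hσ
    rw [norm_mul, Complex.norm_real, Real.norm_of_nonneg (by have := hσ.1; positivity)]
    have h1 := norm_kerCoeff_le c hħ l x y
    have h2 := hσ.1
    have h3 := hσ.2.le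
    have h4 := kerBound_nonneg c hħ l
    gcongr
  · refine Summable.of_norm_bounded (summable_kerBound c hħ hr0.le hr) fun l => ?_
    rw [norm_mul, Complex.norm_real, Real.norm_of_nonneg (by positivity)]
    exact mul_le_mul_of_nonneg_right (norm_kerCoeff_le c hħ l x y) (by positivity)

theorem hasSum_genSeries (c : SphereCase) {ħ : ℝ} (hħ : 0 < ħ) (x y : Sph c.n) {r : ℝ}
    (hr0 : 0 ≤ r) (hr : r < 1) :
    HasSum (fun l => kerCoeff c ħ l x y * ((r ^ l : ℝ) : ℂ))
      ((poissonDenom r (inner ℝ (x : EuclideanSpace ℝ (Fin (c.n + 1))) y) ^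
        (-((c.n : ℝ) - 1) / 2) : ℝ) : ℂ) := by
  have hs : √r < 1 := by
    rw [Real.sqrt_lt' one_pos]; simpa using hr
  have h := hasSum_genKernel c hħ (Real.sqrt_nonneg r) hs x y
  rwa [genKernel_eq c hħ (Real.sqrt_nonneg r) hs, Real.sq_sqrt hr0] at h

/-- Apply `1 + (2/p) r d/dr`, `p = n - 1`, to both sides of the generating series. Termwise it
multiplies by `(2l + p)/p`; on `D^(-p/2)` it yields `D^(-p/2-1) (D - r D')`, and `D - r D' = 1 -
r²`. -/
theorem hasSum_poissonKer (c : SphereCase) {ħ : ℝ} (hħ : 0 < ħ) (x y : Sph c.n) {r : ℝ}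
    (hr0 : 0 < r) (hr : r < 1) :
    HasSum (fun l : ℕ => (((2 * l + ((c.n : ℝ) - 1)) / ((c.n : ℝ) - 1) * r ^ l : ℝ) : ℂ) *
      kerCoeff c ħ l x y)
      (poissonKer c.n r (inner ℝ (x : EuclideanSpace ℝ (Fin (c.n + 1))) y) : ℂ) := by
  set t := inner ℝ (x : EuclideanSpace ℝ (Fin (c.n + 1))) y
  set p := (c.n : ℝ) - 1
  have hp : 0 < p := by have := c.one_le_n_sub_one; simp only [p]; linarith
  have hD := poissonDenom_pos hr0.le hr (abs_inner_sphere_le x y)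
  change 0 < poissonDenom r t at hD
  have h1 := hasDerivAt_genSeries c hħ x y hr0 hr
  have h2 : HasDerivAt (fun σ : ℝ => ((poissonDenom σ t ^ (-p / 2) : ℝ) : ℂ))
      (((2 * r - 2 * t) * (-p / 2) * poissonDenom r t ^ (-p / 2 - 1) : ℝ) : ℂ) r := by
    have hd : HasDerivAt (fun σ => poissonDenom σ t) (2 * r - 2 * t) r := by
      unfold poissonDenom
      have := (((hasDerivAt_id r).const_mul 2).mul_const t).const_sub 1 |>.add (hasDerivAt_pow 2 r)
      exact this.congr_deriv (by norm_num; ring)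
    exact (hd.rpow_const (Or.inl hD.ne')).ofReal_comp
  have h3 : (fun σ : ℝ => ∑' l, kerCoeff c ħ l x y * ((σ ^ l : ℝ) : ℂ)) =ᶠ[𝓝 r]
      fun σ : ℝ => ((poissonDenom σ t ^ (-p / 2) : ℝ) : ℂ) := by
    filter_upwards [Ioo_mem_nhds hr0 hr] with σ hσ
    exact (hasSum_genSeries c hħ x y hσ.1.le hσ.2).tsum_eq
  have h4 := h1.unique (h2.congr_of_eventuallyEq h3)
  have hs : Summable fun l : ℕ => kerCoeff c ħ l x y * (((l : ℝ) * r ^ (l - 1) : ℝ) : ℂ) := by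
    refine Summable.of_norm_bounded (summable_deriv_bound c hħ hr0 hr) fun l => ?_
    rw [norm_mul, Complex.norm_real, Real.norm_of_nonneg (by positivity)]
    exact mul_le_mul_of_nonneg_right (norm_kerCoeff_le c hħ l x y) (by positivity)
  have h5 := hs.hasSum
  rw [h4] at h5
  have h6 := (hasSum_genSeries c hħ x y hr0.le hr).add (h5.mul_left ((2 / p * r : ℝ) : ℂ))
  convert h6 using 1
  · ext l
    rcases l with _ | l
    · simp [hp.ne']
    · rw [Nat.add_sub_cancel, pow_succ]
      have : (p : ℂ) ≠ 0 := by exact_mod_cast hp.ne'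
      push_cast
      field_simp
      ring
  · rw [← Complex.ofReal_mul, ← Complex.ofReal_add, Complex.ofReal_inj, poissonKer]
    have e : poissonDenom r t ^ (-p / 2) =
        poissonDenom r t * poissonDenom r t ^ (-p / 2 - 1) := by
      rw [Real.rpow_sub_one hD.ne']
      field_simp
    change (1 - r ^ 2) * poissonDenom r t ^ (-p / 2 - 1) = poissonDenom r t ^ (-p / 2) + _
    rw [e]
    generalize poissonDenom r t ^ (-p / 2 - 1) = X
    unfold poissonDenom
    field_simp
    ring

theorem summable_poissonBound (c : SphereCase) {ħ : ℝ} (hħ : 0 < ħ) {r : ℝ}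
    (hr0 : 0 ≤ r) (hr : r < 1) :
    Summable (fun l : ℕ => ((2 * l + ((c.n : ℝ) - 1)) / ((c.n : ℝ) - 1) * r ^ l) *
      kerBound c ħ l) := by
  have h1 := summable_kerBound c hħ hr0 hr
  have h2 := summable_nat_mul_pow (kerBound_nonneg c hħ)
    (fun r h0 h1 => summable_kerBound c hħ h0 h1) hr0 hr
  have hp : (c.n : ℝ) - 1 ≠ 0 := by have := c.one_le_n_sub_one; linarith
  refine ((h2.mul_left (2 / ((c.n : ℝ) - 1))).add h1).congr fun l => ?_
  field_simp

theorem norm_poissonTerm_le (c : SphereCase) {ħ : ℝ} (hħ : 0 < ħ) (x y : Sph c.n) {r : ℝ}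
    (hr0 : 0 ≤ r) (l : ℕ) :
    ‖(((2 * l + ((c.n : ℝ) - 1)) / ((c.n : ℝ) - 1) * r ^ l : ℝ) : ℂ) * kerCoeff c ħ l x y‖ ≤
      ((2 * l + ((c.n : ℝ) - 1)) / ((c.n : ℝ) - 1) * r ^ l) * kerBound c ħ l := by
  have hp : 0 < (c.n : ℝ) - 1 := by have := c.one_le_n_sub_one; linarith
  rw [norm_mul, Complex.norm_real, Real.norm_of_nonneg (by positivity)]
  exact mul_le_mul_of_nonneg_left (norm_kerCoeff_le c hħ l x y) (by positivity)

theorem hasSum_congr_fun {ι : Type*} {f g : ι → ℂ} {a : ℂ} (h : ∀ i, f i = g i) :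
    HasSum f a ↔ HasSum g a := by
  rw [funext h]

/-! ### Moments of functions on the sphere -/

instance sFinite_gaussMeasure (m : ℕ) (ħ : ℝ) : SFinite (gaussMeasure m ħ) := by
  unfold gaussMeasure; infer_instance

theorem integral_sphere_gauss_swap {n m : ℕ} {ħ : ℝ} {f : Sph n → (Fin m → ℂ) → ℂ}
    (hf : Continuous f.uncurry) {g : (Fin m → ℂ) → ℝ} (hg : Integrable g (gaussMeasure m ħ))
    (hb : ∀ x z, ‖f x z‖ ≤ g z) :
    ∫ x, ∫ z, f x z ∂(gaussMeasure m ħ) ∂(sphMeasure n) =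
      ∫ z, ∫ x, f x z ∂(sphMeasure n) ∂(gaussMeasure m ħ) := by
  refine integral_integral_swap ?_
  refine (hg.comp_snd (sphMeasure n)).mono' hf.aestronglyMeasurable ?_
  exact Eventually.of_forall fun p => hb p.1 p.2

theorem exists_norm_bound {n : ℕ} {φ : Sph n → ℂ} (hφ : Continuous φ) :
    ∃ M, 0 ≤ M ∧ ∀ x, ‖φ x‖ ≤ M := by
  obtain ⟨M, hM⟩ := (isCompact_univ (X := Sph n)).exists_bound_of_continuousOn hφ.continuousOn
  exact ⟨max M 0, le_max_right _ _, fun x => (hM x (Set.mem_univ x)).trans (le_max_left _ _)⟩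

theorem continuous_integral_sphere {n : ℕ} {X : Type*} [TopologicalSpace X]
    [FirstCountableTopology X] [LocallyCompactSpace X]
    {f : X → Sph n → ℂ} (hf : Continuous f.uncurry) :
    Continuous fun p => ∫ x, f p x ∂(sphMeasure n) := by
  have := continuous_parametric_integral_of_continuous (μ := sphMeasure n) hf
    (isCompact_univ (X := Sph n))
  simpa using this

theorem integrable_sphere {n : ℕ} {φ : Sph n → ℂ} (hφ : Continuous φ) :
    Integrable φ (sphMeasure n) :=
  hφ.integrable_of_hasCompactSupport (HasCompactSupport.of_compactSpace φ)

/-- The `ℓ`-th moment of `φ` against `ρ(z)`. -/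
def moment (c : SphereCase) (ħ : ℝ) (φ : Sph c.n → ℂ) (l : ℕ) (z : Fin c.m → ℂ) : ℂ :=
  ∫ x, (qf c x z / ħ) ^ l * φ x ∂(sphMeasure c.n)

theorem continuous_moment (c : SphereCase) (ħ : ℝ) {φ : Sph c.n → ℂ} (hφ : Continuous φ) (l : ℕ) :
    Continuous (moment c ħ φ l) := by
  refine continuous_integral_sphere (f := fun z x => (qf c x z / ħ) ^ l * φ x) ?_
  have h := (continuous_qf_uncurry c).comp continuous_swap
  have h2 : Continuous fun p : (Fin c.m → ℂ) × Sph c.n => φ p.2 := hφ.comp continuous_snd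
  exact ((h.div_const _).pow l).mul h2

theorem moment_smul (c : SphereCase) (ħ : ℝ) (φ : Sph c.n → ℂ) (l : ℕ) (a : ℂ)
    (z : Fin c.m → ℂ) : moment c ħ φ l (a • z) = a ^ (2 * l) * moment c ħ φ l z := by
  rw [moment, moment, ← integral_const_mul]
  congr 1
  ext x
  rw [qf_smul, pow_mul]
  ring

theorem norm_moment_le (c : SphereCase) {ħ : ℝ} (hħ : 0 < ħ) {φ : Sph c.n → ℂ} {M : ℝ}
    (hM : ∀ x, ‖φ x‖ ≤ M) (l : ℕ) (z : Fin c.m → ℂ) :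
    ‖moment c ħ φ l z‖ ≤ ((∑ j, ‖z j‖ ^ 2) / (2 * ħ)) ^ l * M := by
  have h := norm_integral_le_of_norm_le_const (μ := sphMeasure c.n)
    (f := fun x => (qf c x z / ħ) ^ l * φ x) (C := ((∑ j, ‖z j‖ ^ 2) / (2 * ħ)) ^ l * M)
    (Eventually.of_forall fun x => ?_)
  · simpa [moment] using h
  · rw [norm_mul, norm_pow]
    have h1 := norm_qf_div_le c hħ x z
    have h2 := hM x
    gcongr

theorem integral_kerCoeff_mul (c : SphereCase) {ħ : ℝ} (hħ : 0 < ħ) {φ : Sph c.n → ℂ}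
    (hφ : Continuous φ) (l : ℕ) (x : Sph c.n) :
    ∫ y, kerCoeff c ħ l x y * conj (φ y) ∂(sphMeasure c.n) =
      ((l.factorial : ℂ) ^ 2)⁻¹ *
        ∫ z, (qf c x z / ħ) ^ l * conj (moment c ħ φ l z) ∂(gaussMeasure c.m ħ) := by
  obtain ⟨M, hM0, hM⟩ := exists_norm_bound hφ
  have hq := continuous_qf_uncurry c
  have h := integral_sphere_gauss_swap (ħ := ħ)
    (f := fun y z => (qf c x z / ħ) ^ l * conj ((qf c y z / ħ) ^ l * φ y))
    (g := fun z => ((∑ j, ‖z j‖ ^ 2) / (2 * ħ)) ^ (2 * l) * M) ?_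
    ((integrable_gaussRadius_pow c.m hħ (2 * l)).mul_const M) ?_
  · calc _ = ((l.factorial : ℂ) ^ 2)⁻¹ * ∫ y, ∫ z, (qf c x z / ħ) ^ l *
          conj ((qf c y z / ħ) ^ l * φ y) ∂(gaussMeasure c.m ħ) ∂(sphMeasure c.n) := by
          rw [← integral_const_mul]
          congr 1
          ext y
          rw [kerCoeff, mul_assoc, ← integral_mul_const]
          congr 2
          ext z
          rw [map_mul, mul_assoc]
      _ = _ := by
          rw [h]
          congr 2
          ext z
          rw [integral_const_mul, moment, ← integral_conj]
  · have h1 : Continuous fun p : Sph c.n × (Fin c.m → ℂ) => qf c x p.2 :=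
      (continuous_qf c x).comp continuous_snd
    have h2 : Continuous fun p : Sph c.n × (Fin c.m → ℂ) => φ p.1 := hφ.comp continuous_fst
    exact ((h1.div_const _).pow l).mul
      (Complex.continuous_conj.comp (((hq.div_const _).pow l).mul h2))
  · intro y z
    rw [norm_mul, RCLike.norm_conj, norm_mul, norm_pow, norm_pow, two_mul l, pow_add, mul_assoc]
    have h1 := norm_qf_div_le c hħ x z
    have h2 := norm_qf_div_le c hħ y z
    have h3 := hM y
    gcongr

/-- Fubini, used once in each sphere variable. It identifies the quadratic form of the kernel
coefficient with the squared norm of a moment, so it is nonnegative and can enter an Abel limit. -/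
theorem integral_integral_kerCoeff (c : SphereCase) {ħ : ℝ} (hħ : 0 < ħ) {φ : Sph c.n → ℂ}
    (hφ : Continuous φ) (l : ℕ) :
    ∫ x, ∫ y, kerCoeff c ħ l x y * conj (φ y) * φ x ∂(sphMeasure c.n) ∂(sphMeasure c.n) =
      ((l.factorial : ℂ) ^ 2)⁻¹ *
        ∫ z, moment c ħ φ l z * conj (moment c ħ φ l z) ∂(gaussMeasure c.m ħ) := by
  obtain ⟨M, hM0, hM⟩ := exists_norm_bound hφ
  have hq := continuous_qf_uncurry c
  have h := integral_sphere_gauss_swap (ħ := ħ)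
    (f := fun x z => (qf c x z / ħ) ^ l * φ x * conj (moment c ħ φ l z))
    (g := fun z => ((∑ j, ‖z j‖ ^ 2) / (2 * ħ)) ^ (2 * l) * (M * M)) ?_
    ((integrable_gaussRadius_pow c.m hħ (2 * l)).mul_const (M * M)) ?_
  · simp_rw [integral_mul_const, integral_kerCoeff_mul c hħ hφ, mul_assoc]
    rw [integral_const_mul]
    congr 1
    calc _ = ∫ x, ∫ z, (qf c x z / ħ) ^ l * φ x * conj (moment c ħ φ l z)
          ∂(gaussMeasure c.m ħ) ∂(sphMeasure c.n) := by
          congr 1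
          ext x
          rw [← integral_mul_const]
          congr 1
          ext z
          ring
      _ = _ := by
          rw [h]
          congr 1
          ext z
          rw [integral_mul_const, moment]
  · have h2 : Continuous fun p : Sph c.n × (Fin c.m → ℂ) => φ p.1 := hφ.comp continuous_fst
    have h3 : Continuous fun p : Sph c.n × (Fin c.m → ℂ) => moment c ħ φ l p.2 :=
      (continuous_moment c ħ hφ l).comp continuous_snd
    exact (((hq.div_const _).pow l).mul h2).mul (Complex.continuous_conj.comp h3)
  · intro x z
    rw [norm_mul, RCLike.norm_conj, norm_mul, norm_pow, two_mul l, pow_add]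
    have h1 := norm_qf_div_le c hħ x z
    have h2 := norm_moment_le c hħ hM l z
    have h3 := hM x
    calc _ ≤ ((∑ j, ‖z j‖ ^ 2) / (2 * ħ)) ^ l * M * (((∑ j, ‖z j‖ ^ 2) / (2 * ħ)) ^ l * M) := by
          gcongr
      _ = _ := by ring

theorem continuous_kerCoeff (c : SphereCase) {ħ : ℝ} (hħ : 0 < ħ) (l : ℕ) :
    Continuous fun p : Sph c.n × Sph c.n => kerCoeff c ħ l p.1 p.2 := by
  unfold kerCoeff
  refine continuous_const.mul (continuous_of_dominated
    (bound := fun z : Fin c.m → ℂ => ((∑ j, ‖z j‖ ^ 2) / (2 * ħ)) ^ (2 * l)) ?_ ?_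
    (integrable_gaussRadius_pow c.m hħ (2 * l)) ?_)
  · intro p
    have h1 := continuous_qf c p.1
    have h2 := continuous_qf c p.2
    exact Continuous.aestronglyMeasurable (by fun_prop)
  · intro p
    refine Eventually.of_forall fun z => ?_
    rw [norm_mul, RCLike.norm_conj, norm_pow, norm_pow, two_mul l, pow_add]
    have h1 := norm_qf_div_le c hħ p.1 z
    have h2 := norm_qf_div_le c hħ p.2 z
    gcongr
  · refine Eventually.of_forall fun z => ?_
    have h1 : Continuous fun p : Sph c.n × Sph c.n => qf c p.1 z :=
      (continuous_qf_uncurry c).comp (continuous_fst.prodMk continuous_const)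
    have h2 : Continuous fun p : Sph c.n × Sph c.n => qf c p.2 z :=
      (continuous_qf_uncurry c).comp (continuous_snd.prodMk continuous_const)
    exact ((h1.div_const _).pow l).mul
      (Complex.continuous_conj.comp ((h2.div_const _).pow l))

/-! ### The Poisson kernel as an approximate identity -/

/-- The weight of the `ℓ`-th kernel coefficient in the Poisson kernel. -/
def weight (n l : ℕ) : ℝ := (2 * l + ((n : ℝ) - 1)) / ((n : ℝ) - 1)

theorem kerCoeff_zero (c : SphereCase) {ħ : ℝ} (hħ : 0 < ħ) (x y : Sph c.n) :
    kerCoeff c ħ 0 x y = 1 := by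
  simp [kerCoeff, -integral_const, integral_one_gaussMeasure c.m hħ]

theorem moment_one (c : SphereCase) (ħ : ℝ) {l : ℕ} (hl : l ≠ 0) (z : Fin c.m → ℂ) :
    moment c ħ (fun _ => 1) l z = 0 := by
  simp only [moment, mul_one, div_pow]
  rw [integral_div]
  unfold qf
  rw [integral_cdot_pow_eq_zero _ (sum_rho_sq c z) hl, zero_div]

theorem integral_kerCoeff (c : SphereCase) {ħ : ℝ} (hħ : 0 < ħ) {l : ℕ} (hl : l ≠ 0)
    (x : Sph c.n) : ∫ y, kerCoeff c ħ l x y ∂(sphMeasure c.n) = 0 := by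
  have h := integral_kerCoeff_mul c hħ (φ := fun _ => 1) continuous_const l x
  simpa [moment_one c ħ hl] using h

/-- The Poisson kernel as a function of two points of the sphere. -/
def sphPoisson {n : ℕ} (r : ℝ) (x y : Sph n) : ℝ :=
  poissonKer n r (inner ℝ (x : EuclideanSpace ℝ (Fin (n + 1))) y)

theorem hasSum_sphPoisson (c : SphereCase) {ħ : ℝ} (hħ : 0 < ħ) (x y : Sph c.n) {r : ℝ}
    (hr0 : 0 < r) (hr : r < 1) :
    HasSum (fun l : ℕ => ((weight c.n l * r ^ l : ℝ) : ℂ) * kerCoeff c ħ l x y)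
      (sphPoisson r x y : ℂ) :=
  hasSum_poissonKer c hħ x y hr0 hr

theorem integral_sphPoisson_complex (c : SphereCase) (x : Sph c.n) {r : ℝ}
    (hr0 : 0 < r) (hr : r < 1) :
    ∫ y, (sphPoisson r x y : ℂ) ∂(sphMeasure c.n) = 1 := by
  -- The kernel does not involve `ħ`, so its expansion may be taken at `ħ = 1`. Only the term `l =
  -- 0` has nonzero integral over the sphere.
  have h := hasSum_integral_of_dominated_convergence (μ := sphMeasure c.n)
    (F := fun (l : ℕ) y => ((weight c.n l * r ^ l : ℝ) : ℂ) * kerCoeff c 1 l x y)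
    (f := fun y => (sphPoisson r x y : ℂ))
    (fun l _ => weight c.n l * r ^ l * kerBound c 1 l) ?_ ?_ ?_ ?_ ?_
  · refine (h.unique ?_)
    refine (hasSum_congr_fun fun l => ?_).2 (hasSum_ite_eq 0 (1 : ℂ))
    rw [integral_const_mul]
    split_ifs with hl
    · subst hl
      have := c.one_le_n_sub_one
      have h0 : (c.n : ℝ) - 1 ≠ 0 := by linarith
      simp [kerCoeff_zero c one_pos, weight, h0]
    · rw [integral_kerCoeff c one_pos hl, mul_zero]
  · intro l
    have := (continuous_kerCoeff c (ħ := 1) one_pos l).comp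
      (continuous_const.prodMk continuous_id : Continuous fun y : Sph c.n => (x, y))
    exact (continuous_const.mul this).aestronglyMeasurable
  · intro l
    exact Eventually.of_forall fun y => norm_poissonTerm_le c one_pos x y hr0.le l
  · exact Eventually.of_forall fun y => summable_poissonBound c one_pos hr0.le hr
  · exact integrable_const _
  · exact Eventually.of_forall fun y => hasSum_sphPoisson c one_pos x y hr0 hr

theorem integral_sphPoisson (c : SphereCase) (x : Sph c.n) {r : ℝ} (hr0 : 0 < r) (hr : r < 1) :
    ∫ y, sphPoisson r x y ∂(sphMeasure c.n) = 1 := by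
  have := integral_sphPoisson_complex c x hr0 hr
  rw [integral_complex_ofReal] at this
  exact_mod_cast this

theorem continuous_sphPoisson {n : ℕ} {r : ℝ} (hr0 : 0 ≤ r) (hr : r < 1) :
    Continuous fun p : Sph n × Sph n => sphPoisson r p.1 p.2 := by
  unfold sphPoisson poissonKer
  refine continuous_const.mul (Continuous.rpow_const ?_ fun p => Or.inl ?_)
  · unfold poissonDenom
    fun_prop
  · exact (poissonDenom_pos hr0 hr (abs_inner_sphere_le p.1 p.2)).ne'

theorem sphPoisson_nonneg {n : ℕ} {r : ℝ} (hr0 : 0 ≤ r) (hr : r < 1) (x y : Sph n) :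
    0 ≤ sphPoisson r x y := by
  have := poissonDenom_pos hr0 hr (abs_inner_sphere_le x y)
  unfold sphPoisson poissonKer
  have h2 : r ^ 2 ≤ 1 := pow_le_one₀ hr0 hr.le
  exact mul_nonneg (by linarith) (Real.rpow_nonneg this.le _)

theorem hasSum_integral_sphPoisson (c : SphereCase) {ħ : ℝ} (hħ : 0 < ħ) {φ : Sph c.n → ℂ}
    (hφ : Continuous φ) {r : ℝ} (hr0 : 0 < r) (hr : r < 1) :
    HasSum (fun l : ℕ => ((weight c.n l * r ^ l : ℝ) : ℂ) * (((l.factorial : ℂ) ^ 2)⁻¹ *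
        ∫ z, moment c ħ φ l z * conj (moment c ħ φ l z) ∂(gaussMeasure c.m ħ)))
      (∫ x, ∫ y, sphPoisson r x y * conj (φ y) * φ x ∂(sphMeasure c.n) ∂(sphMeasure c.n)) := by
  obtain ⟨M, hM0, hM⟩ := exists_norm_bound hφ
  have hφ1 : Continuous fun p : Sph c.n × Sph c.n => φ p.1 := hφ.comp continuous_fst
  have hφ2 : Continuous fun p : Sph c.n × Sph c.n => conj (φ p.2) :=
    Complex.continuous_conj.comp (hφ.comp continuous_snd)
  have hcont : ∀ l, Continuous fun p : Sph c.n × Sph c.n => ((weight c.n l * r ^ l : ℝ) : ℂ) *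
      (kerCoeff c ħ l p.1 p.2 * conj (φ p.2) * φ p.1) := fun l =>
    continuous_const.mul (((continuous_kerCoeff c hħ l).mul hφ2).mul hφ1)
  have hcP : Continuous fun p : Sph c.n × Sph c.n =>
      (sphPoisson r p.1 p.2 : ℂ) * conj (φ p.2) * φ p.1 :=
    ((Complex.continuous_ofReal.comp (continuous_sphPoisson hr0.le hr)).mul hφ2).mul hφ1
  have hint : ∀ {f : Sph c.n × Sph c.n → ℂ}, Continuous f →
      Integrable f ((sphMeasure c.n).prod (sphMeasure c.n)) := fun hf =>
    hf.integrable_of_hasCompactSupport (HasCompactSupport.of_compactSpace _)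
  have h := hasSum_integral_of_dominated_convergence
    (μ := (sphMeasure c.n).prod (sphMeasure c.n))
    (F := fun (l : ℕ) p => ((weight c.n l * r ^ l : ℝ) : ℂ) *
      (kerCoeff c ħ l p.1 p.2 * conj (φ p.2) * φ p.1))
    (f := fun p => (sphPoisson r p.1 p.2 : ℂ) * conj (φ p.2) * φ p.1)
    (fun l _ => weight c.n l * r ^ l * kerBound c ħ l * (M * M)) ?_ ?_ ?_ ?_ ?_
  · rw [integral_prod _ (hint hcP)] at h
    refine (hasSum_congr_fun fun l => ?_).1 h
    have hi : Integrable (fun p : Sph c.n × Sph c.n =>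
        kerCoeff c ħ l p.1 p.2 * conj (φ p.2) * φ p.1) ((sphMeasure c.n).prod (sphMeasure c.n)) :=
      hint (((continuous_kerCoeff c hħ l).mul hφ2).mul hφ1)
    rw [integral_const_mul, integral_prod _ hi, ← integral_integral_kerCoeff c hħ hφ]
  · exact fun l => (hcont l).aestronglyMeasurable
  · intro l
    refine Eventually.of_forall fun p => ?_
    have h1 := norm_poissonTerm_le c hħ p.1 p.2 hr0.le l
    have h2 := hM p.1
    have h3 := hM p.2
    rw [← mul_assoc, ← mul_assoc, norm_mul, norm_mul, RCLike.norm_conj, mul_assoc]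
    change _ ≤ weight c.n l * r ^ l * kerBound c ħ l at h1
    refine mul_le_mul h1 (mul_le_mul h3 h2 (norm_nonneg _) hM0) (by positivity)
      ((norm_nonneg _).trans h1)
  · exact Eventually.of_forall fun p =>
      (summable_poissonBound c hħ hr0.le hr).mul_right (M * M)
  · exact integrable_const _
  · refine Eventually.of_forall fun p => ?_
    have := ((hasSum_sphPoisson c hħ p.1 p.2 hr0 hr).mul_right (conj (φ p.2))).mul_right (φ p.1)
    refine this.congr_fun ?_ |> fun h => h
    intro l
    simp only [mul_assoc]

/-- The denominator equals `(1 - r)² + r|x - y|²`; this keeps the kernel from concentrating away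
from the diagonal. -/
theorem poissonDenom_inner_ge {n : ℕ} {r δ : ℝ} (hr : 1 / 2 ≤ r) (x y : Sph n)
    (hδ : 0 ≤ δ) (h : δ ≤ dist y x) :
    δ ^ 2 / 2 ≤ poissonDenom r (inner ℝ (x : EuclideanSpace ℝ (Fin (n + 1))) y) := by
  have h1 : dist y x ^ 2 = 2 - 2 * inner ℝ (x : EuclideanSpace ℝ (Fin (n + 1))) y := by
    rw [Subtype.dist_eq, dist_comm, dist_eq_norm, norm_sub_sq_real, norm_eq_of_mem_sphere x,
      norm_eq_of_mem_sphere y]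
    ring
  have h2 : δ ^ 2 ≤ dist y x ^ 2 := pow_le_pow_left₀ hδ h 2
  unfold poissonDenom
  nlinarith [sq_nonneg (1 - r), sq_nonneg (dist y x)]

theorem sphPoisson_le {n : ℕ} (hn : 1 ≤ n) {r δ : ℝ} (hr : 1 / 2 ≤ r) (hr1 : r < 1) (x y : Sph n)
    (hδ : 0 < δ) (h : δ ≤ dist y x) :
    sphPoisson r x y ≤ (1 - r ^ 2) * (δ ^ 2 / 2) ^ (-((n : ℝ) - 1) / 2 - 1) := by
  have h1 := poissonDenom_inner_ge hr x y hδ.le h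
  have h2 : r ^ 2 ≤ 1 := pow_le_one₀ (by linarith) hr1.le
  have hn' : (1 : ℝ) ≤ n := by exact_mod_cast hn
  unfold sphPoisson poissonKer
  refine mul_le_mul_of_nonneg_left ?_ (by linarith)
  exact Real.rpow_le_rpow_of_nonpos (by positivity) h1 (by linarith)

theorem continuous_sphPoisson_right {n : ℕ} {r : ℝ} (hr0 : 0 ≤ r) (hr : r < 1) (x : Sph n) :
    Continuous fun y : Sph n => sphPoisson r x y := by
  unfold sphPoisson poissonKer
  refine continuous_const.mul (Continuous.rpow_const ?_ fun y => Or.inl ?_)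
  · unfold poissonDenom
    fun_prop
  · exact (poissonDenom_pos hr0 hr (abs_inner_sphere_le x y)).ne'

/-- The peak-function theorem applies: the kernel is nonnegative, has mass one, and off any
neighbourhood of `x` is at most a constant times `1 - r²`. -/
theorem tendsto_integral_sphPoisson (c : SphereCase) {g : Sph c.n → ℂ} (hg : Continuous g)
    (x : Sph c.n) :
    Tendsto (fun r : ℝ => ∫ y, (sphPoisson r x y : ℂ) * g y ∂(sphMeasure c.n)) (𝓝[<] 1)
      (𝓝 (g x)) := by
  have hev : ∀ᶠ r : ℝ in 𝓝[<] 1, 1 / 2 ≤ r ∧ r < 1 :=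
    (eventually_nhdsWithin_of_eventually_nhds (eventually_ge_nhds (by norm_num))).and
      eventually_mem_nhdsWithin
  have h := tendsto_integral_peak_smul_of_integrable_of_tendsto (μ := sphMeasure c.n) (x₀ := x)
    (φ := fun r y => sphPoisson r x y) (g := g) (l := 𝓝[<] (1 : ℝ)) (a := g x)
    MeasurableSet.univ univ_mem (measure_ne_top _ _) ?_ ?_ ?_ ?_ (integrable_sphere hg)
    (hg.tendsto x)
  · simpa only [Complex.real_smul] using h
  · filter_upwards [hev] with r hr y
    exact sphPoisson_nonneg (by linarith [hr.1]) hr.2 x y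
  · intro u hu hx
    obtain ⟨δ, hδ, hball⟩ := Metric.isOpen_iff.1 hu x hx
    rw [Metric.tendstoUniformlyOn_iff]
    intro ε hε
    have ht : Tendsto (fun r : ℝ => (1 - r ^ 2) * (δ ^ 2 / 2) ^ (-((c.n : ℝ) - 1) / 2 - 1))
        (𝓝[<] 1) (𝓝 0) := by
      have hc : Continuous fun r : ℝ =>
          (1 - r ^ 2) * (δ ^ 2 / 2) ^ (-((c.n : ℝ) - 1) / 2 - 1) := by fun_prop
      have := hc.tendsto 1
      simp only [one_pow, sub_self, zero_mul] at this
      exact this.mono_left nhdsWithin_le_nhds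
    filter_upwards [hev, ht.eventually_lt_const hε] with r hr hlt y hy
    have hd : δ ≤ dist y x := by
      by_contra hcon
      exact hy (hball (not_le.1 hcon))
    rw [Pi.zero_apply, dist_zero_left, Real.norm_of_nonneg
      (sphPoisson_nonneg (by linarith [hr.1]) hr.2 x y)]
    have hn : 1 ≤ c.n := one_le_two.trans c.two_le_n
    have hle := sphPoisson_le (n := c.n) hn hr.1 hr.2 x y hδ hd
    exact lt_of_le_of_lt hle hlt
  · simp only [setIntegral_univ]
    refine tendsto_const_nhds.congr' ?_
    filter_upwards [hev] with r hr
    exact (integral_sphPoisson c x (by linarith [hr.1]) hr.2).symm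
  · filter_upwards [hev] with r hr
    have hr0 : 0 ≤ r := by linarith [hr.1]
    exact (continuous_sphPoisson_right hr0 hr.2 x).aestronglyMeasurable

theorem norm_integral_sphPoisson_mul_le (c : SphereCase) {g : Sph c.n → ℂ} {M : ℝ}
    (hM : ∀ x, ‖g x‖ ≤ M) (x : Sph c.n) {r : ℝ} (hr0 : 0 < r) (hr : r < 1) :
    ‖∫ y, (sphPoisson r x y : ℂ) * g y ∂(sphMeasure c.n)‖ ≤ M := by
  have hc := continuous_sphPoisson_right hr0.le hr x
  have hi : Integrable (fun y : Sph c.n => sphPoisson r x y * M) (sphMeasure c.n) :=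
    (hc.integrable_of_hasCompactSupport (HasCompactSupport.of_compactSpace _)).mul_const M
  refine (norm_integral_le_of_norm_le hi (Eventually.of_forall fun y => ?_)).trans_eq ?_
  · have h0 := sphPoisson_nonneg hr0.le hr x y
    rw [norm_mul, Complex.norm_real, Real.norm_of_nonneg h0]
    exact mul_le_mul_of_nonneg_left (hM y) h0
  · rw [integral_mul_const, integral_sphPoisson c x hr0 hr, one_mul]

theorem tendsto_integral_integral_sphPoisson (c : SphereCase) {φ : Sph c.n → ℂ}
    (hφ : Continuous φ) :
    Tendsto (fun r : ℝ => ∫ x, ∫ y, (sphPoisson r x y : ℂ) * conj (φ y) * φ x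
        ∂(sphMeasure c.n) ∂(sphMeasure c.n)) (𝓝[<] 1)
      (𝓝 (∫ x, conj (φ x) * φ x ∂(sphMeasure c.n))) := by
  obtain ⟨M, hM0, hM⟩ := exists_norm_bound hφ
  have hφc : Continuous fun y => conj (φ y) := Complex.continuous_conj.comp hφ
  have hMc : ∀ y, ‖conj (φ y)‖ ≤ M := fun y => by rw [RCLike.norm_conj]; exact hM y
  have hev : ∀ᶠ r : ℝ in 𝓝[<] 1, 0 < r ∧ r < 1 :=
    (eventually_nhdsWithin_of_eventually_nhds (eventually_gt_nhds (by norm_num))).and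
      eventually_mem_nhdsWithin
  simp_rw [integral_mul_const]
  refine tendsto_integral_filter_of_dominated_convergence (fun _ => M * M) ?_ ?_
    (integrable_const _) ?_
  · filter_upwards [hev] with r hr
    refine Continuous.aestronglyMeasurable (Continuous.mul ?_ hφ)
    refine continuous_integral_sphere (f := fun x y => (sphPoisson r x y : ℂ) * conj (φ y)) ?_
    exact (Complex.continuous_ofReal.comp (continuous_sphPoisson hr.1.le hr.2)).mul
      (hφc.comp continuous_snd)
  · filter_upwards [hev] with r hr
    refine Eventually.of_forall fun x => ?_
    rw [norm_mul]
    have h1 := norm_integral_sphPoisson_mul_le c hMc x hr.1 hr.2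
    exact mul_le_mul h1 (hM x) (norm_nonneg _) hM0
  · exact Eventually.of_forall fun x => (tendsto_integral_sphPoisson c hφc x).mul_const _

/-! ### Parseval identity for the moments -/

/-- If `∑ rˡ aₗ` converges for every `r < 1` and has a limit as `r → 1`, then `∑ aₗ` converges to
that limit, provided that the terms are nonnegative. -/
theorem hasSum_of_tendsto_abel {a : ℕ → ℝ} (ha : ∀ l, 0 ≤ a l) {S : ℝ → ℝ} {s : ℝ}
    (hS : ∀ r, 0 < r → r < 1 → HasSum (fun l => r ^ l * a l) (S r))
    (hlim : Tendsto S (𝓝[<] 1) (𝓝 s)) : HasSum a s := by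
  have hev : ∀ᶠ r : ℝ in 𝓝[<] 1, 0 < r ∧ r < 1 :=
    (eventually_nhdsWithin_of_eventually_nhds (eventually_gt_nhds (by norm_num))).and
      eventually_mem_nhdsWithin
  have hpart : ∀ N, ∑ l ∈ Finset.range N, a l ≤ s := by
    intro N
    have h1 : Tendsto (fun r : ℝ => ∑ l ∈ Finset.range N, r ^ l * a l) (𝓝[<] 1)
        (𝓝 (∑ l ∈ Finset.range N, a l)) := by
      have hc : Continuous fun r : ℝ => ∑ l ∈ Finset.range N, r ^ l * a l := by fun_prop
      have := hc.tendsto 1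
      simp only [one_pow, one_mul] at this
      exact this.mono_left nhdsWithin_le_nhds
    refine le_of_tendsto_of_tendsto h1 hlim ?_
    filter_upwards [hev] with r hr
    exact sum_le_hasSum _ (fun l _ => mul_nonneg (pow_nonneg hr.1.le l) (ha l)) (hS r hr.1 hr.2)
  have hsum : Summable a := summable_of_sum_range_le ha hpart
  have hle : ∑' l, a l ≤ s := hsum.tsum_le_of_sum_range_le hpart
  have hge : s ≤ ∑' l, a l := by
    refine le_of_tendsto hlim ?_
    filter_upwards [hev] with r hr
    refine hasSum_le (fun l => ?_) (hS r hr.1 hr.2) hsum.hasSum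
    exact mul_le_of_le_one_left (ha l) (pow_le_one₀ hr.1.le hr.2.le)
  rw [← le_antisymm hle hge]
  exact hsum.hasSum

theorem coeff_sq (c : SphereCase) (l : ℕ) :
    coeff c.n l ^ 2 = weight c.n l * ((l.factorial : ℝ) ^ 2)⁻¹ := by
  have h := c.one_le_n_sub_one
  have hl : (0 : ℝ) ≤ l := Nat.cast_nonneg l
  rw [coeff, weight, div_pow, mul_pow, Real.sq_sqrt (by linarith), Real.sq_sqrt (by linarith)]
  field_simp
  ring

theorem integral_mul_conj_eq {α : Type*} [MeasurableSpace α] (μ : Measure α) (f : α → ℂ) :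
    ∫ z, f z * conj (f z) ∂μ = ((∫ z, ‖f z‖ ^ 2 ∂μ : ℝ) : ℂ) := by
  rw [← integral_complex_ofReal]
  congr 1
  ext z
  rw [Complex.mul_conj, Complex.normSq_eq_norm_sq]

/-- By `coeff_sq` the `l`-th term is the coefficient of `r^l` in the Poisson integral of `φ` paired
with `φ`. As `r → 1` that pairing tends to `‖φ‖²`, and nonnegativity of the terms permits setting `r
= 1` in the series. -/
theorem hasSum_integral_norm_sq (c : SphereCase) {ħ : ℝ} (hħ : 0 < ħ) {φ : Sph c.n → ℂ}
    (hφ : Continuous φ) :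
    HasSum (fun l : ℕ => ∫ z, ‖(coeff c.n l : ℂ) * moment c ħ φ l z‖ ^ 2 ∂(gaussMeasure c.m ħ))
      (∫ x, ‖φ x‖ ^ 2 ∂(sphMeasure c.n)) := by
  have hterm : ∀ l : ℕ, ∫ z, ‖(coeff c.n l : ℂ) * moment c ħ φ l z‖ ^ 2 ∂(gaussMeasure c.m ħ) =
      weight c.n l * (((l.factorial : ℝ) ^ 2)⁻¹ *
        ∫ z, ‖moment c ħ φ l z‖ ^ 2 ∂(gaussMeasure c.m ħ)) := by
    intro l
    rw [← mul_assoc, ← coeff_sq, ← integral_const_mul]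
    congr 1
    ext z
    rw [norm_mul, mul_pow, Complex.norm_real, Real.norm_of_nonneg (coeff_nonneg _ _)]
  have hlim := (Complex.continuous_re.tendsto _).comp (tendsto_integral_integral_sphPoisson c hφ)
  have e : (∫ x, conj (φ x) * φ x ∂(sphMeasure c.n)).re = ∫ x, ‖φ x‖ ^ 2 ∂(sphMeasure c.n) := by
    simp_rw [mul_comm (conj _)]
    rw [integral_mul_conj_eq, Complex.ofReal_re]
  rw [e] at hlim
  refine hasSum_of_tendsto_abel (fun l => integral_nonneg fun z => by positivity) ?_ hlim
  intro r hr0 hr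
  have h := Complex.hasSum_re (hasSum_integral_sphPoisson c hħ hφ hr0 hr)
  have e2 : (fun l : ℕ => r ^ l * ∫ z, ‖(coeff c.n l : ℂ) * moment c ħ φ l z‖ ^ 2
      ∂(gaussMeasure c.m ħ)) = fun l : ℕ => (((weight c.n l * r ^ l : ℝ) : ℂ) *
      (((l.factorial : ℂ) ^ 2)⁻¹ *
        ∫ z, moment c ħ φ l z * conj (moment c ħ φ l z) ∂(gaussMeasure c.m ħ))).re := by
    ext l
    have e3 : ((l.factorial : ℂ) ^ 2)⁻¹ = ((((l.factorial : ℝ) ^ 2)⁻¹ : ℝ) : ℂ) := by push_cast; rfl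
    rw [hterm, integral_mul_conj_eq, e3, ← Complex.ofReal_mul, ← Complex.ofReal_mul,
      Complex.ofReal_re]
    ring
  rw [e2]
  exact h

/-! ### The transform as an isometry, and the resolution of the identity -/

theorem ae_eq_of_tendsto_lp {α : Type*} [MeasurableSpace α] {μ : Measure α} {F : ℕ → Lp ℂ 2 μ}
    {G : Lp ℂ 2 μ} (hG : Tendsto F atTop (𝓝 G)) {Fr : ℕ → α → ℂ} (hF : ∀ n, F n =ᵐ[μ] Fr n)
    {f : α → ℂ} (hf : ∀ z, Tendsto (fun n => Fr n z) atTop (𝓝 (f z))) : G =ᵐ[μ] f := by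
  obtain ⟨ns, hns, hae⟩ := (tendstoInMeasure_of_tendsto_Lp hG).exists_seq_tendsto_ae
  filter_upwards [hae, ae_all_iff.2 hF] with z h1 h2
  simp only [h2] at h1
  exact tendsto_nhds_unique h1 ((hf z).comp hns.tendsto_atTop)

theorem norm_sq_of_ae_eq {α : Type*} [MeasurableSpace α] {μ : Measure α} {f : α → ℂ}
    {G : Lp ℂ 2 μ} (h : G =ᵐ[μ] f) : ‖G‖ ^ 2 = ∫ z, ‖f z‖ ^ 2 ∂μ := by
  have h1 := inner_self_eq_norm_sq_to_K (𝕜 := ℂ) G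
  rw [L2.inner_def] at h1
  have h2 : ∫ z, inner ℂ (G z) (G z) ∂μ = ((∫ z, ‖f z‖ ^ 2 ∂μ : ℝ) : ℂ) := by
    rw [← integral_complex_ofReal]
    refine integral_congr_ae ?_
    filter_upwards [h] with z hz
    rw [hz, inner_self_eq_norm_sq_to_K]
    push_cast
    rfl
  rw [h2] at h1
  refine Complex.ofReal_injective ?_
  rw [h1]
  push_cast
  rfl

theorem hasSum_of_orthogonal {E : Type*} [NormedAddCommGroup E] [InnerProductSpace ℂ E]
    [CompleteSpace E] {F : ℕ → E} (horth : Pairwise fun i j => inner ℂ (F i) (F j) = 0) {s : ℝ}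
    (hs : HasSum (fun l => ‖F l‖ ^ 2) s) : ∃ G, HasSum F G ∧ ‖G‖ ^ 2 = s := by
  have hV : OrthogonalFamily ℂ (fun i => Submodule.span ℂ {F i})
      fun i => (Submodule.span ℂ {F i}).subtypeₗᵢ := by
    intro i j hij v w
    obtain ⟨a, ha⟩ := Submodule.mem_span_singleton.1 v.2
    obtain ⟨b, hb⟩ := Submodule.mem_span_singleton.1 w.2
    change inner ℂ (v : E) (w : E) = 0
    rw [← ha, ← hb, inner_smul_left, inner_smul_right, horth hij, mul_zero, mul_zero]
  let f : ∀ i, Submodule.span ℂ {F i} := fun i => ⟨F i, Submodule.mem_span_singleton_self _⟩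
  have hsum : Summable F := (hV.summable_iff_norm_sq_summable f).2 hs.summable
  obtain ⟨G, hG⟩ := hsum
  refine ⟨G, hG, ?_⟩
  have h1 : ∀ t : Finset ℕ, ‖∑ i ∈ t, F i‖ ^ 2 = ∑ i ∈ t, ‖F i‖ ^ 2 := fun t => hV.norm_sum f t
  have h2 : Tendsto (fun t : Finset ℕ => ‖∑ i ∈ t, F i‖ ^ 2) atTop (𝓝 (‖G‖ ^ 2)) :=
    ((continuous_norm.pow 2).tendsto G).comp hG
  simp_rw [h1] at h2
  exact tendsto_nhds_unique h2 hs

/-- The transform of a continuous function on the sphere, term by term. -/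
theorem hasSum_bargmann (c : SphereCase) (ħ : ℝ) (φ : C(Sph c.n, ℂ)) (z : Fin c.m → ℂ) :
    HasSum (fun l : ℕ => (coeff c.n l : ℂ) * moment c ħ φ l z)
      (bargmann c ħ (ContinuousMap.toLp 2 (sphMeasure c.n) ℂ φ) z) := by
  obtain ⟨M, hM0, hM⟩ := exists_norm_bound φ.continuous
  have hq : Continuous fun x : Sph c.n => qf c x z / ħ :=
    ((continuous_qf_uncurry c).comp (continuous_id.prodMk continuous_const)).div_const _
  obtain ⟨R, hR0, hR⟩ := exists_norm_bound hq
  have hterm : ∀ (l : ℕ) x, ‖(coeff c.n l : ℂ) * (qf c x z / ħ) ^ l‖ ≤ coeff c.n l * |R| ^ l := by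
    intro l x
    rw [norm_mul, norm_pow, Complex.norm_real, Real.norm_of_nonneg (coeff_nonneg _ l),
      abs_of_nonneg hR0]
    exact mul_le_mul_of_nonneg_left (pow_le_pow_left₀ (norm_nonneg _) (hR x) l) (coeff_nonneg _ l)
  have e : bargmann c ħ (ContinuousMap.toLp 2 (sphMeasure c.n) ℂ φ) z =
      ∫ x, (∑' l : ℕ, (coeff c.n l : ℂ) * (qf c x z / ħ) ^ l) * φ x ∂(sphMeasure c.n) := by
    refine integral_congr_ae ?_
    filter_upwards [ContinuousMap.coeFn_toLp (𝕜 := ℂ) (p := 2) (sphMeasure c.n) φ] with x hx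
    rw [hx]
    rfl
  have e2 : (fun l : ℕ => (coeff c.n l : ℂ) * moment c ħ φ l z) = fun l : ℕ =>
      ∫ x, (coeff c.n l : ℂ) * (qf c x z / ħ) ^ l * φ x ∂(sphMeasure c.n) := by
    ext l
    simp_rw [mul_assoc]
    rw [integral_const_mul, moment]
  rw [e, e2]
  refine hasSum_integral_of_dominated_convergence (fun l _ => coeff c.n l * |R| ^ l * M) ?_ ?_ ?_
    (integrable_const _) ?_
  · exact fun l => ((continuous_const.mul (hq.pow l)).mul φ.continuous).aestronglyMeasurable
  · intro l
    refine Eventually.of_forall fun x => ?_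
    rw [norm_mul]
    exact mul_le_mul (hterm l x) (hM x) (norm_nonneg _) ((norm_nonneg _).trans (hterm l x))
  · exact Eventually.of_forall fun x => (summable_coeff c.n R).mul_right M
  · refine Eventually.of_forall fun x => HasSum.mul_right _ ?_
    exact (Summable.of_norm_bounded (summable_coeff c.n R) fun l => hterm l x).hasSum

theorem memLp_coeff_moment (c : SphereCase) {ħ : ℝ} (hħ : 0 < ħ) {φ : Sph c.n → ℂ}
    (hφ : Continuous φ) (l : ℕ) :
    MemLp (fun z => (coeff c.n l : ℂ) * moment c ħ φ l z) 2 (gaussMeasure c.m ħ) := by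
  obtain ⟨M, hM0, hM⟩ := exists_norm_bound hφ
  refine MemLp.const_mul ?_ _
  have hc := continuous_moment c ħ hφ l
  refine (memLp_two_iff_integrable_sq_norm hc.aestronglyMeasurable).2 ?_
  refine ((integrable_gaussRadius_pow c.m hħ (2 * l)).mul_const (M ^ 2)).mono'
    (hc.norm.pow 2).aestronglyMeasurable (Eventually.of_forall fun z => ?_)
  rw [Real.norm_of_nonneg (by positivity), mul_comm 2 l, pow_mul, ← mul_pow]
  exact pow_le_pow_left₀ (norm_nonneg _) (norm_moment_le c hħ hM l z) 2

/-- The homogeneous terms are orthogonal and their squared norms sum to `‖φ‖²`, so the series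
converges in `L²(μ)` with the right norm. It also converges pointwise to the transform, and a
subsequence converging almost everywhere identifies the two limits. -/
theorem bargmann_toLp (c : SphereCase) {ħ : ℝ} (hħ : 0 < ħ) (φ : C(Sph c.n, ℂ)) :
    ∃ G : Lp ℂ 2 (gaussMeasure c.m ħ),
      G =ᵐ[gaussMeasure c.m ħ] bargmann c ħ (ContinuousMap.toLp 2 (sphMeasure c.n) ℂ φ) ∧
      ‖G‖ = ‖ContinuousMap.toLp 2 (sphMeasure c.n) ℂ φ‖ := by
  set F : ℕ → Lp ℂ 2 (gaussMeasure c.m ħ) := fun l => (memLp_coeff_moment c hħ φ.continuous l).toLp _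
  have horth : Pairwise fun i j => inner ℂ (F i) (F j) = 0 := by
    intro i j hij
    rw [L2.inner_def]
    rw [← integral_homogeneous_mul_conj c.m hħ (g := fun z => (coeff c.n j : ℂ) * moment c ħ φ j z)
      (h := fun z => (coeff c.n i : ℂ) * moment c ħ φ i z)
      (continuous_const.mul (continuous_moment c ħ φ.continuous j))
      (continuous_const.mul (continuous_moment c ħ φ.continuous i)) hij.symm
      (fun a z => by rw [moment_smul]; ring) (fun a z => by rw [moment_smul]; ring)]
    refine integral_congr_ae ?_
    filter_upwards [(memLp_coeff_moment c hħ φ.continuous i).coeFn_toLp,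
      (memLp_coeff_moment c hħ φ.continuous j).coeFn_toLp] with z h1 h2
    simp only [F]
    rw [h1, h2]
    rfl
  have hs := hasSum_integral_norm_sq c hħ φ.continuous
  simp_rw [← norm_sq_of_ae_eq (memLp_coeff_moment c hħ φ.continuous _).coeFn_toLp] at hs
  obtain ⟨G, hG, hn⟩ := hasSum_of_orthogonal horth hs
  refine ⟨G, ?_, ?_⟩
  · refine ae_eq_of_tendsto_lp hG.tendsto_sum_nat (Fr := fun N z =>
      ∑ l ∈ Finset.range N, (coeff c.n l : ℂ) * moment c ħ φ l z) ?_
      fun z => (hasSum_bargmann c ħ φ z).tendsto_sum_nat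
    intro N
    induction N with
    | zero =>
      simp only [Finset.range_zero, Finset.sum_empty]
      exact Lp.coeFn_zero ℂ 2 (gaussMeasure c.m ħ)
    | succ N ih =>
      simp only [Finset.sum_range_succ]
      exact (Lp.coeFn_add _ _).trans
        (ih.add (memLp_coeff_moment c hħ φ.continuous N).coeFn_toLp)
  · rw [← sq_eq_sq₀ (norm_nonneg _) (norm_nonneg _), hn]
    exact (norm_sq_of_ae_eq (ContinuousMap.coeFn_toLp (𝕜 := ℂ) (p := 2) (sphMeasure c.n) φ)).symm

theorem conj_cdot {k : ℕ} (z w : Fin k → ℂ) : conj (cdot z w) = cdot w z := by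
  unfold cdot
  rw [map_sum]
  refine Finset.sum_congr rfl fun j _ => ?_
  rw [map_mul, Complex.conj_conj, mul_comm]

theorem conj_coherentFun (n : ℕ) (ħ : ℝ) (α : Fin (n + 1) → ℂ) (x : Sph n) :
    conj (coherentFun n ħ α x) = ∑' l : ℕ, (coeff n l : ℂ) * (cdot α x.toC / (ħ : ℂ)) ^ l := by
  rw [coherentFun, Complex.conj_tsum]
  congr 1
  ext l
  rw [map_mul, map_pow, map_div₀, conj_cdot, Complex.conj_ofReal, Complex.conj_ofReal]

/-- The kernel of the transform is the complex conjugate of `Φ_z`. Linearity of the transform and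
pointwise continuity in `ψ` follow at once. -/
theorem bargmann_eq_ip (c : SphereCase) (ħ : ℝ) (ψ : L2 c.n) (z : Fin c.m → ℂ) :
    bargmann c ħ ψ z = ip ψ (Phi c ħ z) := by
  rw [ip, L2.inner_def]
  refine integral_congr_ae ?_
  filter_upwards [ContinuousMap.coeFn_toLp (𝕜 := ℂ) (p := 2) (sphMeasure c.n)
    ⟨coherentFun c.n ħ (rho c z), continuous_coherentFun c.n ħ (rho c z)⟩] with x hx
  rw [Phi, coherent, hx, RCLike.inner_apply', ContinuousMap.coe_mk, conj_coherentFun]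

theorem bargmann_add (c : SphereCase) (ħ : ℝ) (φ ψ : L2 c.n) (z : Fin c.m → ℂ) :
    bargmann c ħ (φ + ψ) z = bargmann c ħ φ z + bargmann c ħ ψ z := by
  simp only [bargmann_eq_ip, ip, inner_add_right]

theorem bargmann_sub (c : SphereCase) (ħ : ℝ) (φ ψ : L2 c.n) (z : Fin c.m → ℂ) :
    bargmann c ħ (φ - ψ) z = bargmann c ħ φ z - bargmann c ħ ψ z := by
  simp only [bargmann_eq_ip, ip, inner_sub_right]

theorem bargmann_smul (c : SphereCase) (ħ : ℝ) (a : ℂ) (ψ : L2 c.n) (z : Fin c.m → ℂ) :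
    bargmann c ħ (a • ψ) z = a * bargmann c ħ ψ z := by
  simp only [bargmann_eq_ip, ip, inner_smul_right]

theorem tendsto_bargmann (c : SphereCase) (ħ : ℝ) {f : ℕ → L2 c.n} {ψ : L2 c.n}
    (h : Tendsto f atTop (𝓝 ψ)) (z : Fin c.m → ℂ) :
    Tendsto (fun k => bargmann c ħ (f k) z) atTop (𝓝 (bargmann c ħ ψ z)) := by
  simp only [bargmann_eq_ip, ip]
  exact tendsto_const_nhds.inner h

/-- Extension from the dense subspace of continuous functions: the isometry carries Cauchy sequences
to Cauchy sequences, and since evaluation at a point is continuous on `L²(S^n)` the limit is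
represented by the integral formula itself. -/
theorem exists_lp_bargmann (c : SphereCase) {ħ : ℝ} (hħ : 0 < ħ) (ψ : L2 c.n) :
    ∃ G : Lp ℂ 2 (gaussMeasure c.m ħ), G =ᵐ[gaussMeasure c.m ħ] bargmann c ħ ψ ∧ ‖G‖ = ‖ψ‖ := by
  choose U hU hUn using fun φ : C(Sph c.n, ℂ) => bargmann_toLp c hħ φ
  have hd : DenseRange (ContinuousMap.toLp (E := ℂ) 2 (sphMeasure c.n) ℂ) :=
    ContinuousMap.toLp_denseRange ℂ _ ℂ (by norm_num)
  obtain ⟨v, hv, hlim⟩ := mem_closure_iff_seq_limit.1 (hd ψ)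
  choose f hf using hv
  have hfl : Tendsto (fun k => ContinuousMap.toLp (E := ℂ) 2 (sphMeasure c.n) ℂ (f k)) atTop
      (𝓝 ψ) := by simpa only [hf] using hlim
  have hsub : ∀ i j, U (f i) - U (f j) = U (f i - f j) := by
    intro i j
    refine Lp.ext ?_
    filter_upwards [Lp.coeFn_sub (U (f i)) (U (f j)), hU (f i), hU (f j), hU (f i - f j)]
      with z h1 h2 h3 h4
    rw [h1, Pi.sub_apply, h2, h3, h4, map_sub, bargmann_sub]
  have hC : CauchySeq fun k => U (f k) := by
    have h1 := hfl.cauchySeq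
    rw [Metric.cauchySeq_iff] at h1 ⊢
    intro ε hε
    obtain ⟨N, hN⟩ := h1 ε hε
    refine ⟨N, fun i hi j hj => ?_⟩
    have h2 := hN i hi j hj
    rwa [dist_eq_norm, hsub, hUn, map_sub, ← dist_eq_norm]
  obtain ⟨G, hG⟩ := cauchySeq_tendsto_of_complete hC
  refine ⟨G, ae_eq_of_tendsto_lp hG (fun k => hU (f k)) fun z => tendsto_bargmann c ħ hfl z, ?_⟩
  refine tendsto_nhds_unique hG.norm ?_
  simp only [hUn]
  exact hfl.norm

/-- The transform is an isometry of `L²(S^n)` into `L²(ℂ^m, dμ)`. -/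
theorem exists_bargmannIsometry (c : SphereCase) {ħ : ℝ} (hħ : 0 < ħ) :
    ∃ U : L2 c.n →ₗᵢ[ℂ] Lp ℂ 2 (gaussMeasure c.m ħ),
      ∀ ψ, U ψ =ᵐ[gaussMeasure c.m ħ] bargmann c ħ ψ := by
  choose U hU hUn using fun ψ : L2 c.n => exists_lp_bargmann c hħ ψ
  refine ⟨⟨⟨⟨U, fun φ ψ => ?_⟩, fun a ψ => ?_⟩, hUn⟩, hU⟩
  · refine Lp.ext ?_
    filter_upwards [Lp.coeFn_add (U φ) (U ψ), hU φ, hU ψ, hU (φ + ψ)] with z h1 h2 h3 h4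
    rw [h1, Pi.add_apply, h2, h3, h4, bargmann_add]
  · refine Lp.ext ?_
    filter_upwards [Lp.coeFn_smul a (U ψ), hU ψ, hU (a • ψ)] with z h1 h2 h3
    rw [RingHom.id_apply, h1, Pi.smul_apply, h2, h3, bargmann_smul, smul_eq_mul]

theorem integrable_bargmann_mul_conj (c : SphereCase) {ħ : ℝ} (hħ : 0 < ħ) (φ ψ : L2 c.n) :
    Integrable (fun u => bargmann c ħ φ u * conj (bargmann c ħ ψ u)) (gaussMeasure c.m ħ) := by
  obtain ⟨U, hU⟩ := exists_bargmannIsometry c hħ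
  refine (L2.integrable_inner (𝕜 := ℂ) (U ψ) (U φ)).congr ?_
  filter_upwards [hU φ, hU ψ] with u h1 h2
  rw [h1, h2, RCLike.inner_apply]

theorem integral_bargmann_mul_conj (c : SphereCase) {ħ : ℝ} (hħ : 0 < ħ) (φ ψ : L2 c.n) :
    ∫ u, bargmann c ħ φ u * conj (bargmann c ħ ψ u) ∂(gaussMeasure c.m ħ) = ip φ ψ := by
  obtain ⟨U, hU⟩ := exists_bargmannIsometry c hħ
  rw [ip, ← U.inner_map_map, L2.inner_def]
  refine integral_congr_ae ?_
  filter_upwards [hU φ, hU ψ] with u h1 h2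
  rw [h1, h2, RCLike.inner_apply]

/-- The coherent states resolve the identity. -/
theorem ip_resolution (c : SphereCase) {ħ : ℝ} (hħ : 0 < ħ) (φ ψ : L2 c.n) :
    Integrable (fun u => ip φ (Phi c ħ u) * ip (Phi c ħ u) ψ) (gaussMeasure c.m ħ) ∧
      ∫ u, ip φ (Phi c ħ u) * ip (Phi c ħ u) ψ ∂(gaussMeasure c.m ħ) = ip φ ψ := by
  have e : (fun u => ip φ (Phi c ħ u) * ip (Phi c ħ u) ψ) =
      fun u => bargmann c ħ φ u * conj (bargmann c ħ ψ u) := by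
    ext u
    rw [bargmann_eq_ip, bargmann_eq_ip, ip, ip, ip, inner_conj_symm]
  rw [e]
  exact ⟨integrable_bargmann_mul_conj c hħ φ ψ, integral_bargmann_mul_conj c hħ φ ψ⟩

/-! ### Almost everywhere nonvanishing of `Q` -/

theorem measurable_bargmann_toLp (c : SphereCase) (ħ : ℝ) (φ : C(Sph c.n, ℂ)) :
    Measurable (bargmann c ħ (ContinuousMap.toLp 2 (sphMeasure c.n) ℂ φ)) := by
  refine measurable_of_tendsto_metrizable (f := fun N z =>
    ∑ l ∈ Finset.range N, (coeff c.n l : ℂ) * moment c ħ φ l z) (fun N => ?_)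
    (tendsto_pi_nhds.2 fun z => (hasSum_bargmann c ħ φ z).tendsto_sum_nat)
  exact (continuous_finsetSum _ fun l _ =>
    continuous_const.mul (continuous_moment c ħ φ.continuous l)).measurable

/-- By homogeneity of the moments the transform along a complex line is a power series in `s²` that
converges everywhere. Holomorphy in one variable is enough for the argument about zeros. -/
theorem differentiable_bargmann_smul (c : SphereCase) {ħ : ℝ} (hħ : 0 < ħ) (φ : C(Sph c.n, ℂ))
    (u : Fin c.m → ℂ) :
    Differentiable ℂ fun s : ℂ =>
      bargmann c ħ (ContinuousMap.toLp 2 (sphMeasure c.n) ℂ φ) (s • u) := by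
  obtain ⟨M, hM0, hM⟩ := exists_norm_bound φ.continuous
  have e : (fun s : ℂ => bargmann c ħ (ContinuousMap.toLp 2 (sphMeasure c.n) ℂ φ) (s • u)) =
      fun s : ℂ => ∑' l : ℕ, (coeff c.n l : ℂ) * (s ^ (2 * l) * moment c ħ φ l u) := by
    ext s
    rw [← (hasSum_bargmann c ħ φ (s • u)).tsum_eq]
    congr 1
    ext l
    rw [moment_smul]
  rw [e]
  intro s
  set A := (∑ j, ‖u j‖ ^ 2) / (2 * ħ)
  have hA : 0 ≤ A := gaussRadius_nonneg hħ u
  have h := Complex.differentiableOn_tsum_of_summable_norm (U := Metric.ball (0 : ℂ) (‖s‖ + 1))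
    (F := fun (l : ℕ) (s : ℂ) => (coeff c.n l : ℂ) * (s ^ (2 * l) * moment c ħ φ l u))
    ((summable_coeff c.n ((‖s‖ + 1) ^ 2 * A)).mul_right M) ?_ Metric.isOpen_ball ?_
  · exact h.differentiableAt (Metric.isOpen_ball.mem_nhds (by simp))
  · intro l
    exact Differentiable.differentiableOn (by fun_prop)
  · intro l w hw
    have hw' : ‖w‖ ≤ ‖s‖ + 1 := (mem_ball_zero_iff.1 hw).le
    have h1 := norm_moment_le c hħ hM l u
    rw [norm_mul, norm_mul, norm_pow, Complex.norm_real, Real.norm_of_nonneg (coeff_nonneg _ l),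
      abs_of_nonneg (by positivity), mul_pow, ← pow_mul, mul_assoc, mul_assoc]
    refine mul_le_mul_of_nonneg_left ?_ (coeff_nonneg _ l)
    gcongr

theorem rho_zero (c : SphereCase) : rho c 0 = 0 := by
  have := rho_smul c 0 0
  simpa using this

theorem Phi_zero (c : SphereCase) (ħ : ℝ) :
    Phi c ħ 0 = ContinuousMap.toLp 2 (sphMeasure c.n) ℂ (ContinuousMap.const _ 1) := by
  rw [Phi, coherent]
  congr 1
  ext x
  have h : (c.n : ℝ) - 1 ≠ 0 := by have := c.one_le_n_sub_one; linarith
  have hs : √((c.n : ℝ) - 1) ≠ 0 :=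
    (Real.sqrt_pos.2 (by have := c.one_le_n_sub_one; linarith)).ne'
  have hz : cdot x.toC (0 : Fin (c.n + 1) → ℂ) = 0 := by simp [cdot]
  simp only [ContinuousMap.coe_mk, ContinuousMap.const_apply, coherentFun, rho_zero, hz]
  rw [tsum_eq_single 0 fun l hl => by simp [hl]]
  simp [coeff, hs]

theorem coeff_zero (c : SphereCase) : coeff c.n 0 = 1 := by
  have hs : √((c.n : ℝ) - 1) ≠ 0 :=
    (Real.sqrt_pos.2 (by have := c.one_le_n_sub_one; linarith)).ne'
  simp [coeff, hs]

/-- The state at the origin is the constant `1`, whose moments of positive degree vanish. This one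
value shows both that no coherent state is zero and that `Q` is not identically zero on any line
through the origin. -/
theorem Q_zero_right (c : SphereCase) (ħ : ℝ) (z : Fin c.m → ℂ) : Q c ħ z 0 = 1 := by
  rw [Q, Phi_zero]
  refine (hasSum_bargmann c ħ _ z).unique ?_
  refine (hasSum_congr_fun fun l => ?_).2 (hasSum_ite_eq 0 (1 : ℂ))
  split_ifs with hl
  · subst hl
    simp [coeff_zero, moment]
  · change (coeff c.n l : ℂ) * moment c ħ (fun _ => 1) l z = 0
    rw [moment_one c ħ hl, mul_zero]

theorem Q_eq_ip (c : SphereCase) (ħ : ℝ) (z w : Fin c.m → ℂ) :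
    Q c ħ z w = ip (Phi c ħ w) (Phi c ħ z) := bargmann_eq_ip c ħ _ z

theorem conj_ip {n : ℕ} (φ ψ : L2 n) : conj (ip φ ψ) = ip ψ φ := inner_conj_symm _ _

theorem conj_Q (c : SphereCase) (ħ : ℝ) (z w : Fin c.m → ℂ) : conj (Q c ħ z w) = Q c ħ w z := by
  rw [Q_eq_ip, Q_eq_ip, conj_ip]

theorem Q_ne_zero_comm (c : SphereCase) (ħ : ℝ) (z w : Fin c.m → ℂ) :
    Q c ħ z w ≠ 0 ↔ Q c ħ w z ≠ 0 := by
  rw [← conj_Q, Ne, Ne, map_eq_zero]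

theorem Phi_ne_zero (c : SphereCase) (ħ : ℝ) (z : Fin c.m → ℂ) : Phi c ħ z ≠ 0 := by
  intro h
  have h1 := Q_zero_right c ħ z
  rw [Q_eq_ip, h, ip, inner_zero_left] at h1
  exact zero_ne_one h1

theorem ae_Q_smul_ne_zero (c : SphereCase) {ħ : ℝ} (hħ : 0 < ħ) (u z : Fin c.m → ℂ) :
    ∀ᵐ t : ℝ, Q c ħ (t • u) z ≠ 0 := by
  have hd := differentiable_bargmann_smul c hħ
    ⟨coherentFun c.n ħ (rho c z), continuous_coherentFun c.n ħ (rho c z)⟩ u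
  change Differentiable ℂ fun s : ℂ => Q c ħ (s • u) z at hd
  have han : AnalyticOnNhd ℝ (fun t : ℝ => Q c ħ ((t : ℂ) • u) z) Set.univ := by
    intro t _
    exact ((hd.analyticAt (t : ℂ)).restrictScalars (𝕜 := ℝ)).comp
      (Complex.ofRealCLM.analyticAt t)
  have h0 : Q c ħ (((0 : ℝ) : ℂ) • u) z ≠ 0 := by
    rw [Complex.ofReal_zero, zero_smul, Q_ne_zero_comm, Q_zero_right]
    exact one_ne_zero
  have hmem := han.preimage_zero_mem_codiscrete h0
  have hae := ae_restrict_le_codiscreteWithin (μ := (volume : Measure ℝ)) MeasurableSet.univ hmem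
  rw [Measure.restrict_univ] at hae
  filter_upwards [hae] with t ht
  simpa using ht

theorem ae_volume_Q_ne_zero (c : SphereCase) {ħ : ℝ} (hħ : 0 < ħ) (z : Fin c.m → ℂ) :
    ∀ᵐ u : Fin c.m → ℂ, Q c ħ u z ≠ 0 := by
  have hmeas : Measurable fun u => Q c ħ u z := measurable_bargmann_toLp c ħ
    ⟨coherentFun c.n ħ (rho c z), continuous_coherentFun c.n ħ (rho c z)⟩
  have hset : MeasurableSet {p : (Fin c.m → ℂ) × ℝ | Q c ħ (p.2 • p.1) z ≠ 0} := by
    have h2 : Measurable fun p : (Fin c.m → ℂ) × ℝ => Q c ħ (p.2 • p.1) z :=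
      hmeas.comp (by fun_prop)
    exact h2 (measurableSet_singleton 0).compl
  have h1 : ∀ᵐ u : Fin c.m → ℂ, ∀ᵐ t : ℝ, Q c ħ (t • u) z ≠ 0 :=
    Eventually.of_forall fun u => ae_Q_smul_ne_zero c hħ u z
  -- After exchanging the order, almost every scale `t` works for almost every `u`. Any such `t ≠ 0`
  -- suffices, because dilation by `t⁻¹` preserves null sets.
  rw [Measure.ae_ae_comm hset] at h1
  obtain ⟨t, ht, ht0⟩ := (h1.and (Measure.ae_ne volume (0 : ℝ))).exists
  have hq := Measure.quasiMeasurePreserving_smul (volume : Measure (Fin c.m → ℂ)) (inv_ne_zero ht0)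
  filter_upwards [hq.ae ht] with u hu
  rwa [smul_inv_smul₀ ht0] at hu

theorem ae_Q_ne_zero (c : SphereCase) {ħ : ℝ} (hħ : 0 < ħ) (z : Fin c.m → ℂ) :
    ∀ᵐ u ∂(gaussMeasure c.m ħ), Q c ħ z u ≠ 0 ∧ Q c ħ u z ≠ 0 := by
  have h : gaussMeasure c.m ħ ≪ volume := withDensity_absolutelyContinuous _ _
  filter_upwards [h.ae_le (ae_volume_Q_ne_zero c hħ z)] with u hu
  exact ⟨(Q_ne_zero_comm c ħ z u).2 hu, hu⟩

theorem extSymbol_mul_Q (c : SphereCase) {ħ : ℝ} (A : L2 c.n →L[ℂ] L2 c.n) {w z : Fin c.m → ℂ}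
    (h : Q c ħ w z ≠ 0) :
    extSymbol c ħ A w z * Q c ħ w z = ip (A (Phi c ħ z)) (Phi c ħ w) := by
  rw [Q_eq_ip] at h ⊢
  exact div_mul_cancel₀ _ h

theorem ip_adjoint {n : ℕ} (A : L2 n →L[ℂ] L2 n) (φ ψ : L2 n) :
    ip φ (ContinuousLinearMap.adjoint A ψ) = ip (A φ) ψ :=
  ContinuousLinearMap.adjoint_inner_left A φ ψ

end

end SphereBerezin

end

/-! ### The Berezin symbol calculus -/

open SphereBerezin in
theorem mainTheorem4 (c : SphereCase) (ħ : ℝ) (hħ : 0 < ħ) (A B : L2 c.n →L[ℂ] L2 c.n) :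
    -- the expressions below are defined almost everywhere in the integration variable
    (∀ z : Fin c.m → ℂ, ∀ᵐ u ∂(gaussMeasure c.m ħ), Q c ħ z u ≠ 0 ∧ Q c ħ u z ≠ 0) ∧
    -- the symbol of the identity
    (∀ z : Fin c.m → ℂ, symbol c ħ (ContinuousLinearMap.id ℂ (L2 c.n)) z = 1) ∧
    (∀ z w : Fin c.m → ℂ, Q c ħ z w ≠ 0 →
      extSymbol c ħ (ContinuousLinearMap.id ℂ (L2 c.n)) z w = 1) ∧
    -- the symbol of the adjoint
    (∀ z w : Fin c.m → ℂ, Q c ħ z w ≠ 0 →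
      extSymbol c ħ (ContinuousLinearMap.adjoint A) z w = conj (extSymbol c ħ A w z)) ∧
    -- the action of an operator through its symbol
    (∀ (φ : L2 c.n) (z : Fin c.m → ℂ),
      Integrable (fun u => bargmann c ħ φ u * extSymbol c ħ A z u * Q c ħ z u)
        (gaussMeasure c.m ħ) ∧
      bargmann c ħ (A φ) z =
        ∫ u, bargmann c ħ φ u * extSymbol c ħ A z u * Q c ħ z u ∂(gaussMeasure c.m ħ)) ∧
    -- the composition formula
    (∀ z w : Fin c.m → ℂ, Q c ħ z w ≠ 0 →
      Integrable (fun u => extSymbol c ħ B u w * extSymbol c ħ A z u *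
        (Q c ħ z u * Q c ħ u w / Q c ħ z w)) (gaussMeasure c.m ħ) ∧
      extSymbol c ħ (A ∘L B) z w =
        ∫ u, extSymbol c ħ B u w * extSymbol c ħ A z u *
          (Q c ħ z u * Q c ħ u w / Q c ħ z w) ∂(gaussMeasure c.m ħ)) := by
  refine ⟨fun z => ae_Q_ne_zero c hħ z, fun z => ?_, fun z w h => ?_, fun z w _ => ?_,
    fun φ z => ?_, fun z w h => ?_⟩
  · exact div_self (inner_self_ne_zero.2 (Phi_ne_zero c ħ z))
  · rw [Q_eq_ip] at h
    exact div_self h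
  · rw [extSymbol, extSymbol, map_div₀, conj_ip, conj_ip, ← conj_ip, ip_adjoint, conj_ip]
  -- Moving `A` to the other side, `⟨Aφ, Φ_z⟩ = ⟨φ, A*Φ_z⟩` is resolved over `u`. The factor `⟨Φ_u,
  -- A*Φ_z⟩ = ⟨AΦ_u, Φ_z⟩` is the symbol times `Q(z, u)` off the null set where `Q(z, u) = 0`.
  · obtain ⟨h1, h2⟩ := ip_resolution c hħ φ (ContinuousLinearMap.adjoint A (Phi c ħ z))
    have hae : (fun u => ip φ (Phi c ħ u) *
        ip (Phi c ħ u) (ContinuousLinearMap.adjoint A (Phi c ħ z))) =ᵐ[gaussMeasure c.m ħ]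
        fun u => bargmann c ħ φ u * extSymbol c ħ A z u * Q c ħ z u := by
      filter_upwards [ae_Q_ne_zero c hħ z] with u hu
      rw [mul_assoc, extSymbol_mul_Q c A hu.1, bargmann_eq_ip, ip_adjoint]
    exact ⟨h1.congr hae, by rw [← integral_congr_ae hae, h2, bargmann_eq_ip, ip_adjoint]⟩
  · obtain ⟨h1, h2⟩ := ip_resolution c hħ (B (Phi c ħ w))
      (ContinuousLinearMap.adjoint A (Phi c ħ z))
    have hae : (fun u => ip (B (Phi c ħ w)) (Phi c ħ u) *
        ip (Phi c ħ u) (ContinuousLinearMap.adjoint A (Phi c ħ z)) / Q c ħ z w)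
        =ᵐ[gaussMeasure c.m ħ] fun u => extSymbol c ħ B u w * extSymbol c ħ A z u *
          (Q c ħ z u * Q c ħ u w / Q c ħ z w) := by
      -- Both `Q(z, u)` and `Q(u, w)` must be nonzero to turn the two matrix elements into symbols;
      -- each fails only on a null set.
      filter_upwards [ae_Q_ne_zero c hħ z, ae_Q_ne_zero c hħ w] with u hu hw
      rw [ip_adjoint, ← extSymbol_mul_Q c A hu.1, ← extSymbol_mul_Q c B hw.2]
      ring
    refine ⟨(h1.div_const _).congr hae, ?_⟩
    rw [← integral_congr_ae hae, integral_div, h2, ip_adjoint, extSymbol, Q_eq_ip]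
    rfl
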